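/- A plane tree is a finite, rooted, ordered, unlabelled tree; $|T|$ denotes the number of nodes of $T$. Let $\xi$ be a random variable with values in $\{0,1,2,\dots\}$ such that $\mathbb{E}\,\xi = 1$ and $0 < \operatorname{Var}(\xi) < \infty$. Let $\mathcal{T}$ be the Galton–Watson tree with offspring distribution $\xi$: it is grown from a root by giving each node, independently, a random number of (ordered) children distributed as $\xi$. Let $\mathcal{T}_n$ be $\mathcal{T}$ conditioned on $|\mathcal{T}| = n$. Let $h := \gcd\{i \ge 1 : \mathbb{P}(\xi = i) > 0\}$; all limits below are taken as $n \to \infty$ along the integers $n$ with $n \equiv 1 \pmod h$ (for all sufficiently large such $n$ we have $\mathbb{P}(|\mathcal{T}|=n)>0$, so that $\mathcal{T}_n$ is well defined). For a plane tree $T$ let $\pi(T) := \mathbb{P}(\mathcal{T} = T)$, and let $N_T(\mathcal{T}_n)$ be the number of nodes $v$ of $\mathcal{T}_n$ such that the subtree of $\mathcal{T}_n$ rooted at $v$ (consisting of $v$ and all its descendants) is isomorphic to $T$ as a plane tree. Let $\mathrm{Po}(\lambda)$ be the Poisson distribution with mean $\lambda \ge 0$ (with $\mathrm{Po}(0)$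 the point mass at $0$), and let $d_{TV}(X,Y) := \sup_{A \subseteq \{0,1,2,\dots\}} |\mathbb{P}(X \in A) - \mathbb{P}(Y \in A)|$ be the total variation distance. Let $(k_n)$ be a sequence of non-negative integers with $k_n \to \infty$ and $k_n = o(n)$. Then $$\lim_{n\to\infty}\ \sup_{T : |T| = k_n} d_{TV}\big(N_T(\mathcal{T}_n), \mathrm{Po}(n\pi(T))\big) = 0 .$$ Consequently, if $(T_n)$ is a sequence of plane trees with $|T_n| = k_n$ (for all large $n$), then: (i) if $n\pi(T_n) \to 0$, then $\mathbb{P}(N_{T_n}(\mathcal{T}_n) = 0) \to 1$; (ii) if $n\pi(T_n) \to \mu \in (0,\infty)$, then $N_{T_n}(\mathcal{T}_n)$ converges in distribution to $\mathrm{Po}(\mu)$; (iii) if $n\pi(T_n) \to \infty$, then $\dfrac{N_{T_n}(\mathcal{T}_n) - n\pi(T_n)}{\sqrt{n\pi(T_n)}}$ converges in distribution to the standard normal distribution $N(0,1)$. -/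

import Mathlib

open MeasureTheory ProbabilityTheory Filter Topology Asymptotics
open scoped NNReal ENNReal

noncomputable section

/-- A (finite, rooted, ordered, unlabelled) plane tree, coded by its set of nodes in Ulam-Harris
notation: the root is the empty word `[]`, and the children of a node `u` are, from left to right,
`u ++ [0], u ++ [1], …`. Two plane trees are isomorphic exactly when their node sets agree. -/
structure PlaneTree where
  nodes : Finset (List ℕ)
  root_mem : [] ∈ nodes
  parent_mem : ∀ (u : List ℕ) (i : ℕ), u ++ [i] ∈ nodes → u ∈ nodes
  sibling_mem : ∀ (u : List ℕ) (i j : ℕ), j < i → u ++ [i] ∈ nodes → u ++ [j] ∈ nodes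

/-- The size `|T|`, the number of nodes. -/
def PlaneTree.size (T : PlaneTree) : ℕ := T.nodes.card

/-- The subtree of `t` rooted at the node `v` (a node set in Ulam-Harris notation again). -/
def fringeAt (t : Set (List ℕ)) (v : List ℕ) : Set (List ℕ) := {w | v ++ w ∈ t}

/-- The number of nodes `v` of `t` whose fringe subtree has shape `T`. -/
def fringeCount (T : PlaneTree) (t : Set (List ℕ)) : ℕ :=
  {v : List ℕ | v ∈ t ∧ fringeAt t v = (T.nodes : Set (List ℕ))}.ncard

/-- The node set of the (possibly infinite) tree that is grown from the root when each node `u`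
is given `x u` children: a word is a node iff each of its letters is admissible at its position. -/
def grownTree (x : List ℕ → ℕ) : Set (List ℕ) :=
  {u | ∀ (w : List ℕ) (i : ℕ), (w ++ [i]) <+: u → i < x w}

/-- The probability space of the Galton-Watson tree: the numbers of children `x u`, for `u` in the
Ulam-Harris tree, are independent with the offspring law `ν`. The (unconditional) Galton-Watson tree
is the random tree `grownTree` on this space. -/
def gwMeasure (ν : Measure ℕ) : Measure (List ℕ → ℕ) :=
  Measure.infinitePi (fun _ : List ℕ => ν)

/-- `π(T)`: the probability that the Galton-Watson tree equals `T`. -/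
def treeProb (ν : Measure ℕ) (T : PlaneTree) : ℝ≥0 :=
  (gwMeasure ν {x | grownTree x = (T.nodes : Set (List ℕ))}).toNNReal

/-- The Galton-Watson measure conditioned on the tree having exactly `n` nodes. Under this measure
`grownTree` is the conditional Galton-Watson tree of size `n`. -/
def gwCond (ν : Measure ℕ) (n : ℕ) : Measure (List ℕ → ℕ) :=
  ProbabilityTheory.cond (gwMeasure ν) {x | (grownTree x).encard = n}

instance (ν : Measure ℕ) (n : ℕ) : IsFiniteMeasure (gwCond ν n) := by
  unfold gwCond; infer_instance

/-- The law of the number of fringe subtrees of shape `T` in the conditional Galton-Watson tree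
of size `n`. -/
def fringeCountLaw (ν : Measure ℕ) (n : ℕ) (T : PlaneTree) : Measure ℕ :=
  (gwCond ν n).map (fun x => fringeCount T (grownTree x))

instance (ν : Measure ℕ) (n : ℕ) (T : PlaneTree) : IsFiniteMeasure (fringeCountLaw ν n T) := by
  unfold fringeCountLaw; infer_instance

/-- The span of the offspring law: the greatest common divisor of all `i ≥ 1` of positive
probability. -/
def offspringSpan (ν : Measure ℕ) : ℕ := Nat.setGcd {i | 1 ≤ i ∧ ν {i} ≠ 0}

/-- The filter "`n → ∞` along `n - 1 ≡ 0 (mod h)`", with `h` the span of the offspring law. -/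
def alongSpan (ν : Measure ℕ) : Filter ℕ :=
  atTop ⊓ 𝓟 {n | n ≡ 1 [MOD offspringSpan ν]}

/-- Total variation distance of two laws on `ℕ`: the supremum over all events of the difference
of their probabilities. -/
def tvDist (μ₁ μ₂ : Measure ℕ) : ℝ := ⨆ A : Set ℕ, |μ₁.real A - μ₂.real A|

/-- Convergence in distribution: weak convergence of the laws `μ n` to `μ₀` along the filter `l`. -/
def ConvergesInLaw {E : Type*} [TopologicalSpace E] [MeasurableSpace E] [OpensMeasurableSpace E]
    (μ : ℕ → Measure E) [∀ n, IsFiniteMeasure (μ n)] (l : Filter ℕ)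
    (μ₀ : Measure E) [IsFiniteMeasure μ₀] : Prop :=
  Tendsto (β := FiniteMeasure E) (fun n => ⟨μ n, inferInstance⟩) l
    (@nhds (FiniteMeasure E) _ ⟨μ₀, inferInstance⟩)

end

/-! A tree is encoded by the numbers of children of its nodes in depth-first order. These codes are
self-delimiting, so a fringe subtree of shape `T` is the same as an occurrence of the code of `T` as
a factor of the code of the large tree. By the cycle lemma exactly one rotation of a word of length
`n` with sum `n - 1` is a tree code, and cyclic occurrences do not change under rotation. Hence the
fringe count has the law of the number `W` of cyclic occurrences of a fixed word of length `k` in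
`n` independent offspring variables conditioned on their sum being `n - 1`
(`PlaneForest.fringeCountLaw_eq`).

For this model Stein's method gives a Poisson bound (`abs_cond_sub_poisson_le`). Let `p = π(T)` be
the probability of the word at a given place and `θ` the probability that a block of length `k` has
the right sum `k - 1`. A tree code cannot overlap itself, so an occurrence at `i` excludes all
others meeting its block. Conditioning on the total sum sees a block only through its sum; therefore
the indicator of an occurrence may be exchanged for `p / θ` times the indicator of the right block
sum. The number of blocks with the right sum is concentrated around `n * θ`, by a variance bound,
and this leads to an error of order `k * √(p / θ)`, with no dependence on `n`.

Two inputs finish the estimate. Conditioning on the sum costs only a constant factor for quantities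
that leave a positive fraction of the variables free; this needs upper and lower bounds of order `m
^ (-1/2)` for point probabilities of sums of `m` variables, obtained by Fourier inversion. The same
lower bound gives `θ ≥ c / √k`, while `p ≤ ρ ^ k`, where `ρ < 1` bounds all atoms of the offspring
law. So the distance is at most `C * k ^ 2 * η ^ k` with `η < 1`, uniformly over trees of size `k`
(`exists_tvDist_fringeCountLaw_le`). The three limit statements then follow from the corresponding
facts about Poisson laws. -/

/-! ### Plane forests, their depth-first codes, and fringe subtrees as occurrences of words. -/

/-- A plane forest: either empty, or a first tree (given by the forest `c` of the subtrees at the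
children of its root) followed by a forest `r`. A plane tree is coded by the forest of the subtrees
at the children of its root. -/
inductive PlaneForest where
  | nil : PlaneForest
  | cons (c r : PlaneForest) : PlaneForest

namespace PlaneForest

/-- The number of trees of a forest. -/
def numTrees : PlaneForest → ℕ
  | nil => 0
  | cons _ r => numTrees r + 1

/-- The numbers of children of the nodes of a forest, in depth-first order. -/
def code : PlaneForest → List ℕ
  | nil => []
  | cons c r => numTrees c :: (code c ++ code r)

/-- The numbers of children of the nodes, in depth-first order, of the tree with root forest `f`. -/
def treeCode (f : PlaneForest) : List ℕ := numTrees f :: code f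

/-- Membership of a word in the tree with root forest `f`. -/
def Mem : PlaneForest → List ℕ → Prop
  | _, [] => True
  | nil, _ :: _ => False
  | cons c _, 0 :: w => Mem c w
  | cons _ r, (i + 1) :: w => Mem r (i :: w)

/-- The node set of the tree with root forest `f`. -/
def nodeSet (f : PlaneForest) : Set (List ℕ) := {v | Mem f v}

/-- The number of children of a node in the tree with root forest `f`. -/
def childCount : PlaneForest → List ℕ → ℕ
  | f, [] => numTrees f
  | nil, _ :: _ => 0
  | cons c _, 0 :: w => childCount c w
  | cons _ r, (i + 1) :: w => childCount r (i :: w)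

/-- Shift a node to the next sibling tree. -/
def bump : List ℕ → List ℕ
  | [] => []
  | i :: w => (i + 1) :: w

/-- The nodes other than the root, in depth-first order, of the tree with root forest `f`. -/
def nodeList : PlaneForest → List (List ℕ)
  | nil => []
  | cons c r => [0] :: ((nodeList c).map (List.cons 0) ++ (nodeList r).map bump)

@[simp] theorem mem_nil (f : PlaneForest) : Mem f [] := by cases f <;> trivial

@[simp] theorem not_mem_nil_cons (i : ℕ) (w : List ℕ) : ¬ Mem nil (i :: w) := id

@[simp] theorem mem_cons_zero (c r : PlaneForest) (w : List ℕ) :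
    Mem (cons c r) (0 :: w) ↔ Mem c w := Iff.rfl

@[simp] theorem mem_cons_succ (c r : PlaneForest) (i : ℕ) (w : List ℕ) :
    Mem (cons c r) ((i + 1) :: w) ↔ Mem r (i :: w) := Iff.rfl

@[simp] theorem childCount_nil (f : PlaneForest) : childCount f [] = numTrees f := by
  cases f <;> rfl

theorem mem_append_singleton (f : PlaneForest) (v : List ℕ) (i : ℕ) :
    Mem f (v ++ [i]) ↔ Mem f v ∧ i < childCount f v := by
  induction f generalizing v i with
  | nil => cases v <;> simp [numTrees]
  | cons c r ihc ihr =>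
    match v with
    | [] =>
      cases i with
      | zero => simp [numTrees]
      | succ i => simpa [numTrees] using ihr [] i
    | 0 :: w => simpa [childCount] using ihc w i
    | (j + 1) :: w => simpa [childCount] using ihr (j :: w) i

theorem grownTree_append_singleton (x : List ℕ → ℕ) (v : List ℕ) (i : ℕ) :
    v ++ [i] ∈ grownTree x ↔ v ∈ grownTree x ∧ i < x v := by
  simp only [grownTree, Set.mem_ofPred_eq]
  constructor
  · intro h
    exact ⟨fun w j hw => h w j (hw.trans (List.prefix_append _ _)), h v i List.prefix_rfl⟩
  · rintro ⟨h1, h2⟩ w j hw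
    rcases List.prefix_concat_iff.1 (by simpa using hw) with h | h
    · obtain ⟨rfl, h'⟩ := List.append_inj' h rfl
      obtain rfl : j = i := by simpa using h'
      exact h2
    · exact h1 w j h

theorem nil_mem_grownTree (x : List ℕ → ℕ) : [] ∈ grownTree x := by
  intro w i h
  simp at h

/-- A tree is determined by the child counts at its own nodes. This makes the event a cylinder over
finitely many coordinates, so that its probability is a finite product. -/
theorem grownTree_eq_nodeSet_iff (x : List ℕ → ℕ) (f : PlaneForest) :
    grownTree x = nodeSet f ↔ ∀ v, Mem f v → x v = childCount f v := by
  constructor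
  · intro h v hv
    have hv' : v ∈ grownTree x := h ▸ hv
    have key : ∀ i, i < x v ↔ i < childCount f v := by
      intro i
      have h1 := grownTree_append_singleton x v i
      have h2 := mem_append_singleton f v i
      have h3 : v ++ [i] ∈ grownTree x ↔ Mem f (v ++ [i]) := by rw [h]; rfl
      tauto
    exact le_antisymm (not_lt.1 fun hlt => lt_irrefl _ ((key _).1 hlt))
      (not_lt.1 fun hlt => lt_irrefl _ ((key _).2 hlt))
  · intro h
    ext v
    induction v using List.reverseRecOn with
    | nil => exact iff_of_true (nil_mem_grownTree x) (mem_nil f)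
    | append_singleton v i ih =>
      rw [grownTree_append_singleton]
      change _ ↔ Mem f (v ++ [i])
      rw [mem_append_singleton]
      change _ ↔ Mem f v at ih
      rw [ih]
      exact and_congr_right fun hv => by rw [h v hv]

theorem ne_nil_of_mem_nodeList {f : PlaneForest} {v : List ℕ} (h : v ∈ nodeList f) : v ≠ [] := by
  induction f generalizing v with
  | nil => simp [nodeList] at h
  | cons c r _ ihr =>
    simp only [nodeList, List.mem_cons, List.mem_append, List.mem_map] at h
    rcases h with rfl | ⟨w, _, rfl⟩ | ⟨w, hw, rfl⟩
    · simp
    · simp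
    · cases w with
      | nil => exact absurd rfl (ihr hw)
      | cons i w => simp [bump]

theorem mem_nodeList (f : PlaneForest) (v : List ℕ) : v ∈ nodeList f ↔ Mem f v ∧ v ≠ [] := by
  induction f generalizing v with
  | nil => cases v <;> simp [nodeList]
  | cons c r ihc ihr =>
    simp only [nodeList, List.mem_cons, List.mem_append, List.mem_map]
    constructor
    · rintro (rfl | ⟨w, hw, rfl⟩ | ⟨w, hw, rfl⟩)
      · simp
      · simpa using ((ihc w).1 hw).1
      · cases w with
        | nil => exact absurd rfl (ne_nil_of_mem_nodeList hw)
        | cons i w => simpa [bump] using ((ihr _).1 hw).1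
    · rintro ⟨h1, h2⟩
      match v with
      | [] => exact absurd rfl h2
      | [0] => simp
      | 0 :: j :: w => exact Or.inr (Or.inl ⟨j :: w, (ihc _).2 ⟨h1, by simp⟩, rfl⟩)
      | (i + 1) :: w => exact Or.inr (Or.inr ⟨i :: w, (ihr _).2 ⟨h1, by simp⟩, rfl⟩)

theorem nodup_nodeList (f : PlaneForest) : (nodeList f).Nodup := by
  induction f with
  | nil => simp [nodeList]
  | cons c r ihc ihr =>
    have hb : ∀ w ∈ nodeList r, ∃ i u, w = i :: u ∧ bump w = (i + 1) :: u := by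
      intro w hw
      cases w with
      | nil => exact absurd rfl (ne_nil_of_mem_nodeList hw)
      | cons i u => exact ⟨i, u, rfl, rfl⟩
    rw [nodeList, List.nodup_cons, List.nodup_append]
    refine ⟨?_, ihc.map (List.cons_injective), ?_, ?_⟩
    · simp only [List.mem_append, List.mem_map, not_or, not_exists, not_and]
      refine ⟨fun w hw h => ne_nil_of_mem_nodeList hw (by simpa using h), fun w hw h => ?_⟩
      obtain ⟨i, u, rfl, h'⟩ := hb w hw
      rw [h'] at h; simp at h
    · refine ihr.map_on fun a ha b hb' hab => ?_
      obtain ⟨i, u, rfl, h'⟩ := hb a ha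
      obtain ⟨j, u', rfl, h''⟩ := hb b hb'
      rw [h', h''] at hab
      simpa using hab
    · intro a ha b hb' hab
      obtain ⟨w, _, rfl⟩ := List.mem_map.1 ha
      obtain ⟨w', hw', rfl⟩ := List.mem_map.1 hb'
      obtain ⟨i, u, rfl, h'⟩ := hb w' hw'
      rw [h'] at hab; simp at hab

theorem code_eq_map (f : PlaneForest) : code f = (nodeList f).map (childCount f) := by
  induction f with
  | nil => rfl
  | cons c r ihc ihr =>
    simp only [code, nodeList, List.map_cons, List.map_append, List.map_map]
    congr 1
    · simp [childCount]
    · congr 1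
      rw [ihr]
      refine List.map_congr_left fun v hv => ?_
      cases v with
      | nil => exact absurd rfl (ne_nil_of_mem_nodeList hv)
      | cons i w => rfl

theorem treeCode_eq_map (f : PlaneForest) :
    treeCode f = ([] :: nodeList f).map (childCount f) := by
  simp [treeCode, code_eq_map]

theorem nodup_cons_nodeList (f : PlaneForest) : ([] :: nodeList f).Nodup :=
  List.nodup_cons.2 ⟨fun h => ne_nil_of_mem_nodeList h rfl, nodup_nodeList f⟩

theorem mem_cons_nodeList (f : PlaneForest) (v : List ℕ) : v ∈ [] :: nodeList f ↔ Mem f v := by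
  rw [List.mem_cons, mem_nodeList]
  by_cases h : v = [] <;> simp [h]

theorem nodeSet_eq_toFinset (f : PlaneForest) :
    nodeSet f = (([] :: nodeList f).toFinset : Set (List ℕ)) := by
  ext v
  rw [Finset.mem_coe, List.mem_toFinset, mem_cons_nodeList]
  rfl

theorem encard_nodeSet (f : PlaneForest) : (nodeSet f).encard = (treeCode f).length := by
  rw [nodeSet_eq_toFinset, Set.encard_coe_eq_coe_finsetCard,
    List.toFinset_card_of_nodup (nodup_cons_nodeList f), treeCode_eq_map, List.length_map]

theorem nodeSet_injective : Function.Injective nodeSet := by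
  intro f g h
  replace h : ∀ v, Mem f v ↔ Mem g v := fun v => Set.ext_iff.1 h v
  induction f generalizing g with
  | nil =>
    cases g with
    | nil => rfl
    | cons c r => simpa using h [0]
  | cons c r ihc ihr =>
    cases g with
    | nil => simpa using h [0]
    | cons c' r' =>
      rw [ihc (g := c') fun v => by simpa using h (0 :: v)]
      rw [ihr (g := r') fun v => ?_]
      cases v with
      | nil => simp
      | cons i w => simpa using h ((i + 1) :: w)

/-- Codes are self-delimiting: once the number of trees is known, reading from the left reveals
where the forest ends, whatever follows it. -/
theorem code_append_inj {f g : PlaneForest} {u v : List ℕ} (hn : numTrees f = numTrees g)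
    (h : code f ++ u = code g ++ v) : f = g ∧ u = v := by
  induction f generalizing g u v with
  | nil =>
    cases g with
    | nil => exact ⟨rfl, by simpa [code] using h⟩
    | cons c r => simp [numTrees] at hn
  | cons c r ihc ihr =>
    cases g with
    | nil => simp [numTrees] at hn
    | cons c' r' =>
      simp only [code, List.cons_append, List.append_assoc, List.cons.injEq] at h
      obtain ⟨rfl, h2⟩ := ihc h.1 h.2
      obtain ⟨rfl, h3⟩ := ihr (by simpa [numTrees] using hn) h2
      exact ⟨rfl, h3⟩

theorem treeCode_isPrefix_iff {f g : PlaneForest} {u : List ℕ} :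
    treeCode f <+: treeCode g ++ u ↔ g = f := by
  constructor
  · rintro ⟨v, hv⟩
    simp only [treeCode, List.cons_append, List.cons.injEq] at hv
    exact (code_append_inj hv.1 hv.2).1.symm
  · rintro rfl
    exact List.prefix_append _ _

theorem treeCode_injective : Function.Injective treeCode := by
  intro f g h
  exact treeCode_isPrefix_iff (u := []).1 (by rw [h]; simp)

instance : Countable PlaneForest := treeCode_injective.countable

/-- Splitting off the first `d` trees. In decoding a word, these become the subtrees below a node
with `d` children, and the remaining trees become its right siblings. -/
theorem exists_code_eq_append (f : PlaneForest) (d : ℕ) (hd : d ≤ numTrees f) :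
    ∃ c r, numTrees c = d ∧ numTrees f = d + numTrees r ∧ code f = code c ++ code r := by
  induction f generalizing d with
  | nil => exact ⟨nil, nil, by simp_all [numTrees, code]⟩
  | cons c r _ ihr =>
    cases d with
    | zero => exact ⟨nil, cons c r, by simp [numTrees, code]⟩
    | succ d =>
      obtain ⟨c', r', h1, h2, h3⟩ := ihr d (by simpa [numTrees] using hd)
      exact ⟨cons c c', r', by simp [numTrees, h1], by simp [numTrees, h2]; omega,
        by simp [code, h3]⟩

/-- A word whose partial sums satisfy the Łukasiewicz condition is the code of a forest. -/
theorem exists_code_eq (w : List ℕ) (j : ℕ) (h1 : ∀ m < w.length, m < j + (w.take m).sum)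
    (h2 : w.length = j + w.sum) : ∃ f, numTrees f = j ∧ code f = w := by
  induction w generalizing j with
  | nil => exact ⟨nil, by simp_all [numTrees, code]⟩
  | cons d w ih =>
    have hj : 0 < j := by simpa using h1 0 (by simp)
    -- Reading the letter `d` replaces one pending tree by `d` pending trees.
    obtain ⟨g, hg1, hg2⟩ := ih (j - 1 + d) (fun m hm => by
      have := h1 (m + 1) (by simpa using hm)
      simp only [List.take_succ_cons, List.sum_cons] at this
      omega) (by simp only [List.length_cons, List.sum_cons] at h2; omega)
    obtain ⟨c, r, h3, h4, h5⟩ := exists_code_eq_append g d (by omega)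
    exact ⟨cons c r, by simp only [numTrees]; omega, by simp [code, h3, ← h5, hg2]⟩

theorem length_code (f : PlaneForest) : (code f).length = numTrees f + (code f).sum := by
  induction f with
  | nil => rfl
  | cons c r ihc ihr =>
    simp only [code, numTrees, List.length_cons, List.length_append, List.sum_cons,
      List.sum_append]
    omega

/-- After `m` nodes the right-hand side counts the roots and all children announced so far; it
exceeds `m` as long as some node is still to be read. -/
theorem lt_sum_take_code (f : PlaneForest) (m : ℕ) (hm : m < (code f).length) :
    m < numTrees f + ((code f).take m).sum := by
  induction f generalizing m with
  | nil => simp [code] at hm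
  | cons c r ihc ihr =>
    cases m with
    | zero => simp [numTrees]
    | succ m =>
      simp only [code, List.length_cons, List.length_append] at hm
      simp only [code, numTrees, List.take_succ_cons, List.sum_cons, List.take_append,
        List.sum_append]
      rcases lt_or_ge m (code c).length with h | h
      · have := ihc m h
        omega
      · have := ihr (m - (code c).length) (by omega)
        have h3 := length_code c
        rw [List.take_of_length_le h]
        omega

theorem exists_treeCode_eq_iff (w : List ℕ) :
    (∃ f, treeCode f = w) ↔
      (∀ m < w.length, m ≤ (w.take m).sum) ∧ w.length = 1 + w.sum := by
  constructor
  · rintro ⟨f, rfl⟩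
    refine ⟨fun m hm => ?_, ?_⟩
    · cases m with
      | zero => simp
      | succ m =>
        have := lt_sum_take_code f m (by simpa [treeCode] using hm)
        simp only [treeCode, List.take_succ_cons, List.sum_cons]
        omega
    · simp [treeCode, length_code f]
      omega
  · rintro ⟨h1, h2⟩
    obtain ⟨f, hf1, hf2⟩ := exists_code_eq w 1 (fun m hm => by have := h1 m hm; omega) h2
    cases f with
    | nil => simp [numTrees] at hf1
    | cons c r =>
      cases r with
      | nil => exact ⟨c, by simpa [code, treeCode] using hf2⟩
      | cons c' r' => simp [numTrees] at hf1

/-- The tree whose root has the subtrees in `l`. -/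
def ofList (l : List PlaneForest) : PlaneForest := l.foldr cons nil

theorem mem_ofList (l : List PlaneForest) (i : ℕ) (w : List ℕ) :
    Mem (ofList l) (i :: w) ↔ ∃ h : i < l.length, Mem l[i] w := by
  induction l generalizing i with
  | nil => simp [ofList]
  | cons c l ih =>
    cases i with
    | zero => simp [ofList]
    | succ i => simpa [ofList] using ih i

theorem cons_mem_grownTree (x : List ℕ → ℕ) (i : ℕ) (w : List ℕ) :
    i :: w ∈ grownTree x ↔ i < x [] ∧ w ∈ grownTree (fun u => x (i :: u)) := by
  induction w using List.reverseRecOn with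
  | nil =>
    have := grownTree_append_singleton x [] i
    simpa [nil_mem_grownTree] using this
  | append_singleton w j ih =>
    rw [← List.cons_append, grownTree_append_singleton, grownTree_append_singleton, ih]
    tauto

/-- Induction on the number of nodes: the subtree at a child of the root embeds into the tree
without its root, hence is smaller. -/
theorem exists_nodeSet_eq_grownTree (x : List ℕ → ℕ) (hx : (grownTree x).Finite) :
    ∃ f, grownTree x = nodeSet f := by
  induction hn : (grownTree x).ncard using Nat.strong_induction_on generalizing x with
  | _ n ih =>
    have key : ∀ i < x [], ∃ f, grownTree (fun u => x (i :: u)) = nodeSet f := by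
      intro i hi
      have hsub : List.cons i '' grownTree (fun u => x (i :: u)) ⊆ grownTree x \ {[]} := by
        rintro _ ⟨w, hw, rfl⟩
        exact ⟨(cons_mem_grownTree x i w).2 ⟨hi, hw⟩, by simp⟩
      have hfin : (grownTree (fun u => x (i :: u))).Finite :=
        Set.Finite.of_finite_image ((hx.subset Set.sdiff_subset).subset hsub)
          (List.cons_injective.injOn)
      refine ih _ ?_ _ hfin rfl
      rw [← hn, ← Set.ncard_image_of_injective _ (List.cons_injective (a := i))]
      refine (Set.ncard_le_ncard hsub (hx.subset Set.sdiff_subset)).trans_lt ?_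
      exact Set.ncard_sdiff_singleton_lt_of_mem (nil_mem_grownTree x) hx
    choose g hg using key
    refine ⟨ofList (List.ofFn fun i : Fin (x []) => g i i.2), ?_⟩
    ext v
    cases v with
    | nil => exact iff_of_true (nil_mem_grownTree x) (mem_nil _)
    | cons i w =>
      rw [cons_mem_grownTree]
      change _ ↔ Mem _ _
      rw [mem_ofList]
      simp only [List.length_ofFn, List.getElem_ofFn]
      constructor
      · rintro ⟨hi, hw⟩
        exact ⟨hi, by rw [hg i hi] at hw; exact hw⟩
      · rintro ⟨hi, hw⟩
        exact ⟨hi, by rw [hg i hi]; exact hw⟩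

theorem fringeAt_cons_zero (c r : PlaneForest) (v : List ℕ) :
    fringeAt (nodeSet (cons c r)) (0 :: v) = fringeAt (nodeSet c) v := rfl

theorem fringeAt_nil (t : Set (List ℕ)) : fringeAt t [] = t := rfl

open Classical in
/-- The number of positions in `u` where the word `p` starts in `u ++ rest`. -/
noncomputable def occurrences (p : List ℕ) : List ℕ → List ℕ → ℕ
  | [], _ => 0
  | a :: u, rest => (if p <+: a :: (u ++ rest) then 1 else 0) + occurrences p u rest

theorem occurrences_append (p u v rest : List ℕ) :
    occurrences p (u ++ v) rest = occurrences p u (v ++ rest) + occurrences p v rest := by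
  induction u with
  | nil => simp [occurrences]
  | cons a u ih => simp [occurrences, ih, add_assoc]

-- The code of the subtree at a node starts at the position of that node. Since tree codes are
-- prefix-free, `treeCode f₀` starts there exactly when that subtree is `f₀`, and then it ends
-- within the code of `f`. This is why `rest` plays no role and may later be chosen as a second copy
-- of the word.
open Classical in
theorem occurrences_code (f₀ f : PlaneForest) (rest : List ℕ) :
    occurrences (treeCode f₀) (code f) rest =
      (nodeList f).countP (fun v => fringeAt (nodeSet f) v = nodeSet f₀) := by
  induction f generalizing rest with
  | nil => rfl
  | cons c r ihc ihr =>
    simp only [code, occurrences, nodeList, occurrences_append, List.countP_cons,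
      List.countP_append, List.countP_map, ihc, ihr]
    have h1 : treeCode f₀ <+: numTrees c :: (code c ++ code r ++ rest) ↔
        fringeAt (nodeSet (cons c r)) [0] = nodeSet f₀ := by
      rw [fringeAt_cons_zero, fringeAt_nil, nodeSet_injective.eq_iff,
        ← treeCode_isPrefix_iff (u := code r ++ rest)]
      simp [treeCode]
    have h2 : ∀ v ∈ nodeList r, fringeAt (nodeSet (cons c r)) (bump v) =
        fringeAt (nodeSet r) v := by
      intro v hv
      cases v with
      | nil => exact absurd rfl (ne_nil_of_mem_nodeList hv)
      | cons i w => rfl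
    have h3 : (nodeList r).countP ((fun v => decide (fringeAt (nodeSet (cons c r)) v =
        nodeSet f₀)) ∘ bump) = (nodeList r).countP
          (fun v => decide (fringeAt (nodeSet r) v = nodeSet f₀)) := by
      refine List.countP_congr fun v hv => ?_
      simp [h2 v hv]
    rw [h3]
    simp only [h1, decide_eq_true_eq]
    have h4 : ((fun v => decide (fringeAt (nodeSet (cons c r)) v = nodeSet f₀)) ∘ List.cons 0) =
      fun v => decide (fringeAt (nodeSet c) v = nodeSet f₀) := rfl
    rw [h4]
    omega

/-- The number of fringe subtrees of a given shape is the number of occurrences of the code of the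
shape in the cyclic code of the tree. -/
theorem fringeCount_nodeSet (T : PlaneTree) (f₀ f : PlaneForest)
    (hT : (T.nodes : Set (List ℕ)) = nodeSet f₀) (rest : List ℕ) :
    fringeCount T (nodeSet f) = occurrences (treeCode f₀) (treeCode f) rest := by
  classical
  have h1 : {v : List ℕ | v ∈ nodeSet f ∧ fringeAt (nodeSet f) v = (T.nodes : Set (List ℕ))} =
      ((([] :: nodeList f).filter
        (fun v => fringeAt (nodeSet f) v = nodeSet f₀)).toFinset : Set (List ℕ)) := by
    ext v
    rw [Set.mem_ofPred_eq, Finset.mem_coe, List.mem_toFinset, List.mem_filter, mem_cons_nodeList,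
      decide_eq_true_eq, hT]
    rfl
  rw [fringeCount, h1, Set.ncard_coe_finset,
    List.toFinset_card_of_nodup ((nodup_cons_nodeList f).filter _), ← List.countP_eq_length_filter,
    List.countP_cons, ← occurrences_code f₀ f rest, treeCode.eq_def f, occurrences, add_comm]
  congr 1
  rw [fringeAt_nil]
  simp only [nodeSet_injective.eq_iff, decide_eq_true_eq, ← treeCode_isPrefix_iff (u := rest)]
  rfl

/-- Sibling closure and finiteness make the children of every word an initial segment of `ℕ`;
growing a tree with these child counts gives `T` back. -/
theorem _root_.PlaneTree.exists_nodes_eq (T : PlaneTree) :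
    ∃ f : PlaneForest, (T.nodes : Set (List ℕ)) = nodeSet f := by
  classical
  have hx : ∀ v, ∃ d, ∀ i, v ++ [i] ∈ T.nodes ↔ i < d := by
    intro v
    have hfin : {i | v ++ [i] ∈ T.nodes}.Finite :=
      Set.Finite.of_finite_image (T.nodes.finite_toSet.subset (by
        rintro _ ⟨i, hi, rfl⟩; exact hi))
        (f := fun i => v ++ [i]) (fun a _ b _ h => by simpa using h)
    have hex : ∃ d, v ++ [d] ∉ T.nodes := by
      by_contra! h
      exact Set.infinite_univ (hfin.subset fun i _ => h i)
    refine ⟨Nat.find hex, fun i => ⟨fun hi => ?_, fun hi => ?_⟩⟩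
    · by_contra hlt
      rcases (not_lt.1 hlt).lt_or_eq with h | h
      · exact Nat.find_spec hex (T.sibling_mem v i _ h hi)
      · exact Nat.find_spec hex (h ▸ hi)
    · by_contra h
      exact Nat.find_min hex hi h
  choose x hx using hx
  have h : grownTree x = (T.nodes : Set (List ℕ)) := by
    ext v
    induction v using List.reverseRecOn with
    | nil => exact iff_of_true (nil_mem_grownTree x) T.root_mem
    | append_singleton v i ih =>
      rw [grownTree_append_singleton, ih, ← hx, Finset.mem_coe, Finset.mem_coe]
      exact ⟨fun h => h.2, fun h => ⟨T.parent_mem v i h, h⟩⟩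
  obtain ⟨f, hf⟩ := exists_nodeSet_eq_grownTree x (h ▸ T.nodes.finite_toSet)
  exact ⟨f, h ▸ hf⟩

/-- The code of a tree does not overlap itself. -/
theorem treeCode_drop_not_isPrefix (f : PlaneForest) (m : ℕ) (h0 : 0 < m)
    (hm : m < (treeCode f).length) : ¬ (treeCode f).drop m <+: treeCode f := by
  intro h
  obtain ⟨h1, h2⟩ := (exists_treeCode_eq_iff (treeCode f)).1 ⟨f, rfl⟩
  set w := treeCode f
  -- If the suffix `w.drop m` is also a prefix, then both `w.take m` and `w.drop m` have sum at
  -- least their length, so the total sum is at least the length of `w`. It is one less.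
  have h3 := h1 m hm
  have h4 := h1 (w.length - m) (by omega)
  have h5 : w.take (w.length - m) = w.drop m := by
    rw [List.prefix_iff_eq_take.1 h, List.length_drop]
  rw [h5] at h4
  have h6 : w.sum = (w.take m).sum + (w.drop m).sum := by
    rw [← List.sum_append, List.take_append_drop]
  omega

end PlaneForest

/-! ### Cyclic words, the cycle lemma and rotation invariance. -/

section Cyclic

variable {n : ℕ} [NeZero n]

/-- The word `p` occurs in the cyclic word `x` at position `i`. -/
def OccursAt (p : List ℕ) (x : Fin n → ℕ) (i : Fin n) : Prop :=
  ∀ (j : ℕ) (h : j < p.length), x (i + Fin.ofNat n j) = p[j]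

open Classical in
/-- The number of occurrences of the word `p` in the cyclic word `x`. -/
noncomputable def cyclicCount (p : List ℕ) (x : Fin n → ℕ) : ℕ :=
  (Finset.univ.filter (OccursAt p x)).card

theorem cyclicCount_add_left (p : List ℕ) (x : Fin n → ℕ) (r : Fin n) :
    cyclicCount p (fun i => x (r + i)) = cyclicCount p x := by
  classical
  unfold cyclicCount
  refine Finset.card_equiv (Equiv.addLeft r) fun i => ?_
  simp [OccursAt, add_assoc]

open Classical in
theorem PlaneForest.occurrences_eq_sum (p u rest : List ℕ) :
    PlaneForest.occurrences p u rest =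
      ∑ i ∈ Finset.range u.length, if p <+: (u ++ rest).drop i then 1 else 0 := by
  induction u with
  | nil => rfl
  | cons a u ih =>
    rw [PlaneForest.occurrences, ih, List.length_cons, Finset.sum_range_succ', add_comm]
    rfl

/-- A second copy of the word imitates wrapping around; one copy suffices because `p` is not longer
than the word. -/
theorem occurrences_ofFn (p : List ℕ) (x : Fin n → ℕ) (hp : p.length ≤ n) :
    PlaneForest.occurrences p (List.ofFn x) (List.ofFn x) = cyclicCount p x := by
  classical
  rw [PlaneForest.occurrences_eq_sum, List.length_ofFn, cyclicCount, Finset.card_filter,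
    Finset.sum_range]
  refine Finset.sum_congr rfl fun i _ => if_congr ?_ rfl rfl
  rw [List.prefix_iff_getElem?]
  refine forall_congr' fun j => forall_congr' fun hj => ?_
  have hi := i.2
  have h1 : i + Fin.ofNat n j = ⟨(i + j) % n, Nat.mod_lt _ (NeZero.pos n)⟩ := by
    ext; simp [Fin.val_add]
  rw [List.getElem?_drop, List.getElem?_append, h1]
  split_ifs with h
  · rw [List.getElem?_eq_getElem h]
    simp only [List.length_ofFn] at h
    simp only [List.getElem_ofFn, Option.some.injEq, Nat.mod_eq_of_lt h]
  · simp only [List.length_ofFn] at h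
    have h2 : (i : ℕ) + j - n < n := by omega
    rw [List.length_ofFn, List.getElem?_eq_getElem (by simpa using h2)]
    simp only [List.getElem_ofFn, Option.some.injEq]
    have h3 : ((i : ℕ) + j) % n = i + j - n := by
      rw [Nat.mod_eq_sub_mod (by omega), Nat.mod_eq_of_lt h2]
    simp only [h3]

/-- `x` lists the numbers of children of a tree in depth-first order. -/
def IsTreeWord (x : Fin n → ℕ) : Prop := ∃ f, PlaneForest.treeCode f = List.ofFn x

theorem sum_take_ofFn (x : Fin n → ℕ) (m : ℕ) (hm : m ≤ n) :
    ((List.ofFn x).take m).sum = ∑ u ∈ Finset.range m, x (Fin.ofNat n u) := by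
  induction m with
  | zero => simp
  | succ m ih =>
    rw [Finset.sum_range_succ, ← ih (by omega), List.take_add_one, List.sum_append,
      List.getElem?_eq_getElem (by simpa using hm)]
    have : Fin.ofNat n m = ⟨m, hm⟩ := by ext; simp [Nat.mod_eq_of_lt (show m < n from hm)]
    rw [this]
    simp

theorem isTreeWord_iff (x : Fin n → ℕ) :
    IsTreeWord x ↔ (∀ m < n, m ≤ ∑ u ∈ Finset.range m, x (Fin.ofNat n u)) ∧
      n = 1 + ∑ i, x i := by
  rw [IsTreeWord, PlaneForest.exists_treeCode_eq_iff, List.length_ofFn, List.sum_ofFn]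
  refine and_congr_left fun _ => forall_congr' fun m => forall_congr' fun hm => ?_
  rw [sum_take_ofFn x m hm.le]

theorem sum_range_add_period (x : Fin n → ℕ) (t : ℕ) :
    ∑ u ∈ Finset.range (t + n), x (Fin.ofNat n u) =
      ∑ u ∈ Finset.range t, x (Fin.ofNat n u) + ∑ i, x i := by
  have h0 : ∑ u ∈ Finset.range n, x (Fin.ofNat n u) = ∑ i, x i := by
    rw [Finset.sum_range]
    exact Finset.sum_congr rfl fun i _ => by congr 1; ext; simp
  induction t with
  | zero => rw [Nat.zero_add, h0, Finset.sum_range_zero, zero_add]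
  | succ t ih =>
    rw [show t + 1 + n = t + n + 1 by ring, Finset.sum_range_succ, ih, Finset.sum_range_succ]
    have : Fin.ofNat n (t + n) = Fin.ofNat n t := by ext; simp
    rw [this]; ring

/-- The **cycle lemma**. -/
theorem existsUnique_isTreeWord_rotate (x : Fin n → ℕ) (hx : n = 1 + ∑ i, x i) :
    ∃! r : Fin n, IsTreeWord (fun i => x (r + i)) := by
  set P : ℕ → ℕ := fun t => ∑ u ∈ Finset.range t, x (Fin.ofNat n u) with hP
  have hper : ∀ t, P (t + n) + 1 = P t + n := fun t => by
    have := sum_range_add_period x t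
    simp only [hP]; omega
  have hiff : ∀ r : Fin n, IsTreeWord (fun i => x (r + i)) ↔
      ∀ m < n, m + P r ≤ P (r + m) := by
    intro r
    rw [isTreeWord_iff]
    have h1 : ∑ i, x (r + i) = ∑ i, x i := Equiv.sum_comp (Equiv.addLeft r) x
    rw [h1, and_iff_left hx]
    refine forall_congr' fun m => forall_congr' fun hm => ?_
    have h2 : ∑ u ∈ Finset.range m, x (r + Fin.ofNat n u) =
        ∑ u ∈ Finset.range m, x (Fin.ofNat n (r + u)) :=
      Finset.sum_congr rfl fun u _ => by congr 1; ext; simp [Fin.val_add]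
    have h3 : P (r + m) = P r + ∑ u ∈ Finset.range m, x (Fin.ofNat n (r + u)) :=
      Finset.sum_range_add _ _ _
    rw [h2]; omega
  -- The start is the first minimum of the walk `P t - t` over one period: as `t < n`, the weight
  -- `n` makes this a lexicographic minimization of `(P t - t, t)`. Earlier positions lie strictly
  -- higher, which compensates the drop by one over a period when the walk wraps around.
  obtain ⟨r, -, hr⟩ := Finset.exists_min_image (Finset.univ : Finset (Fin n))
    (fun t => ((P t : ℤ) - t) * n + t) ⟨0, Finset.mem_univ _⟩
  have h2 : ∀ m < n, m + P r ≤ P (r + m) := by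
    intro m hm
    have hn : (0 : ℤ) < n := by exact_mod_cast NeZero.pos n
    have hr1 : ((r : ℕ) : ℤ) < n := by exact_mod_cast r.2
    rcases lt_or_ge ((r : ℕ) + m) n with h | h
    · have h1 := hr ⟨r + m, h⟩ (Finset.mem_univ _)
      simp only [Nat.cast_add] at h1
      have h2 : ((r : ℕ) : ℤ) + m < n := by exact_mod_cast h
      by_contra hlt
      have h3 : (P (r + m) : ℤ) - (r + m) ≤ P r - r - 1 := by omega
      nlinarith
    · obtain ⟨i, hi⟩ : ∃ i, (r : ℕ) + m = i + n := ⟨r + m - n, by omega⟩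
      have hin : i < r := by omega
      have h1 := hr ⟨i, by omega⟩ (Finset.mem_univ _)
      simp only at h1
      have h2 := hper i
      rw [← hi] at h2
      by_contra hlt
      have h3 : (P i : ℤ) - i ≤ P r - r := by omega
      have h4 : (i : ℤ) < (r : ℕ) := by exact_mod_cast hin
      nlinarith
  refine ⟨r, (hiff r).2 h2, fun r' hr' => ?_⟩
  have h1 := (hiff r').1 hr'
  -- For two good starts `a < b`, the walk at `b` is at least its value at `a`, and at `a + n` it is
  -- at least its value at `b`; but it loses one from `a` to `a + n`.
  have aux : ∀ a b : Fin n, (∀ m < n, m + P a ≤ P (a + m)) → (∀ m < n, m + P b ≤ P (b + m)) →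
      ¬ (a : ℕ) < b := by
    intro a b ha hb hab
    have e1 := ha (b - a) (by omega)
    have e2 := hb (a + n - b) (by omega)
    rw [show (a : ℕ) + (b - a) = b by omega] at e1
    rw [show (b : ℕ) + (a + n - b) = a + n by omega] at e2
    have e3 := hper a
    omega
  exact le_antisymm (not_lt.1 fun h => aux _ _ h2 h1 h) (not_lt.1 fun h => aux _ _ h1 h2 h)

variable (ν : Measure ℕ) [IsProbabilityMeasure ν]

theorem measurePreserving_rotate (r : Fin n) :
    MeasurePreserving (fun (x : Fin n → ℕ) i => x (r + i))
      (Measure.pi fun _ => ν) (Measure.pi fun _ => ν) := by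
  have h := measurePreserving_piCongrLeft (fun _ : Fin n => ν) (Equiv.addLeft r).symm
  have h2 : (fun (x : Fin n → ℕ) i => x (r + i)) =
      MeasurableEquiv.piCongrLeft (fun _ : Fin n => ℕ) (Equiv.addLeft r).symm := by
    funext x i
    have := MeasurableEquiv.piCongrLeft_apply_apply (β := fun _ : Fin n => ℕ)
      (Equiv.addLeft r).symm x (r + i)
    simpa using this.symm
  rw [h2]
  exact h

/-- The event on the right is the disjoint union of the `n` rotations of the event on the left, and
rotations preserve both the measure and the cyclic count. -/
theorem measure_isTreeWord (p : List ℕ) (A : Set ℕ) :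
    n * Measure.pi (fun _ : Fin n => ν) {x | IsTreeWord x ∧ cyclicCount p x ∈ A} =
      Measure.pi (fun _ : Fin n => ν) {x | n = 1 + ∑ i, x i ∧ cyclicCount p x ∈ A} := by
  have h1 : {x : Fin n → ℕ | n = 1 + ∑ i, x i ∧ cyclicCount p x ∈ A} =
      ⋃ r : Fin n, (fun x i => x (r + i)) ⁻¹' {x | IsTreeWord x ∧ cyclicCount p x ∈ A} := by
    ext x
    simp only [Set.mem_ofPred_eq, Set.mem_iUnion, Set.mem_preimage, cyclicCount_add_left]
    constructor
    · rintro ⟨h, hA⟩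
      obtain ⟨r, hr, -⟩ := existsUnique_isTreeWord_rotate x h
      exact ⟨r, hr, hA⟩
    · rintro ⟨r, hr, hA⟩
      have := ((isTreeWord_iff _).1 hr).2
      have h3 := Equiv.sum_comp (Equiv.addLeft r) x
      simp only [Equiv.coe_addLeft] at h3
      rw [h3] at this
      exact ⟨this, hA⟩
  rw [h1, measure_iUnion]
  · simp_rw [fun r => (measurePreserving_rotate ν r).measure_preimage
      (s := {x | IsTreeWord x ∧ cyclicCount p x ∈ A}) (MeasurableSet.of_discrete).nullMeasurableSet]
    simp
  · intro r r' hrr'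
    rw [Function.onFun, Set.disjoint_left]
    rintro x ⟨hx, -⟩ ⟨hx', -⟩
    have h2 := ((isTreeWord_iff _).1 hx).2
    have h3 := Equiv.sum_comp (Equiv.addLeft r) x
    simp only [Equiv.coe_addLeft] at h3
    rw [h3] at h2
    exact hrr' ((existsUnique_isTreeWord_rotate x h2).unique hx hx')
  · exact fun r => MeasurableSet.of_discrete

end Cyclic

/-! ### From the Galton-Watson tree to independent variables conditioned on their sum. -/

namespace PlaneForest

theorem setOf_grownTree_eq (f : PlaneForest) :
    {x : List ℕ → ℕ | grownTree x = nodeSet f} =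
      Set.pi (([] :: nodeList f).toFinset : Set (List ℕ)) (fun v => {childCount f v}) := by
  ext x
  rw [Set.mem_ofPred_eq, grownTree_eq_nodeSet_iff, ← nodeSet_eq_toFinset]
  rfl

theorem measurableSet_grownTree_eq (f : PlaneForest) :
    MeasurableSet {x : List ℕ → ℕ | grownTree x = nodeSet f} := by
  rw [setOf_grownTree_eq]
  exact MeasurableSet.pi (Finset.countable_toSet _) fun _ _ => measurableSet_singleton _

theorem gwMeasure_grownTree_eq (ν : Measure ℕ) [IsProbabilityMeasure ν]
    (f : PlaneForest) :
    gwMeasure ν {x | grownTree x = nodeSet f} = ((treeCode f).map fun d => ν {d}).prod := by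
  rw [setOf_grownTree_eq, gwMeasure, Measure.infinitePi_pi _ fun _ _ => measurableSet_singleton _,
    List.prod_toFinset _ (nodup_cons_nodeList f), treeCode_eq_map, List.map_map]
  rfl

theorem treeProb_eq (ν : Measure ℕ) [IsProbabilityMeasure ν]
    (T : PlaneTree) (f : PlaneForest)
    (hT : (T.nodes : Set (List ℕ)) = nodeSet f) :
    (treeProb ν T : ℝ≥0∞) = ((treeCode f).map fun d => ν {d}).prod := by
  rw [← gwMeasure_grownTree_eq, treeProb, hT, ENNReal.coe_toNNReal]
  exact (lt_of_le_of_lt (by unfold gwMeasure; exact prob_le_one) ENNReal.one_lt_top).ne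

theorem setOf_size_count_eq {n : ℕ} (T : PlaneTree) (f₀ : PlaneForest)
    (hT : (T.nodes : Set (List ℕ)) = nodeSet f₀) (A : Set ℕ) :
    {x | (grownTree x).encard = n ∧ fringeCount T (grownTree x) ∈ A} =
      ⋃ f ∈ {f : PlaneForest | (treeCode f).length = n ∧
        occurrences (treeCode f₀) (treeCode f) (treeCode f) ∈ A},
        {x | grownTree x = nodeSet f} := by
  ext x
  simp only [Set.mem_ofPred_eq, Set.mem_iUnion, exists_prop]
  constructor
  · rintro ⟨h1, h2⟩
    obtain ⟨f, hf⟩ := exists_nodeSet_eq_grownTree x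
      (Set.finite_of_encard_eq_coe h1)
    rw [hf, encard_nodeSet] at h1
    rw [hf, fringeCount_nodeSet T f₀ f hT (treeCode f)] at h2
    exact ⟨f, ⟨by exact_mod_cast h1, h2⟩, hf⟩
  · rintro ⟨f, ⟨h1, h2⟩, hf⟩
    rw [hf, encard_nodeSet, fringeCount_nodeSet T f₀ f hT (treeCode f)]
    exact ⟨by exact_mod_cast h1, h2⟩

theorem measurableSet_size_count {n : ℕ} (T : PlaneTree) (f₀ : PlaneForest)
    (hT : (T.nodes : Set (List ℕ)) = nodeSet f₀) (A : Set ℕ) :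
    MeasurableSet {x | (grownTree x).encard = n ∧ fringeCount T (grownTree x) ∈ A} := by
  rw [setOf_size_count_eq T f₀ hT]
  exact MeasurableSet.biUnion (Set.to_countable _) fun f _ => measurableSet_grownTree_eq f

/-- Both sides are the sum, over the same countable set of trees, of the product of the offspring
probabilities along the code. -/
theorem gwMeasure_size_count (ν : Measure ℕ) [IsProbabilityMeasure ν]
    {n : ℕ} [NeZero n] (T : PlaneTree) (f₀ : PlaneForest)
    (hT : (T.nodes : Set (List ℕ)) = nodeSet f₀)
    (hn : (treeCode f₀).length ≤ n) (A : Set ℕ) :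
    gwMeasure ν {x | (grownTree x).encard = n ∧ fringeCount T (grownTree x) ∈ A} =
      Measure.pi (fun _ : Fin n => ν)
        {x | IsTreeWord x ∧ cyclicCount (treeCode f₀) x ∈ A} := by
  have h1 : {x : Fin n → ℕ | IsTreeWord x ∧ cyclicCount (treeCode f₀) x ∈ A} =
      ⋃ f ∈ {f : PlaneForest | (treeCode f).length = n ∧
        occurrences (treeCode f₀) (treeCode f) (treeCode f) ∈ A},
        {x | List.ofFn x = treeCode f} := by
    ext x
    simp only [Set.mem_ofPred_eq, Set.mem_iUnion, exists_prop]
    constructor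
    · rintro ⟨⟨f, hf⟩, hA⟩
      refine ⟨f, ⟨by simp [hf], ?_⟩, hf.symm⟩
      rwa [hf, occurrences_ofFn _ _ hn]
    · rintro ⟨f, ⟨_, h2⟩, hf⟩
      refine ⟨⟨f, hf.symm⟩, ?_⟩
      rwa [← hf, occurrences_ofFn _ _ hn] at h2
  rw [setOf_size_count_eq T f₀ hT, h1, measure_biUnion (Set.to_countable _),
    measure_biUnion (Set.to_countable _)]
  · congr 1
    funext f
    rw [gwMeasure_grownTree_eq]
    obtain ⟨f, hf, -⟩ := f
    simp only
    subst hf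
    have h2 : {x : Fin (treeCode f).length → ℕ | List.ofFn x = treeCode f} =
        {(treeCode f).get} := by
      ext x
      rw [Set.mem_ofPred_eq, Set.mem_singleton_iff]
      conv_lhs => rhs; rw [← List.ofFn_get (treeCode f)]
      exact List.ofFn_inj
    rw [h2, Measure.pi_singleton]
    conv_lhs => rw [← List.ofFn_get (treeCode f)]
    rw [List.map_ofFn, List.prod_ofFn]
    rfl
  · intro f _ g _ hfg
    rw [Function.onFun, Set.disjoint_left]
    intro x hx hx'
    exact hfg (treeCode_injective (hx.symm.trans hx'))
  · exact fun f _ => MeasurableSet.of_discrete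
  · intro f _ g _ hfg
    rw [Function.onFun, Set.disjoint_left]
    intro x hx hx'
    exact hfg (nodeSet_injective (hx.symm.trans hx'))
  · exact fun f _ => measurableSet_grownTree_eq f

/-- Needed because `Measure.map` returns `0` for functions that are not almost everywhere
measurable. Infinite trees are avoided by setting the count to `0` off the event of size `n`, where
only countably many trees occur. -/
theorem aemeasurable_fringeCount (ν : Measure ℕ) {n : ℕ} (T : PlaneTree) (f₀ : PlaneForest)
    (hT : (T.nodes : Set (List ℕ)) = nodeSet f₀) :
    AEMeasurable (fun x => fringeCount T (grownTree x)) (gwCond ν n) := by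
  classical
  have hE : MeasurableSet {x | (grownTree x).encard = n} := by
    simpa using measurableSet_size_count (n := n) T f₀ hT Set.univ
  refine AEMeasurable.smul_measure ?_ _
  refine ⟨{x | (grownTree x).encard = n}.indicator (fun x => fringeCount T (grownTree x)),
    measurable_to_countable' fun m => ?_, (indicator_ae_eq_restrict hE).symm⟩
  have h1 : {x | (grownTree x).encard = n}.indicator (fun x => fringeCount T (grownTree x)) ⁻¹' {m}
      = {x | (grownTree x).encard = n ∧ fringeCount T (grownTree x) ∈ ({m} : Set ℕ)} ∪
        ({x | (grownTree x).encard = n}ᶜ ∩ {_x | 0 = m}) := by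
    ext x
    by_cases hx : (grownTree x).encard = n <;> simp [Set.indicator, hx]
  rw [h1]
  exact (measurableSet_size_count T f₀ hT _).union (hE.compl.inter (MeasurableSet.const _))

/-- The number of fringe subtrees of a given shape in a conditioned Galton-Watson tree is
distributed as the number of cyclic occurrences of its code in independent random variables
conditioned on their sum. -/
theorem fringeCountLaw_eq (ν : Measure ℕ) [IsProbabilityMeasure ν]
    {n : ℕ} [NeZero n] (T : PlaneTree) (f₀ : PlaneForest)
    (hT : (T.nodes : Set (List ℕ)) = nodeSet f₀)
    (hn : (treeCode f₀).length ≤ n) :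
    fringeCountLaw ν n T =
      (ProbabilityTheory.cond (Measure.pi fun _ : Fin n => ν) {x | n = 1 + ∑ i, x i}).map
        (cyclicCount (treeCode f₀)) := by
  ext A hA
  have hE : MeasurableSet {x | (grownTree x).encard = n} := by
    simpa using measurableSet_size_count (n := n) T f₀ hT Set.univ
  rw [fringeCountLaw, Measure.map_apply_of_aemeasurable (aemeasurable_fringeCount ν T f₀ hT) hA,
    Measure.map_apply (Measurable.of_discrete) hA, gwCond, cond_apply hE,
    cond_apply MeasurableSet.of_discrete]
  -- The cycle lemma contributes the same factor `n` to the event and to the conditioning event, so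
  -- it cancels in the quotient.
  have key := fun A => (congrArg ((n : ℝ≥0∞) * ·) (gwMeasure_size_count ν T f₀ hT hn A)).trans
    (measure_isTreeWord ν (treeCode f₀) A)
  have k1 := key Set.univ
  have k2 := key A
  simp only [Set.mem_univ, and_true] at k1
  have e1 : {x : List ℕ → ℕ | (grownTree x).encard = n} ∩
      (fun x => fringeCount T (grownTree x)) ⁻¹' A =
      {x | (grownTree x).encard = n ∧ fringeCount T (grownTree x) ∈ A} := rfl
  have e2 : {x : Fin n → ℕ | n = 1 + ∑ i, x i} ∩ cyclicCount (treeCode f₀) ⁻¹' A =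
      {x | n = 1 + ∑ i, x i ∧ cyclicCount (treeCode f₀) x ∈ A} := rfl
  have hn0 : (n : ℝ≥0∞) ≠ 0 := by exact_mod_cast NeZero.ne n
  rw [e1, e2, ← k1, ← k2, ENNReal.mul_inv (Or.inl hn0) (Or.inl (ENNReal.natCast_ne_top n)),
    mul_mul_mul_comm, ENNReal.inv_mul_cancel hn0 (ENNReal.natCast_ne_top n), one_mul]

end PlaneForest

/-! ### The Stein equation for the Poisson distribution. -/

section Stein

open Nat in
theorem poisson_real_eq_tsum (r : ℝ≥0) (A : Set ℕ) :
    (poissonMeasure r).real A = ∑' i, A.indicator (fun i => Real.exp (-r) * r ^ i / (i)!) i := by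
  rw [← integral_indicator_one MeasurableSet.of_discrete, integral_poissonMeasure]
  refine tsum_congr fun i => ?_
  by_cases h : i ∈ A <;> simp [h]

/-- The increments of the solution of the Stein equation for a law `p` on the natural numbers with
`l * p m = (m + 1) * p (m + 1)`: here `c`, `t` are the lower and upper tails, `a`, `b` their parts
in a set, and `q` the mass in the set. -/
theorem stein_increment_bound {a b c t p p' q : ℝ} (hp : 0 < p) (hp' : 0 < p') (ha : 0 ≤ a)
    (hac : a ≤ c) (hb : 0 ≤ b) (hbt : b ≤ t) (hq : 0 ≤ q) (hqp : q ≤ p) (h1 : c + p + t = 1)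
    (hU : t * p' ≤ (t + p) * p) (hL : c * p ≤ (c + p) * p') :
    |((a + q) * t - b * (c + p)) / p - (a * (t + p) - (b + q) * c) / p'| ≤ 1 := by
  have hx : t / p ≤ (t + p) / p' := by rw [div_le_div_iff₀ hp hp']; exact hU
  have hy : c / p' ≤ (c + p) / p := by rw [div_le_div_iff₀ hp' hp]; exact hL
  -- The expression is linear in `a`, `b` and `q`, with coefficients of known sign by `hx` and `hy`.
  -- The extremes are at `a = b = 0`, `q = p` and at `a = c`, `b = t`, `q = 0`; there it is bounded
  -- by `c + p + t = 1` in absolute value.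
  have e : ((a + q) * t - b * (c + p)) / p - (a * (t + p) - (b + q) * c) / p' =
      a * (t / p - (t + p) / p') - b * ((c + p) / p - c / p') + q * (t / p + c / p') := by
    field_simp
    ring
  have ht0 : 0 ≤ t := hb.trans hbt
  have hc0 : 0 ≤ c := ha.trans hac
  have htp : 0 ≤ t / p := by positivity
  have hcp : 0 ≤ c / p' := by positivity
  rw [e, abs_le]
  constructor
  · have e1 : c * (t / p - (t + p) / p') ≤ a * (t / p - (t + p) / p') := by nlinarith
    have e2 : b * ((c + p) / p - c / p') ≤ t * ((c + p) / p - c / p') := by nlinarith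
    have e3 : 0 ≤ q * (t / p + c / p') := by positivity
    have e4 : c * (t / p - (t + p) / p') - t * ((c + p) / p - c / p') = -t - p * (c / p') := by
      field_simp
      ring
    have e5 : p * (c / p') ≤ c + p := by
      calc p * (c / p') ≤ p * ((c + p) / p) := by gcongr
        _ = c + p := by field_simp
    linarith
  · have e1 : a * (t / p - (t + p) / p') ≤ 0 := by nlinarith
    have e2 : 0 ≤ b * ((c + p) / p - c / p') := by
      apply mul_nonneg hb; linarith
    have e3 : q * (t / p + c / p') ≤ p * (t / p + (c + p) / p) := by gcongr
    have e4 : p * (t / p + (c + p) / p) = 1 := by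
      rw [← h1]; field_simp; ring
    linarith

open Nat in
/-- **Stein's method** for the Poisson distribution: a solution of the Stein equation with bounds
for its increments and for its value near the mean. -/
theorem exists_poisson_stein_solution (r : ℝ≥0) (hr : 0 < r) (A : Set ℕ) :
    ∃ f : ℕ → ℝ,
      (∀ m : ℕ, r * f (m + 1) - m * f m = A.indicator 1 m - (poissonMeasure r).real A) ∧
      (∀ m : ℕ, |f (m + 2) - f (m + 1)| ≤ 1 / r) ∧
      ∃ c : ℕ, |(c : ℝ) - r| ≤ √r ∧ |f (c + 1)| ≤ 2 / √r := by
  have hr' : (0 : ℝ) < r := hr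
  set p : ℕ → ℝ := fun i => Real.exp (-r) * r ^ i / (i)! with hp
  have hp0 : ∀ i, 0 < p i := fun i => by simp only [hp]; positivity
  have hps : ∀ i, r * p i = (i + 1) * p (i + 1) := fun i => by
    simp only [hp, Nat.factorial_succ, pow_succ, Nat.cast_mul, Nat.cast_add_one]
    field_simp
  have hsum : HasSum p 1 := hasSum_one_poissonMeasure r
  set q : ℕ → ℝ := A.indicator p with hq
  have hq0 : ∀ i, 0 ≤ q i := fun i => Set.indicator_nonneg (fun j _ => (hp0 j).le) i
  have hqp : ∀ i, q i ≤ p i := fun i => Set.indicator_le_self' (fun j _ => (hp0 j).le) i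
  have hqs : Summable q := Summable.of_nonneg_of_le hq0 hqp hsum.summable
  have hPA : (poissonMeasure r).real A = ∑' i, q i := poisson_real_eq_tsum r A
  set c : ℕ → ℝ := fun m => ∑ i ∈ Finset.range m, p i with hc
  set a : ℕ → ℝ := fun m => ∑ i ∈ Finset.range m, q i with ha
  set t : ℕ → ℝ := fun m => ∑' i, p (i + m) with ht
  set b : ℕ → ℝ := fun m => ∑' i, q (i + m) with hb
  have hps' : ∀ m, Summable fun i => p (i + m) := fun m => (summable_nat_add_iff m).2 hsum.summable
  have hqs' : ∀ m, Summable fun i => q (i + m) := fun m => (summable_nat_add_iff m).2 hqs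
  have hct : ∀ m, c m + t m = 1 := fun m =>
    (hsum.summable.sum_add_tsum_nat_add m).trans hsum.tsum_eq
  have hab : ∀ m, a m + b m = (poissonMeasure r).real A := fun m =>
    (hqs.sum_add_tsum_nat_add m).trans hPA.symm
  have hcs : ∀ m, c (m + 1) = c m + p m := fun m => Finset.sum_range_succ _ _
  have has : ∀ m, a (m + 1) = a m + q m := fun m => Finset.sum_range_succ _ _
  have hts : ∀ m, t m = t (m + 1) + p m := fun m => by linarith [hct m, hct (m + 1), hcs m]
  have hbs : ∀ m, b m = b (m + 1) + q m := fun m => by linarith [hab m, hab (m + 1), has m]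
  have ha0 : ∀ m, 0 ≤ a m := fun m => Finset.sum_nonneg fun i _ => hq0 i
  have hac : ∀ m, a m ≤ c m := fun m => Finset.sum_le_sum fun i _ => hqp i
  have hb0 : ∀ m, 0 ≤ b m := fun m => tsum_nonneg fun i => hq0 _
  have hbt : ∀ m, b m ≤ t m := fun m => (hqs' m).tsum_le_tsum (fun i => hqp _) (hps' m)
  -- Log-concavity: the ratio `p (i + 1) / p i = r / (i + 1)` decreases in `i`. Summed over lower or
  -- upper tails it gives the two hypotheses of `stein_increment_bound`.
  have hmono : ∀ i m, i ≤ m → p i * p (m + 1) ≤ p (i + 1) * p m := by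
    intro i m him
    have h1 := hps i
    have h2 := hps m
    have h3 : (i : ℝ) ≤ m := by exact_mod_cast him
    refine le_of_mul_le_mul_left ?_ hr'
    calc r * (p i * p (m + 1)) = (i + 1) * (p (i + 1) * p (m + 1)) := by rw [← mul_assoc, h1]; ring
      _ ≤ (m + 1) * (p (i + 1) * p (m + 1)) := by
        have := mul_pos (hp0 (i + 1)) (hp0 (m + 1))
        gcongr
      _ = r * (p (i + 1) * p m) := by linear_combination -(p (i + 1)) * h2
  have hL : ∀ m, c m * p m ≤ c (m + 1) * p (m - 1) ∨ m = 0 := by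
    intro m
    rcases m with _ | m
    · exact Or.inr rfl
    · left
      simp only [hc, Finset.sum_mul, Nat.add_sub_cancel]
      rw [Finset.sum_range_succ' _ (m + 1)]
      refine le_add_of_le_of_nonneg (Finset.sum_le_sum fun i hi => ?_) (by positivity [hp0 0, hp0 m])
      exact hmono i m (by have := Finset.mem_range.1 hi; omega)
  have hU : ∀ m, t (m + 2) * p m ≤ t (m + 1) * p (m + 1) := by
    intro m
    simp only [ht, ← tsum_mul_right]
    refine ((hps' _).mul_right _).tsum_le_tsum (fun i => ?_) ((hps' _).mul_right _)
    rw [mul_comm, mul_comm (p (i + (m + 1)))]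
    exact hmono m (i + (m + 1)) (by omega)
  -- By `hf0` the numerator is the partial sum up to `m` of the right-hand side of the Stein
  -- equation weighted by `p`. The truncated `m - 1` at `m = 0` is harmless, since the numerator
  -- vanishes there.
  set f : ℕ → ℝ := fun m => (a m * t m - b m * c m) / (r * p (m - 1)) with hf
  have hf0 : ∀ m, a m * t m - b m * c m = a m - (poissonMeasure r).real A * c m := fun m => by
    have h1 := hct m
    have h2 := hab m
    have : t m = 1 - c m := by linarith
    rw [← h2, this]; ring
  have heq : ∀ m : ℕ, r * f (m + 1) - m * f m =
      A.indicator 1 m - (poissonMeasure r).real A := by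
    intro m
    have hqA : q m = A.indicator 1 m * p m := by
      by_cases h : m ∈ A <;> simp [hq, h]
    have h1 : (m : ℝ) * f m = (a m - (poissonMeasure r).real A * c m) / p m := by
      rcases m with _ | m
      · simp [ha, hc]
      · simp only [hf, hf0, Nat.add_sub_cancel, hps]
        have := hp0 (m + 1)
        push_cast
        field_simp
    have := hp0 m
    rw [h1]
    simp only [hf, hf0, Nat.add_sub_cancel, has, hcs, hqA]
    field_simp
    ring
  have hinc : ∀ m : ℕ, |f (m + 2) - f (m + 1)| ≤ 1 / r := by
    intro m
    have h1 : f (m + 2) - f (m + 1) = (((a (m + 1) + q (m + 1)) * t (m + 2) -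
        b (m + 2) * (c (m + 1) + p (m + 1))) / p (m + 1) - (a (m + 1) * (t (m + 2) + p (m + 1)) -
        (b (m + 2) + q (m + 1)) * c (m + 1)) / p m) / r := by
      have e1 := has (m + 1)
      have e2 := hcs (m + 1)
      have e3 := hts (m + 1)
      have e4 := hbs (m + 1)
      simp only [hf, Nat.add_sub_cancel, show m + 2 - 1 = m + 1 by omega]
      rw [← e1, ← e2, ← e3, ← e4]
      have := hp0 m
      have := hp0 (m + 1)
      field_simp
    rw [h1, abs_div, abs_of_pos hr']
    refine div_le_div_of_nonneg_right ?_ hr'.le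
    refine stein_increment_bound (hp0 _) (hp0 _) (ha0 _) (hac _) (hb0 _) (hbt _) (hq0 _) (hqp _)
      ?_ ?_ ?_
    · rw [← hcs (m + 1)]; exact hct _
    · rw [← hts (m + 1)]; exact hU m
    · rw [← hcs (m + 1)]; simpa using (hL (m + 1))
  refine ⟨f, heq, hinc, ?_⟩
  have hsq : √(r : ℝ) * √r = r := Real.mul_self_sqrt hr'.le
  have hspos : 0 < √(r : ℝ) := Real.sqrt_pos.2 hr'
  have hPA1 : (poissonMeasure r).real A ≤ 1 := measureReal_le_one
  have hPA0 : 0 ≤ (poissonMeasure r).real A := measureReal_nonneg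
  rcases lt_or_ge (r : ℝ) 1 with h1 | h1
  · have hs1 : √(r : ℝ) ≤ 1 := Real.sqrt_le_one.2 h1.le
    refine ⟨0, ?_, ?_⟩
    · rw [Nat.cast_zero, zero_sub, abs_neg, abs_of_pos hr']
      nlinarith
    · have e1 : |f 1| ≤ 1 := by
        have hp0' : p 0 = Real.exp (-r) := by simp [hp]
        have hc1 : c 1 = p 0 := by simp [hc]
        have h2 : |a 1 * t 1 - b 1 * c 1| ≤ p 0 * t 1 := by
          rw [hc1, abs_le]
          have e1 := ha0 1
          have e2 := hac 1
          have e3 := hb0 1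
          have e4 := hbt 1
          have e5 := hp0 0
          rw [hc1] at e2
          constructor <;> nlinarith
        have h3 : t 1 ≤ r := by
          have := hct 1
          rw [hc1, hp0'] at this
          have := Real.add_one_le_exp (-(r : ℝ))
          linarith
        simp only [hf, Nat.sub_self]
        rw [abs_div, abs_of_pos (mul_pos hr' (hp0 0)), div_le_one (mul_pos hr' (hp0 0))]
        nlinarith [hp0 0]
      refine e1.trans ?_
      rw [le_div_iff₀ hspos]; linarith
  · have hs1 : 1 ≤ √(r : ℝ) := Real.one_le_sqrt.2 h1
    -- The Stein equation at `c + 1` expresses `(c + 1 - r) * f (c + 1)` through an increment of `f`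
    -- and a term of size at most one. With `c + 1` at least `√r` above the mean this bounds `f (c +
    -- 1)`, while `c` itself stays within `√r` of the mean.
    obtain ⟨c, hcm⟩ : ∃ c, ⌈(r : ℝ) + √r⌉₊ = c + 1 :=
      Nat.exists_eq_succ_of_ne_zero (Nat.ceil_pos.2 (by positivity)).ne'
    have e1 : (r : ℝ) + √r ≤ c + 1 := by
      have := Nat.le_ceil ((r : ℝ) + √r)
      rw [hcm] at this; exact_mod_cast this
    have e2 : (c : ℝ) < r + √r := by
      have := Nat.ceil_lt_add_one (show 0 ≤ (r : ℝ) + √r by positivity)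
      rw [hcm] at this; push_cast at this; linarith
    refine ⟨c, abs_le.2 ⟨by linarith, by linarith⟩, ?_⟩
    have e3 := heq (c + 1)
    have e4 := hinc c
    have e5 : |(r : ℝ) * (f (c + 2) - f (c + 1))| ≤ 1 := by
      rw [abs_mul, abs_of_pos hr']
      calc (r : ℝ) * |f (c + 2) - f (c + 1)| ≤ r * (1 / r) := by gcongr
        _ = 1 := by field_simp
    have e6 : |A.indicator (1 : ℕ → ℝ) (c + 1) - (poissonMeasure r).real A| ≤ 1 := by
      by_cases h : c + 1 ∈ A <;> simp only [h, Set.indicator_of_mem, Set.indicator_of_notMem,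
        not_false_eq_true, Pi.one_apply] <;> rw [abs_le] <;> constructor <;> linarith
    have e7 : |((c : ℝ) + 1 - r) * f (c + 1)| ≤ 2 := by
      have : ((c : ℝ) + 1 - r) * f (c + 1) = (r : ℝ) * (f (c + 2) - f (c + 1)) -
          (A.indicator (1 : ℕ → ℝ) (c + 1) - (poissonMeasure r).real A) := by
        rw [← e3]; push_cast; ring
      rw [this]
      exact (abs_sub _ _).trans (by linarith)
    rw [abs_mul, abs_of_nonneg (by linarith)] at e7
    rw [le_div_iff₀ hspos]
    nlinarith [abs_nonneg (f (c + 1))]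

end Stein

/-! ### Bounded functions on a discrete space and the Cauchy-Schwarz inequality. -/

section BoundedFun

/-- A bounded real function. -/
def BoundedFun {Ω : Type*} (F : Ω → ℝ) : Prop := ∃ C, ∀ x, |F x| ≤ C

variable {Ω : Type*} {F G : Ω → ℝ}

theorem BoundedFun.const (c : ℝ) : BoundedFun (fun _ : Ω => c) := ⟨|c|, fun _ => le_rfl⟩

theorem BoundedFun.add (hF : BoundedFun F) (hG : BoundedFun G) :
    BoundedFun fun x => F x + G x := by
  obtain ⟨C, hC⟩ := hF
  obtain ⟨D, hD⟩ := hG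
  exact ⟨C + D, fun x => (abs_add_le _ _).trans (add_le_add (hC x) (hD x))⟩

theorem BoundedFun.mul (hF : BoundedFun F) (hG : BoundedFun G) :
    BoundedFun fun x => F x * G x := by
  obtain ⟨C, hC⟩ := hF
  obtain ⟨D, hD⟩ := hG
  refine ⟨C * D, fun x => ?_⟩
  rw [abs_mul]
  exact mul_le_mul (hC x) (hD x) (abs_nonneg _) ((abs_nonneg _).trans (hC x))

theorem BoundedFun.sub (hF : BoundedFun F) (hG : BoundedFun G) :
    BoundedFun fun x => F x - G x := by
  obtain ⟨C, hC⟩ := hF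
  obtain ⟨D, hD⟩ := hG
  exact ⟨C + D, fun x => (abs_sub _ _).trans (add_le_add (hC x) (hD x))⟩

theorem BoundedFun.sq (hF : BoundedFun F) : BoundedFun fun x => F x ^ 2 := by
  simpa only [_root_.sq] using hF.mul hF

theorem BoundedFun.abs (hF : BoundedFun F) : BoundedFun fun x => |F x| := by
  simpa only [BoundedFun, abs_abs] using hF

theorem BoundedFun.sum {ι : Type*} {A : Finset ι} {F : ι → Ω → ℝ} (hF : ∀ i, BoundedFun (F i)) :
    BoundedFun fun x => ∑ i ∈ A, F i x := by
  choose C hC using hF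
  exact ⟨∑ i ∈ A, C i, fun x => (Finset.abs_sum_le_sum_abs _ _).trans
    (Finset.sum_le_sum fun i _ => hC i x)⟩

theorem BoundedFun.of_unit (h0 : ∀ x, 0 ≤ F x) (h1 : ∀ x, F x ≤ 1) : BoundedFun F :=
  ⟨1, fun x => by rw [abs_of_nonneg (h0 x)]; exact h1 x⟩

theorem BoundedFun.comp_of_le {W : Ω → ℕ} {n : ℕ} (hW : ∀ x, W x ≤ n) (f : ℕ → ℝ) :
    BoundedFun fun x => f (W x) :=
  ⟨∑ i ∈ Finset.range (n + 1), |f i|, fun x =>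
    Finset.single_le_sum (f := fun i => |f i|) (fun _ _ => abs_nonneg _)
      (Finset.mem_range.2 (Nat.lt_succ_of_le (hW x)))⟩

theorem BoundedFun.integrable [MeasurableSpace Ω] [DiscreteMeasurableSpace Ω] {μ : Measure Ω}
    [IsFiniteMeasure μ] (hF : BoundedFun F) : Integrable F μ := by
  obtain ⟨C, hC⟩ := hF
  exact Integrable.of_bound (Measurable.of_discrete).aestronglyMeasurable C
    (ae_of_all _ hC)

theorem sq_integral_mul_le [MeasurableSpace Ω] [DiscreteMeasurableSpace Ω] {μ : Measure Ω}
    [IsFiniteMeasure μ] (hF : BoundedFun F) (hG : BoundedFun G) :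
    (∫ x, F x * G x ∂μ) ^ 2 ≤ (∫ x, F x ^ 2 ∂μ) * ∫ x, G x ^ 2 ∂μ := by
  have h : ∀ t : ℝ, 0 ≤ (∫ x, F x ^ 2 ∂μ) * (t * t) + (2 * ∫ x, F x * G x ∂μ) * t +
      ∫ x, G x ^ 2 ∂μ := by
    intro t
    have e : (∫ x, F x ^ 2 ∂μ) * (t * t) + (2 * ∫ x, F x * G x ∂μ) * t + ∫ x, G x ^ 2 ∂μ =
        ∫ x, (F x * t + G x) ^ 2 ∂μ := by
      rw [← integral_mul_const, ← integral_const_mul, ← integral_mul_const, ← integral_add,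
        ← integral_add]
      · exact integral_congr_ae (ae_of_all _ fun x => by ring)
      · exact ((hF.sq.mul (.const _)).add (((BoundedFun.const _).mul
          (hF.mul hG)).mul (.const _))).integrable
      · exact hG.sq.integrable
      · exact (hF.sq.mul (.const _)).integrable
      · exact (((BoundedFun.const _).mul (hF.mul hG)).mul (.const _)).integrable
    rw [e]
    exact integral_nonneg fun x => sq_nonneg _
  have := discrim_le_zero h
  rw [discrim] at this
  nlinarith

end BoundedFun

/-! ### Functions of blocks of independent variables, and the cost of conditioning on the total sum.
-/

section Iid

variable {ι : Type*}

/-- The law of a family of independent variables with law `ν`. -/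
noncomputable abbrev iidMeasure (ν : Measure ℕ) (ι : Type*) [Fintype ι] : Measure (ι → ℕ) :=
  Measure.pi fun _ : ι => ν

/-- The indicator function of the event that the variables in `B` sum up to `a`. -/
def sumIndicator (B : Finset ι) (a : ℕ) (x : ι → ℕ) : ℝ := if ∑ i ∈ B, x i = a then 1 else 0

theorem sumIndicator_nonneg (B : Finset ι) (a : ℕ) (x : ι → ℕ) : 0 ≤ sumIndicator B a x := by
  unfold sumIndicator; split_ifs <;> norm_num

theorem sumIndicator_le_one (B : Finset ι) (a : ℕ) (x : ι → ℕ) : sumIndicator B a x ≤ 1 := by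
  unfold sumIndicator; split_ifs <;> norm_num

theorem boundedFun_sumIndicator (B : Finset ι) (a : ℕ) : BoundedFun (sumIndicator B a) :=
  .of_unit (sumIndicator_nonneg B a) (sumIndicator_le_one B a)

theorem dependsOn_sumIndicator (B : Finset ι) (a : ℕ) :
    DependsOn (sumIndicator B a) (B : Set ι) := by
  intro x y h
  unfold sumIndicator
  rw [Finset.sum_congr rfl fun i hi => h i hi]

theorem dependsOn_mul {F G : (ι → ℕ) → ℝ} {s : Set ι} (hF : DependsOn F s) (hG : DependsOn G s) :
    DependsOn (fun x => F x * G x) s := fun x y h => by simp only [hF h, hG h]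

variable [Fintype ι] (ν : Measure ℕ) [IsProbabilityMeasure ν]

theorem integral_mul_of_dependsOn {F G : (ι → ℕ) → ℝ} {S T : Finset ι} (hST : Disjoint S T)
    (hF : DependsOn F (S : Set ι)) (hG : DependsOn G (T : Set ι)) :
    ∫ x, F x * G x ∂iidMeasure ν ι = (∫ x, F x ∂iidMeasure ν ι) * ∫ x, G x ∂iidMeasure ν ι := by
  have hi : iIndepFun (fun (i : ι) (x : ι → ℕ) => x i) (iidMeasure ν ι) :=
    iIndepFun_pi (X := fun _ => id) fun _ => aemeasurable_id
  have h := hi.indepFun_finset S T hST fun i => measurable_pi_apply i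
  have aux : ∀ (F : (ι → ℕ) → ℝ) (S : Finset ι), DependsOn F (S : Set ι) →
      ∃ F' : (S → ℕ) → ℝ, F = F' ∘ fun x (i : S) => x i := by
    intro F S hF
    have hfac : Function.FactorsThrough F (fun (x : ι → ℕ) (i : S) => x i) :=
      fun x y hxy => hF fun i hi => congrFun hxy ⟨i, hi⟩
    exact ⟨Function.extend _ F 0, funext fun x => (hfac.extend_apply 0 x).symm⟩
  obtain ⟨F', rfl⟩ := aux F S hF
  obtain ⟨G', rfl⟩ := aux G T hG
  exact (h.comp (φ := F') (ψ := G') Measurable.of_discrete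
    Measurable.of_discrete).integral_fun_mul_eq_mul_integral
    Measurable.of_discrete.aestronglyMeasurable Measurable.of_discrete.aestronglyMeasurable

variable [DecidableEq ι]

/-- Conditioning on the total sum costs at most a constant factor for functions that leave enough
of the variables free. -/
theorem integral_mul_sumIndicator_le {G : (ι → ℕ) → ℝ} {B : Finset ι} {C : ℝ} (s : ℕ)
    (hB : ∀ j, ∫ x, sumIndicator Bᶜ j x ∂iidMeasure ν ι ≤ C) (hG0 : ∀ x, 0 ≤ G x)
    (hGb : BoundedFun G) (hG : DependsOn G (B : Set ι)) :
    ∫ x, G x * sumIndicator Finset.univ s x ∂iidMeasure ν ι ≤ C * ∫ x, G x ∂iidMeasure ν ι := by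
  -- Split by the value `a` of the sum over `B`. The independent variables outside `B` must supply
  -- `s - a`, which has probability at most `C` for every `a`.
  have h1 : ∀ x : ι → ℕ, sumIndicator Finset.univ s x =
      ∑ a ∈ Finset.range (s + 1), sumIndicator B a x * sumIndicator Bᶜ (s - a) x := by
    intro x
    have hx : ∑ i, x i = ∑ i ∈ B, x i + ∑ i ∈ Bᶜ, x i := (Finset.sum_add_sum_compl B _).symm
    by_cases hs : ∑ i ∈ B, x i ≤ s
    · rw [Finset.sum_eq_single_of_mem _ (Finset.mem_range.2 (Nat.lt_succ_of_le hs))]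
      · unfold sumIndicator
        rw [if_pos rfl, one_mul]
        exact if_congr (by omega) rfl rfl
      · intro a _ ha
        unfold sumIndicator
        rw [if_neg ha.symm, zero_mul]
    · rw [Finset.sum_eq_zero]
      · unfold sumIndicator
        rw [if_neg (by omega)]
      · intro a ha
        unfold sumIndicator
        rw [if_neg (by have := Finset.mem_range.1 ha; omega), zero_mul]
  have hC : 0 ≤ C := (integral_nonneg fun x => sumIndicator_nonneg _ _ x).trans (hB 0)
  have hb : ∀ a, BoundedFun fun x => G x * sumIndicator B a x :=
    fun a => hGb.mul (boundedFun_sumIndicator B a)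
  calc ∫ x, G x * sumIndicator Finset.univ s x ∂iidMeasure ν ι
      = ∫ x, ∑ a ∈ Finset.range (s + 1), (G x * sumIndicator B a x) * sumIndicator Bᶜ (s - a) x
          ∂iidMeasure ν ι := by
        refine integral_congr_ae (ae_of_all _ fun x => ?_)
        simp only [h1, Finset.mul_sum, mul_assoc]
    _ = ∑ a ∈ Finset.range (s + 1), (∫ x, G x * sumIndicator B a x ∂iidMeasure ν ι) *
          ∫ x, sumIndicator Bᶜ (s - a) x ∂iidMeasure ν ι := by
        rw [integral_finsetSum _ fun a _ =>
          ((hb a).mul (boundedFun_sumIndicator Bᶜ (s - a))).integrable]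
        exact Finset.sum_congr rfl fun a _ => integral_mul_of_dependsOn ν
          (disjoint_compl_right) (dependsOn_mul hG (dependsOn_sumIndicator B a))
          (dependsOn_sumIndicator _ _)
    _ ≤ ∑ a ∈ Finset.range (s + 1), (∫ x, G x * sumIndicator B a x ∂iidMeasure ν ι) * C :=
        Finset.sum_le_sum fun a _ => mul_le_mul_of_nonneg_left (hB _)
          (integral_nonneg fun x => mul_nonneg (hG0 x) (sumIndicator_nonneg _ _ x))
    _ = C * ∫ x, ∑ a ∈ Finset.range (s + 1), G x * sumIndicator B a x ∂iidMeasure ν ι := by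
        rw [← Finset.sum_mul, mul_comm, integral_finsetSum _ fun a _ => (hb a).integrable]
    _ ≤ C * ∫ x, G x ∂iidMeasure ν ι := by
        refine mul_le_mul_of_nonneg_left (integral_mono (BoundedFun.sum hb).integrable
          hGb.integrable fun x => ?_) hC
        simp only [← Finset.mul_sum]
        refine mul_le_of_le_one_right (hG0 x) ?_
        by_cases hs : ∑ i ∈ B, x i ∈ Finset.range (s + 1)
        · rw [Finset.sum_eq_single_of_mem _ hs]
          · exact sumIndicator_le_one _ _ _
          · intro a _ ha
            unfold sumIndicator
            rw [if_neg ha.symm]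
        · rw [Finset.sum_eq_zero]
          · exact zero_le_one
          · intro a ha
            unfold sumIndicator
            rw [if_neg (by rintro rfl; exact hs ha)]

/-- Replacing a function of a block of variables by another function, both supported on the same
value of the sum over the block. -/
theorem integral_mul_mul_sumIndicator {Y G : (ι → ℕ) → ℝ} {B : Finset ι} {a : ℕ} (s : ℕ)
    (hY : DependsOn Y (B : Set ι)) (hYa : ∀ x, Y x ≠ 0 → ∑ i ∈ B, x i = a)
    (hG : DependsOn G ((Bᶜ : Finset ι) : Set ι)) (has : a ≤ s) :
    ∫ x, Y x * G x * sumIndicator Finset.univ s x ∂iidMeasure ν ι =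
      (∫ x, Y x ∂iidMeasure ν ι) * ∫ x, G x * sumIndicator Bᶜ (s - a) x ∂iidMeasure ν ι := by
  rw [← integral_mul_of_dependsOn ν disjoint_compl_right hY
    (dependsOn_mul hG (dependsOn_sumIndicator Bᶜ (s - a)))]
  refine integral_congr_ae (ae_of_all _ fun x => ?_)
  simp only
  by_cases h : Y x = 0
  · simp [h]
  · rw [mul_assoc]
    -- Where `Y` does not vanish the block contributes exactly `a`, so the total is `s` precisely
    -- when the rest contributes `s - a`.
    have h1 := hYa x h
    have hx : ∑ i, x i = ∑ i ∈ B, x i + ∑ i ∈ Bᶜ, x i := (Finset.sum_add_sum_compl B _).symm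
    congr 2
    unfold sumIndicator
    exact if_congr (by omega) rfl rfl

/-- A variance bound for a sum of functions of blocks of variables. -/
theorem integral_sq_sum_sub_le {Y : ι → (ι → ℕ) → ℝ} {blk : ι → Finset ι} {m : ℝ} {D : ℕ}
    (hY0 : ∀ i x, 0 ≤ Y i x) (hY1 : ∀ i x, Y i x ≤ 1)
    (hYd : ∀ i, DependsOn (Y i) (blk i : Set ι)) (hYm : ∀ i, ∫ x, Y i x ∂iidMeasure ν ι = m)
    (hD : ∀ i, (Finset.univ.filter fun j => ¬ Disjoint (blk i) (blk j)).card ≤ D)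
    (A : Finset ι) :
    ∫ x, (∑ i ∈ A, (Y i x - m)) ^ 2 ∂iidMeasure ν ι ≤ A.card * D * m := by
  rcases A.eq_empty_or_nonempty with rfl | ⟨i₀, _⟩
  · simp
  have hm0 : 0 ≤ m := hYm i₀ ▸ integral_nonneg (hY0 i₀)
  have hYb : ∀ i, BoundedFun (Y i) := fun i => .of_unit (hY0 i) (hY1 i)
  have hZb : ∀ i, BoundedFun fun x => Y i x - m := fun i => (hYb i).sub (.const m)
  have hvar : ∀ i, ∫ x, (Y i x - m) ^ 2 ∂iidMeasure ν ι ≤ m := by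
    intro i
    have h1 : ∫ x, (Y i x - m) ^ 2 ∂iidMeasure ν ι ≤
        ∫ x, ((1 - 2 * m) * Y i x + m ^ 2) ∂iidMeasure ν ι := by
      refine integral_mono (hZb i).sq.integrable
        (((BoundedFun.const _).mul (hYb i)).add (.const _)).integrable fun x => ?_
      nlinarith [hY0 i x, hY1 i x]
    rw [integral_add ((BoundedFun.const _).mul (hYb i)).integrable (integrable_const _),
      integral_const_mul, hYm] at h1
    simp only [integral_const, probReal_univ, one_smul] at h1
    nlinarith
  -- Disjoint blocks are uncorrelated. For overlapping ones the covariance is bounded by the average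
  -- of the two variances.
  have hcov : ∀ i j, ∫ x, (Y i x - m) * (Y j x - m) ∂iidMeasure ν ι ≤
      if ¬ Disjoint (blk i) (blk j) then m else 0 := by
    intro i j
    split_ifs with h
    · rw [integral_mul_of_dependsOn ν h (fun x y hxy => by simp only [hYd i hxy])
        (fun x y hxy => by simp only [hYd j hxy]), integral_sub (hYb i).integrable
        (integrable_const _), hYm]
      simp
    · have h1 : ∫ x, (Y i x - m) * (Y j x - m) ∂iidMeasure ν ι ≤
          ∫ x, ((1 / 2) * (Y i x - m) ^ 2 + (1 / 2) * (Y j x - m) ^ 2) ∂iidMeasure ν ι := by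
        refine integral_mono ((hZb i).mul (hZb j)).integrable
          (((BoundedFun.const _).mul (hZb i).sq).add
            ((BoundedFun.const _).mul (hZb j).sq)).integrable fun x => ?_
        nlinarith [sq_nonneg (Y i x - m - (Y j x - m))]
      rw [integral_add ((BoundedFun.const _).mul (hZb i).sq).integrable
        ((BoundedFun.const _).mul (hZb j).sq).integrable, integral_const_mul,
        integral_const_mul] at h1
      linarith [hvar i, hvar j]
  calc ∫ x, (∑ i ∈ A, (Y i x - m)) ^ 2 ∂iidMeasure ν ι
      = ∑ i ∈ A, ∑ j ∈ A, ∫ x, (Y i x - m) * (Y j x - m) ∂iidMeasure ν ι := by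
        simp only [sq, Finset.sum_mul_sum]
        rw [integral_finsetSum _ fun i _ =>
          (BoundedFun.sum fun j => (hZb i).mul (hZb j)).integrable]
        exact Finset.sum_congr rfl fun i _ => integral_finsetSum _ fun j _ =>
          ((hZb i).mul (hZb j)).integrable
    _ ≤ ∑ i ∈ A, ∑ j, if ¬ Disjoint (blk i) (blk j) then m else 0 := by
        refine Finset.sum_le_sum fun i _ => (Finset.sum_le_sum fun j _ => hcov i j).trans ?_
        exact Finset.sum_le_sum_of_subset_of_nonneg (Finset.subset_univ _) fun j _ _ => by
          split_ifs <;> simp [hm0]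
    _ ≤ ∑ i ∈ A, (D : ℝ) * m := by
        refine Finset.sum_le_sum fun i _ => ?_
        rw [← Finset.sum_filter, Finset.sum_const, nsmul_eq_mul]
        exact mul_le_mul_of_nonneg_right (by exact_mod_cast hD i) hm0
    _ = A.card * D * m := by rw [Finset.sum_const, nsmul_eq_mul, mul_assoc]

/-- The variance bound after conditioning on the total sum. -/
theorem integral_sq_sum_sub_mul_sumIndicator_le {Y : ι → (ι → ℕ) → ℝ} {blk : ι → Finset ι}
    {m : ℝ} {D : ℕ} {C : ℝ} (s : ℕ)
    (hY0 : ∀ i x, 0 ≤ Y i x) (hY1 : ∀ i x, Y i x ≤ 1)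
    (hYd : ∀ i, DependsOn (Y i) (blk i : Set ι)) (hYm : ∀ i, ∫ x, Y i x ∂iidMeasure ν ι = m)
    (hD : ∀ i, (Finset.univ.filter fun j => ¬ Disjoint (blk i) (blk j)).card ≤ D)
    {A B₁ B₂ : Finset ι} (h1 : ∀ i ∈ A, blk i ⊆ B₁) (h2 : ∀ i ∈ Aᶜ, blk i ⊆ B₂)
    (hB₁ : ∀ j, ∫ x, sumIndicator B₁ᶜ j x ∂iidMeasure ν ι ≤ C)
    (hB₂ : ∀ j, ∫ x, sumIndicator B₂ᶜ j x ∂iidMeasure ν ι ≤ C) :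
    ∫ x, (∑ i, (Y i x - m)) ^ 2 * sumIndicator Finset.univ s x ∂iidMeasure ν ι ≤
      2 * C * Fintype.card ι * D * m := by
  have hC : 0 ≤ C := (integral_nonneg fun x => sumIndicator_nonneg _ _ x).trans (hB₁ 0)
  have hZb : ∀ i, BoundedFun fun x => Y i x - m :=
    fun i => (BoundedFun.of_unit (hY0 i) (hY1 i)).sub (.const m)
  -- The full sum may involve every variable and leave none free to absorb the conditioning. Each of
  -- the two partial sums leaves enough, and `(u + v) ^ 2 ≤ 2 * u ^ 2 + 2 * v ^ 2` recombines them.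
  have key : ∀ A B : Finset ι, (∀ i ∈ A, blk i ⊆ B) →
      (∀ j, ∫ x, sumIndicator Bᶜ j x ∂iidMeasure ν ι ≤ C) →
      ∫ x, (∑ i ∈ A, (Y i x - m)) ^ 2 * sumIndicator Finset.univ s x ∂iidMeasure ν ι ≤
        C * (A.card * D * m) := by
    intro A B hAB hB
    refine (integral_mul_sumIndicator_le ν s hB (fun x => sq_nonneg _)
      (BoundedFun.sum hZb).sq ?_).trans (mul_le_mul_of_nonneg_left
        (integral_sq_sum_sub_le ν hY0 hY1 hYd hYm hD A) hC)
    intro x y hxy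
    simp only
    rw [Finset.sum_congr rfl fun i hi => ?_]
    rw [hYd i fun l hl => hxy l (hAB i hi hl)]
  have hb : ∀ A : Finset ι, BoundedFun fun x => (∑ i ∈ A, (Y i x - m)) ^ 2 *
      sumIndicator Finset.univ s x :=
    fun A => (BoundedFun.sum hZb).sq.mul (boundedFun_sumIndicator _ _)
  calc ∫ x, (∑ i, (Y i x - m)) ^ 2 * sumIndicator Finset.univ s x ∂iidMeasure ν ι
      ≤ ∫ x, (2 * ((∑ i ∈ A, (Y i x - m)) ^ 2 * sumIndicator Finset.univ s x) +
          2 * ((∑ i ∈ Aᶜ, (Y i x - m)) ^ 2 * sumIndicator Finset.univ s x)) ∂iidMeasure ν ι := by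
        refine integral_mono (hb _).integrable (((BoundedFun.const 2).mul (hb A)).add
          ((BoundedFun.const 2).mul (hb Aᶜ))).integrable fun x => ?_
        simp only
        rw [← Finset.sum_add_sum_compl A]
        nlinarith [mul_nonneg (sq_nonneg (∑ i ∈ A, (Y i x - m) - ∑ i ∈ Aᶜ, (Y i x - m)))
          (sumIndicator_nonneg Finset.univ s x)]
    _ ≤ 2 * (C * (A.card * D * m)) + 2 * (C * (Aᶜ.card * D * m)) := by
        rw [integral_add ((BoundedFun.const 2).mul (hb A)).integrable
          ((BoundedFun.const 2).mul (hb Aᶜ)).integrable, integral_const_mul, integral_const_mul]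
        linarith [key A B₁ h1 hB₁, key Aᶜ B₂ h2 hB₂]
    _ = 2 * C * Fintype.card ι * D * m := by
        have : (Fintype.card ι : ℝ) = A.card + Aᶜ.card := by
          exact_mod_cast (Finset.card_add_card_compl A).symm
        rw [this]; ring

end Iid

/-! ### Poisson approximation by Stein's method under conditioning on the sum. -/

section Approximation

variable {ι : Type*} [Fintype ι]

theorem integral_cond_sum_eq (ν : Measure ℕ) (s : ℕ) (F : (ι → ℕ) → ℝ) :
    ∫ x, F x ∂(ProbabilityTheory.cond (iidMeasure ν ι) {x | ∑ i, x i = s}) =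
      (∫ x, sumIndicator Finset.univ s x ∂iidMeasure ν ι)⁻¹ *
        ∫ x, F x * sumIndicator Finset.univ s x ∂iidMeasure ν ι := by
  have hm : MeasurableSet {x : ι → ℕ | ∑ i, x i = s} := MeasurableSet.of_discrete
  have h1 : ∫ x, sumIndicator Finset.univ s x ∂iidMeasure ν ι =
      (iidMeasure ν ι).real {x | ∑ i, x i = s} := by
    rw [← integral_indicator_one hm]
    refine integral_congr_ae (ae_of_all _ fun x => ?_)
    simp [sumIndicator, Set.indicator]
  have h2 : ∫ x, F x * sumIndicator Finset.univ s x ∂iidMeasure ν ι =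
      ∫ x in {x | ∑ i, x i = s}, F x ∂iidMeasure ν ι := by
    rw [← integral_indicator hm]
    refine integral_congr_ae (ae_of_all _ fun x => ?_)
    simp [sumIndicator, Set.indicator]
  rw [h1, h2, ProbabilityTheory.cond, integral_smul_measure, ENNReal.toReal_inv, smul_eq_mul]
  rfl

theorem abs_sub_le_of_increments {f : ℕ → ℝ} {δ : ℝ} (h : ∀ m, |f (m + 2) - f (m + 1)| ≤ δ)
    (a b : ℕ) : |f (a + 1) - f (b + 1)| ≤ δ * |(a : ℝ) - b| := by
  have key : ∀ a d : ℕ, |f (a + d + 1) - f (a + 1)| ≤ δ * d := by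
    intro a d
    induction d with
    | zero => simp
    | succ d ih =>
      have e : f (a + (d + 1) + 1) - f (a + 1) =
          (f (a + d + 2) - f (a + d + 1)) + (f (a + d + 1) - f (a + 1)) := by
        rw [show a + (d + 1) + 1 = a + d + 2 by ring]; ring
      rw [e]
      refine (abs_add_le _ _).trans ?_
      push_cast
      linarith [h (a + d)]
  rcases le_total a b with hab | hab
  · obtain ⟨d, rfl⟩ := Nat.exists_eq_add_of_le hab
    rw [abs_sub_comm, abs_sub_comm (a : ℝ)]
    simpa using key a d
  · obtain ⟨d, rfl⟩ := Nat.exists_eq_add_of_le hab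
    simpa using key b d

variable [DecidableEq ι] (ν : Measure ℕ) [IsProbabilityMeasure ν]

set_option maxHeartbeats 1000000 in
open Classical in
/-- **Poisson approximation** for the number of occurrences of a family of events, each of them
determined by a block of independent variables, conditioned on the sum of all variables. -/
theorem abs_cond_sub_poisson_le {ev : ι → Set (ι → ℕ)} {blk : ι → Finset ι} {a s D : ℕ}
    {A B₁ B₂ : Finset ι} {C₀ p θ : ℝ} {r : ℝ≥0}
    (hev : ∀ i, DependsOn (fun x => x ∈ ev i) (blk i : Set ι))
    (heva : ∀ i, ∀ x ∈ ev i, ∑ l ∈ blk i, x l = a)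
    (hne : ∀ i, (blk i).Nonempty)
    (hov : ∀ i j, i ≠ j → ¬ Disjoint (blk i) (blk j) → Disjoint (ev i) (ev j))
    (hD : ∀ i, (Finset.univ.filter fun j => ¬ Disjoint (blk i) (blk j)).card ≤ D)
    (hA : ∀ i ∈ A, blk i ⊆ B₁) (hAc : ∀ i ∈ Aᶜ, blk i ⊆ B₂)
    (hq : 0 < ∫ x, sumIndicator Finset.univ s x ∂iidMeasure ν ι)
    (hB₁ : ∀ j, ∫ x, sumIndicator B₁ᶜ j x ∂iidMeasure ν ι ≤
      C₀ * ∫ x, sumIndicator Finset.univ s x ∂iidMeasure ν ι)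
    (hB₂ : ∀ j, ∫ x, sumIndicator B₂ᶜ j x ∂iidMeasure ν ι ≤
      C₀ * ∫ x, sumIndicator Finset.univ s x ∂iidMeasure ν ι)
    (hC₀ : 1 ≤ C₀) (hp : ∀ i, (iidMeasure ν ι).real (ev i) = p)
    (hθ : ∀ i, ∫ x, sumIndicator (blk i) a x ∂iidMeasure ν ι = θ)
    (has : a ≤ s) (hr : (r : ℝ) = Fintype.card ι * p) (hr0 : 0 < r) (S : Set ℕ) :
    |(ProbabilityTheory.cond (iidMeasure ν ι) {x | ∑ i, x i = s}).real
        {x | (Finset.univ.filter fun i => x ∈ ev i).card ∈ S} - (poissonMeasure r).real S| ≤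
      8 * C₀ * D * √(p / θ) := by
  set Q := iidMeasure ν ι with hQ
  set q := ∫ x, sumIndicator Finset.univ s x ∂Q with hqdef
  set P := ProbabilityTheory.cond Q {x | ∑ i, x i = s} with hP
  have hE : ∀ F : (ι → ℕ) → ℝ, ∫ x, F x ∂P = q⁻¹ * ∫ x, F x * sumIndicator Finset.univ s x ∂Q :=
    fun F => integral_cond_sum_eq ν s F
  have hPprob : IsProbabilityMeasure P := by
    refine ⟨?_⟩
    have h1 : P.real Set.univ = 1 := by
      have := hE fun _ => 1
      simp only [integral_const, smul_eq_mul, mul_one, one_mul] at this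
      rw [this, inv_mul_cancel₀ hq.ne']
    rw [measureReal_def] at h1
    exact (ENNReal.toReal_eq_one_iff _).1 h1
  set W : (ι → ℕ) → ℕ := fun x => (Finset.univ.filter fun i => x ∈ ev i).card with hW
  set n : ℝ := (Fintype.card ι : ℝ) with hn
  have hr0' : (0 : ℝ) < r := hr0
  have hn0 : 0 < n := by
    rcases (Nat.cast_nonneg (α := ℝ) (Fintype.card ι)).eq_or_lt with h | h
    · rw [hr, hn, ← h, zero_mul] at hr0'; exact absurd hr0' (lt_irrefl _)
    · exact h
  have hp0 : 0 < p := by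
    rw [hr] at hr0'
    exact pos_of_mul_pos_right hr0' hn0.le
  have i₀ : ι := (Fintype.card_pos_iff.1 (by rw [hn] at hn0; exact_mod_cast hn0)).some
  have hD1 : (1 : ℝ) ≤ D := by
    have : 0 < (Finset.univ.filter fun j => ¬ Disjoint (blk i₀) (blk j)).card :=
      Finset.card_pos.2 ⟨i₀, by simpa using (hne i₀).ne_empty⟩
    exact_mod_cast this.trans_le (hD i₀)
  -- the indicators of the events
  set I : ι → (ι → ℕ) → ℝ := fun i => (ev i).indicator 1 with hI
  set J : ι → (ι → ℕ) → ℝ := fun i => sumIndicator (blk i) a with hJ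
  have hI0 : ∀ i x, 0 ≤ I i x := fun i x => Set.indicator_nonneg (fun _ _ => zero_le_one) x
  have hI1 : ∀ i x, I i x ≤ 1 := fun i x => Set.indicator_le_self' (fun _ _ => zero_le_one) x
  have hJ0 : ∀ i x, 0 ≤ J i x := fun i x => sumIndicator_nonneg _ _ x
  have hJ1 : ∀ i x, J i x ≤ 1 := fun i x => sumIndicator_le_one _ _ x
  have hId : ∀ i, DependsOn (I i) (blk i : Set ι) := fun i x y hxy => by
    have h := hev i hxy
    simp only [hI, Set.indicator_apply, Pi.one_apply]
    simp only at h
    simp only [h]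
  have hJd : ∀ i, DependsOn (J i) (blk i : Set ι) := fun i => dependsOn_sumIndicator _ _
  have hIm : ∀ i, ∫ x, I i x ∂Q = p := fun i => by
    rw [← hp i]; exact integral_indicator_one MeasurableSet.of_discrete
  have hIb : ∀ i, BoundedFun (I i) := fun i => .of_unit (hI0 i) (hI1 i)
  have hJb : ∀ i, BoundedFun (J i) := fun i => .of_unit (hJ0 i) (hJ1 i)
  have hIa : ∀ i x, I i x ≠ 0 → ∑ l ∈ blk i, x l = a := fun i x h =>
    heva i x (Set.mem_of_indicator_ne_zero h)
  have hJa : ∀ i x, J i x ≠ 0 → ∑ l ∈ blk i, x l = a := fun i x h => by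
    by_contra h'
    exact h (if_neg h')
  have hpθ : p ≤ θ := by
    rw [← hIm i₀, ← hθ i₀]
    refine integral_mono (hIb i₀).integrable (hJb i₀).integrable fun x => ?_
    by_cases h : I i₀ x = 0
    · rw [h]; exact hJ0 _ _
    · have : sumIndicator (blk i₀) a x = 1 := if_pos (hIa _ _ h)
      rw [this]; exact hI1 _ _
  have hθ0 : 0 < θ := hp0.trans_le hpθ
  have hWle : ∀ x, W x ≤ Fintype.card ι := fun x => Finset.card_le_univ _
  have hWI : ∀ x, (W x : ℝ) = ∑ i, I i x := fun x => by
    simp only [hW, hI, Finset.card_filter, Set.indicator_apply, Pi.one_apply]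
    push_cast
    rfl
  -- moment bounds
  have hsq : ∀ (Y : ι → (ι → ℕ) → ℝ) (m : ℝ), (∀ i x, 0 ≤ Y i x) → (∀ i x, Y i x ≤ 1) →
      (∀ i, DependsOn (Y i) (blk i : Set ι)) → (∀ i, ∫ x, Y i x ∂Q = m) →
      ∫ x, (∑ i, (Y i x - m)) ^ 2 ∂P ≤ 2 * C₀ * n * D * m := by
    intro Y m h0 h1 hd hm
    rw [hE, inv_mul_le_iff₀ hq]
    refine (integral_sq_sum_sub_mul_sumIndicator_le ν s h0 h1 hd hm hD hA hAc hB₁ hB₂).trans_eq ?_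
    ring
  have hJsq := hsq J θ hJ0 hJ1 hJd hθ
  have hIsq := hsq I p hI0 hI1 hId hIm
  have hEI : ∀ i, ∫ x, I i x ∂P ≤ C₀ * p := by
    intro i
    rw [hE, inv_mul_le_iff₀ hq, ← mul_assoc, mul_comm q, ← hIm i]
    by_cases h : i ∈ A
    · exact integral_mul_sumIndicator_le ν s hB₁ (hI0 i) (hIb i)
        ((hId i).mono (by exact_mod_cast hA i h))
    · exact integral_mul_sumIndicator_le ν s hB₂ (hI0 i) (hIb i)
        ((hId i).mono (by exact_mod_cast hAc i (Finset.mem_compl.2 h)))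
  -- Both `I i` and `J i` force the block sum `a`, so the outside of the block sees the same
  -- residual condition in either case; only the probabilities `p` and `θ` of the block events
  -- differ.
  have hswap : ∀ i (G : (ι → ℕ) → ℝ), DependsOn G (((blk i)ᶜ : Finset ι) : Set ι) →
      ∫ x, I i x * G x ∂P = p / θ * ∫ x, J i x * G x ∂P := by
    intro i G hG
    rw [hE, hE, integral_mul_mul_sumIndicator ν s (hId i) (hIa i) hG has,
      integral_mul_mul_sumIndicator ν s (hJd i) (hJa i) hG has, hIm, hθ]
    field_simp
  -- the Stein equation
  obtain ⟨f, hf, hinc, c, hc1, hc2⟩ := exists_poisson_stein_solution r hr0 S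
  have hlip := abs_sub_le_of_increments hinc
  set F : (ι → ℕ) → ℝ := fun x => f (W x + 1) with hF
  set F₀ := f (c + 1) with hF₀
  -- `V i` ignores the events whose blocks meet block `i`, so it depends only on variables outside
  -- that block and `hswap` applies to `G i`.
  set V : ι → (ι → ℕ) → ℕ := fun i x =>
    (Finset.univ.filter fun j => Disjoint (blk i) (blk j) ∧ x ∈ ev j).card with hV
  set G : ι → (ι → ℕ) → ℝ := fun i x => f (V i x + 1) with hG
  -- The fluctuation of the number of blocks with the right sum. Its mean part `n * θ`, multiplied
  -- by `p / θ`, gives `n * p = r` and cancels the first term of the Stein equation.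
  set X : (ι → ℕ) → ℝ := fun x => ∑ i, (J i x - θ) with hX
  have hFb : BoundedFun F := BoundedFun.comp_of_le hWle fun m => f (m + 1)
  have hfWb : BoundedFun fun x => f (W x) := BoundedFun.comp_of_le hWle f
  have hGb : ∀ i, BoundedFun (G i) := fun i =>
    BoundedFun.comp_of_le (fun x => Finset.card_le_univ _) fun m => f (m + 1)
  have hXb : BoundedFun X := BoundedFun.sum fun i => (hJb i).sub (.const _)
  have hGd : ∀ i, DependsOn (G i) (((blk i)ᶜ : Finset ι) : Set ι) := by
    intro i x y hxy
    have : ∀ j, Disjoint (blk i) (blk j) → (x ∈ ev j ↔ y ∈ ev j) := by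
      intro j hj
      refine iff_of_eq (hev j fun l hl => hxy l ?_)
      rw [Finset.mem_coe, Finset.mem_compl]
      exact fun h => Finset.disjoint_left.1 hj h hl
    simp only [hG, hV]
    rw [Finset.filter_congr fun j _ => and_congr_right (this j)]
  -- When event `i` occurs, overlapping events are impossible by `hov`, so only `i` itself is
  -- missing from `V i`.
  have hWV : ∀ i x, x ∈ ev i → W x = V i x + 1 := by
    intro i x hx
    simp only [hW, hV]
    rw [← Finset.card_insert_of_notMem (a := i)]
    · congr 1
      ext j
      simp only [Finset.mem_filter, Finset.mem_univ, true_and, Finset.mem_insert]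
      constructor
      · intro hj
        by_cases hij : j = i
        · exact Or.inl hij
        · refine Or.inr ⟨?_, hj⟩
          by_contra hd
          exact Set.disjoint_left.1 (hov i j (Ne.symm hij) hd) hx hj
      · rintro (rfl | ⟨_, hj⟩)
        · exact hx
        · exact hj
    · simp only [Finset.mem_filter, Finset.mem_univ, true_and, not_and]
      intro hd
      exact absurd (disjoint_self.1 hd) (hne i).ne_empty
  have hIG : ∀ i x, I i x * f (W x) = I i x * G i x := by
    intro i x
    by_cases hx : x ∈ ev i
    · rw [hWV i x hx]
    · have : I i x = 0 := Set.indicator_of_notMem hx _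
      rw [this, zero_mul, zero_mul]
  have hstein : r * (∫ x, F x ∂P) - ∑ i, ∫ x, I i x * G i x ∂P =
      P.real {x | W x ∈ S} - (poissonMeasure r).real S := by
    have h1 : ∀ x, r * F x - ∑ i, I i x * G i x =
        {x | W x ∈ S}.indicator 1 x - (poissonMeasure r).real S := by
      intro x
      have := hf (W x)
      rw [← Finset.sum_congr rfl fun i _ => hIG i x, ← Finset.sum_mul, ← hWI, this]
      rfl
    rw [← integral_indicator_one (MeasurableSet.of_discrete),
      ← integral_finsetSum _ fun i _ => ((hIb i).mul (hGb i)).integrable, ← integral_const_mul,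
      ← integral_sub ((BoundedFun.const _).mul hFb).integrable
        (BoundedFun.sum fun i => (hIb i).mul (hGb i)).integrable]
    have h2 : BoundedFun ({x | W x ∈ S}.indicator (1 : (ι → ℕ) → ℝ)) :=
      .of_unit (fun x => Set.indicator_nonneg (fun _ _ => zero_le_one) x)
        (fun x => Set.indicator_le_self' (fun _ _ => zero_le_one) x)
    have h3 : (poissonMeasure r).real S = ∫ _x, (poissonMeasure r).real S ∂P := by simp
    rw [h3, ← integral_sub h2.integrable (integrable_const _)]
    exact integral_congr_ae (ae_of_all _ h1)
  -- decomposition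
  have hdec : ∑ i, ∫ x, J i x * G i x ∂P = ∫ x, X x * (F x - F₀) ∂P + F₀ * ∫ x, X x ∂P +
      n * θ * ∫ x, F x ∂P + ∑ i, ∫ x, J i x * (G i x - F x) ∂P := by
    have h1 : ∀ i, ∫ x, J i x * (G i x - F x) ∂P =
        ∫ x, J i x * G i x ∂P - ∫ x, J i x * F x ∂P := by
      intro i
      rw [← integral_sub ((hJb i).mul (hGb i)).integrable ((hJb i).mul hFb).integrable]
      exact integral_congr_ae (ae_of_all _ fun x => by ring)
    have h2 : ∑ i, ∫ x, J i x * F x ∂P = ∫ x, X x * (F x - F₀) ∂P + F₀ * ∫ x, X x ∂P +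
        n * θ * ∫ x, F x ∂P := by
      rw [← integral_finsetSum _ fun i _ => ((hJb i).mul hFb).integrable, ← integral_const_mul,
        ← integral_const_mul, ← integral_add (hXb.mul (hFb.sub (.const _))).integrable
        ((BoundedFun.const _).mul hXb).integrable, ← integral_add
        ((hXb.mul (hFb.sub (.const _))).add ((BoundedFun.const _).mul hXb)).integrable
        ((BoundedFun.const _).mul hFb).integrable]
      refine integral_congr_ae (ae_of_all _ fun x => ?_)
      simp only [hX, ← Finset.sum_mul, Finset.sum_sub_distrib, Finset.sum_const, nsmul_eq_mul,
        Finset.card_univ]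
      ring
    rw [Finset.sum_congr rfl fun i _ => h1 i, Finset.sum_sub_distrib, h2]
    ring
  -- bounds
  set v := √(θ / p) with hv
  have hv2 : v ^ 2 = θ / p := Real.sq_sqrt (by positivity)
  have hv1 : 1 ≤ v := Real.one_le_sqrt.2 ((one_le_div hp0).2 hpθ)
  have hCD : 1 ≤ C₀ * D := one_le_mul_of_one_le_of_one_le hC₀ hD1
  have hrn : n * θ = r * v ^ 2 := by rw [hr, hv2]; field_simp
  have hX2 : ∫ x, X x ^ 2 ∂P ≤ 2 * (C₀ * D) * (r * v ^ 2) := by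
    rw [← hrn]
    exact hJsq.trans_eq (by ring)
  -- `F` is Lipschitz in `W` with constant `1 / r`, and `W` deviates from `c` by order `√r` in mean
  -- square: variance of `W` plus the distance of `c` from `r`.
  have hFF : ∫ x, (F x - F₀) ^ 2 ∂P ≤ 6 * (C₀ * D) / r := by
    have h1 : ∀ x, (F x - F₀) ^ 2 ≤ 2 / r ^ 2 * (∑ i, (I i x - p)) ^ 2 + 2 / r := by
      intro x
      have e1 : |F x - F₀| ≤ 1 / r * |(W x : ℝ) - c| := hlip (W x) c
      have e2 : (F x - F₀) ^ 2 ≤ (1 / r * |(W x : ℝ) - c|) ^ 2 := by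
        rw [← sq_abs (F x - F₀)]
        exact pow_le_pow_left₀ (abs_nonneg _) e1 2
      rw [mul_pow, sq_abs] at e2
      have e3 : ∑ i, (I i x - p) = W x - r := by
        rw [Finset.sum_sub_distrib, ← hWI, hr]
        simp [hn]
      have e4 : ((c : ℝ) - r) ^ 2 ≤ r := by
        rw [← sq_abs]
        calc |(c : ℝ) - r| ^ 2 ≤ √r ^ 2 := pow_le_pow_left₀ (abs_nonneg _) hc1 2
          _ = r := Real.sq_sqrt hr0'.le
      have e5 : ((W x : ℝ) - c) ^ 2 ≤ 2 * (W x - r) ^ 2 + 2 * r := by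
        nlinarith [sq_nonneg ((W x : ℝ) - r + (c - r))]
      rw [e3]
      refine e2.trans ((mul_le_mul_of_nonneg_left e5 (by positivity)).trans_eq ?_)
      field_simp
    have hb : BoundedFun fun x => (∑ i, (I i x - p)) ^ 2 :=
      (BoundedFun.sum fun i => (hIb i).sub (.const _)).sq
    have h2 := integral_mono (μ := P) (hFb.sub (.const F₀)).sq.integrable
      (((BoundedFun.const _).mul hb).add (.const _)).integrable h1
    rw [integral_add ((BoundedFun.const _).mul hb).integrable (integrable_const _),
      integral_const_mul] at h2
    simp only [integral_const, probReal_univ, one_smul] at h2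
    refine h2.trans ?_
    have h3 : 2 / (r : ℝ) ^ 2 * ∫ x, (∑ i, (I i x - p)) ^ 2 ∂P ≤
        2 / (r : ℝ) ^ 2 * (2 * (C₀ * D) * r) :=
      mul_le_mul_of_nonneg_left (hIsq.trans_eq (by rw [hr]; ring)) (by positivity)
    have h4 : 2 / (r : ℝ) ^ 2 * (2 * (C₀ * D) * r) = 4 * (C₀ * D) / r := by field_simp; ring
    rw [h4] at h3
    have h5 : 2 / (r : ℝ) ≤ 2 * (C₀ * D) / r := by gcongr; linarith
    have h6 : 6 * (C₀ * D) / (r : ℝ) = 4 * (C₀ * D) / r + 2 * (C₀ * D) / r := by ring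
    linarith
  have hXX0 : 0 ≤ ∫ x, X x ^ 2 ∂P := integral_nonneg fun x => sq_nonneg _
  -- Cauchy-Schwarz: the powers of `r` in the two second moments cancel. The constant is `2 * 6 = 12
  -- ≤ 4 ^ 2`.
  have hT1 : |∫ x, X x * (F x - F₀) ∂P| ≤ 4 * (C₀ * D) * v := by
    refine abs_le_of_sq_le_sq ?_ (by positivity)
    refine (sq_integral_mul_le hXb (hFb.sub (.const F₀))).trans ?_
    refine (mul_le_mul hX2 hFF (integral_nonneg fun x => sq_nonneg _) (by positivity)).trans ?_
    have : 2 * (C₀ * D) * (r * v ^ 2) * (6 * (C₀ * D) / r) = 12 * (C₀ * D * v) ^ 2 := by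
      field_simp; ring
    rw [this]
    nlinarith [sq_nonneg (C₀ * D * v)]
  -- Conditioning destroys the centring of `X`, so this term remains; the small value `2 / √r` of
  -- the Stein solution near the mean controls it.
  have hT2 : |F₀ * ∫ x, X x ∂P| ≤ 3 * (C₀ * D) * v := by
    refine abs_le_of_sq_le_sq ?_ (by positivity)
    have h1 : (∫ x, X x ∂P) ^ 2 ≤ ∫ x, X x ^ 2 ∂P := by
      simpa using sq_integral_mul_le (μ := P) hXb (BoundedFun.const 1)
    have h2 : F₀ ^ 2 ≤ 4 / r := by
      rw [← sq_abs]
      calc |F₀| ^ 2 ≤ (2 / √r) ^ 2 := pow_le_pow_left₀ (abs_nonneg _) hc2 2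
        _ = 4 / r := by rw [div_pow, Real.sq_sqrt hr0'.le]; norm_num
    rw [mul_pow]
    refine (mul_le_mul h2 (h1.trans hX2) (sq_nonneg _) (by positivity)).trans ?_
    have : 4 / (r : ℝ) * (2 * (C₀ * D) * (r * v ^ 2)) = 8 * (C₀ * D) * v ^ 2 := by
      field_simp; ring
    rw [this]
    nlinarith [sq_nonneg v, mul_nonneg (sub_nonneg.2 hCD) (sq_nonneg v),
      mul_nonneg (mul_nonneg (sub_nonneg.2 hCD) (sub_nonneg.2 hCD)) (sq_nonneg v)]
  -- `V i` and `W` differ by the occurrences overlapping block `i`. Each costs `1 / r`, and at most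
  -- `D` of them are possible, each with conditional probability at most `C₀ * p`; summing over `i`
  -- gives `n * p / r = 1`.
  have hT3 : |∑ i, ∫ x, J i x * (G i x - F x) ∂P| ≤ C₀ * D := by
    have h1 : ∀ i x, |J i x * (G i x - F x)| ≤
        1 / r * ∑ j ∈ Finset.univ.filter fun j => ¬ Disjoint (blk i) (blk j), I j x := by
      intro i x
      rw [abs_mul, abs_of_nonneg (hJ0 i x)]
      refine (mul_le_of_le_one_left (abs_nonneg _) (hJ1 i x)).trans ?_
      have e1 := hlip (V i x) (W x)
      refine e1.trans (le_of_eq ?_)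
      congr 1
      have e2 : (V i x : ℝ) =
          ∑ j ∈ Finset.univ.filter (fun j => Disjoint (blk i) (blk j)), I j x := by
        simp only [hV, hI, Set.indicator_apply, Pi.one_apply, ← Finset.filter_filter]
        rw [Finset.card_filter]
        push_cast
        rfl
      have e3 := Finset.sum_filter_add_sum_filter_not Finset.univ
        (fun j => Disjoint (blk i) (blk j)) (fun j => I j x)
      have e4 : 0 ≤ ∑ j ∈ Finset.univ.filter fun j => ¬ Disjoint (blk i) (blk j), I j x :=
        Finset.sum_nonneg fun j _ => hI0 j x
      rw [hWI, e2, ← e3, sub_add_cancel_left, abs_neg, abs_of_nonneg e4]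
    have h2 : ∀ i, |∫ x, J i x * (G i x - F x) ∂P| ≤ 1 / r * (D * (C₀ * p)) := by
      intro i
      refine abs_integral_le_integral_abs.trans ?_
      refine (integral_mono (((hJb i).mul ((hGb i).sub hFb)).abs).integrable
        ((BoundedFun.const _).mul (BoundedFun.sum hIb)).integrable (h1 i)).trans ?_
      rw [integral_const_mul, integral_finsetSum _ fun j _ => (hIb j).integrable]
      refine mul_le_mul_of_nonneg_left ?_ (by positivity)
      refine (Finset.sum_le_sum fun j _ => hEI j).trans ?_
      rw [Finset.sum_const, nsmul_eq_mul]
      exact mul_le_mul_of_nonneg_right (by exact_mod_cast hD i) (by positivity)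
    refine (Finset.abs_sum_le_sum_abs _ _).trans ((Finset.sum_le_sum fun i _ => h2 i).trans ?_)
    rw [Finset.sum_const, nsmul_eq_mul, Finset.card_univ, ← hn, hr]
    refine le_of_eq ?_
    field_simp
  rw [← hstein, Finset.sum_congr rfl fun i _ => hswap i (G i) (hGd i), ← Finset.mul_sum, hdec]
  have e1 : r * ∫ x, F x ∂P = p / θ * (n * θ * ∫ x, F x ∂P) := by
    rw [hr]; field_simp
  have e2 : r * ∫ x, F x ∂P - p / θ * (∫ x, X x * (F x - F₀) ∂P + F₀ * ∫ x, X x ∂P +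
      n * θ * ∫ x, F x ∂P + ∑ i, ∫ x, J i x * (G i x - F x) ∂P) =
      -(p / θ * (∫ x, X x * (F x - F₀) ∂P + F₀ * ∫ x, X x ∂P +
        ∑ i, ∫ x, J i x * (G i x - F x) ∂P)) := by
    rw [e1]; ring
  have hpv : p / θ * v = √(p / θ) := by
    have : √(p / θ) = v⁻¹ := by rw [hv, ← Real.sqrt_inv, inv_div]
    rw [this]
    have h3 : p / θ = (v ^ 2)⁻¹ := by rw [hv2, inv_div]
    rw [h3]
    field_simp
  rw [e2, abs_neg, abs_mul, abs_of_nonneg (show 0 ≤ p / θ by positivity), ← hpv]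
  have e3 : |∫ x, X x * (F x - F₀) ∂P + F₀ * ∫ x, X x ∂P +
      ∑ i, ∫ x, J i x * (G i x - F x) ∂P| ≤ 8 * C₀ * D * v := by
    refine (abs_add_le _ _).trans ((add_le_add (abs_add_le _ _) le_rfl).trans ?_)
    have : C₀ * D ≤ C₀ * D * v := le_mul_of_one_le_right (by positivity) hv1
    nlinarith
  calc p / θ * |∫ x, X x * (F x - F₀) ∂P + F₀ * ∫ x, X x ∂P +
      ∑ i, ∫ x, J i x * (G i x - F x) ∂P| ≤ p / θ * (8 * C₀ * D * v) :=
        mul_le_mul_of_nonneg_left e3 (by positivity)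
    _ = 8 * C₀ * D * (p / θ * v) := by ring

end Approximation

/-! ### Point probabilities of sums of offspring variables by Fourier analysis. -/

section LocalLimit

theorem integral_exp_int_mul_period {h : ℕ} (hh : 0 < h) (m : ℤ) :
    ∫ t in (-(Real.pi / h))..(Real.pi / h), Complex.exp ((h * m * Complex.I) * t) =
      if m = 0 then (2 * Real.pi / h : ℂ) else 0 := by
  have hh' : (h : ℂ) ≠ 0 := by exact_mod_cast hh.ne'
  split_ifs with hm
  · simp only [hm, Int.cast_zero, mul_zero, zero_mul, Complex.exp_zero,
      intervalIntegral.integral_const, Complex.real_smul, mul_one]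
    push_cast
    ring
  · have hm' : (m : ℂ) ≠ 0 := by exact_mod_cast hm
    rw [integral_exp_mul_complex (mul_ne_zero (mul_ne_zero hh' hm') Complex.I_ne_zero)]
    have e1 : (h * m * Complex.I) * ((Real.pi / h : ℝ) : ℂ) = m * (Real.pi * Complex.I) := by
      push_cast; field_simp
    have e2 : (h * m * Complex.I) * ((-(Real.pi / h) : ℝ) : ℂ) =
        m * (Real.pi * Complex.I) - m * (2 * Real.pi * Complex.I) := by
      push_cast; field_simp; ring
    rw [e1, e2, Complex.exp_sub, Complex.exp_int_mul_two_pi_mul_I, div_one, sub_self, zero_div]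

/-- Fourier inversion for a random variable that is supported on a residue class. -/
theorem measureReal_eq_integral_charFun {Ω : Type*} [MeasurableSpace Ω] (P : Measure Ω)
    [IsProbabilityMeasure P] {S : Ω → ℕ} (hS : Measurable S) {h : ℕ} (hh : 0 < h) (j : ℕ)
    (hd : ∀ᵐ ω ∂P, (h : ℤ) ∣ (S ω : ℤ) - j) :
    (2 * Real.pi / h : ℂ) * P.real {ω | S ω = j} =
      ∫ t in (-(Real.pi / h))..(Real.pi / h),
        charFun (P.map fun ω => (S ω : ℝ)) t * Complex.exp (-(t * j * Complex.I)) := by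
  have hle : -(Real.pi / h) ≤ Real.pi / h := by
    have : 0 < Real.pi / h := by have := Real.pi_pos; positivity
    linarith
  have hSm : Measurable fun ω => (S ω : ℝ) := measurable_from_nat.comp hS
  have h1 : ∀ t : ℝ, charFun (P.map fun ω => (S ω : ℝ)) t * Complex.exp (-(t * j * Complex.I)) =
      ∫ ω, Complex.exp (t * (S ω : ℝ) * Complex.I) * Complex.exp (-(t * j * Complex.I)) ∂P := by
    intro t
    rw [charFun_apply_real, integral_map hSm.aemeasurable (by fun_prop), integral_mul_const]
  simp_rw [h1]
  rw [intervalIntegral.integral_of_le hle, integral_integral_swap]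
  -- After exchanging the integrals, the inner one runs over a full period of `exp (i * h * t)`,
  -- because `S ω - j` is a multiple of `h`; only `S ω = j` survives.
  · have h2 : ∀ᵐ ω ∂P, ∫ t in Set.Ioc (-(Real.pi / h)) (Real.pi / h),
        Complex.exp (t * (S ω : ℝ) * Complex.I) * Complex.exp (-(t * j * Complex.I)) =
        {ω | S ω = j}.indicator (fun _ => (2 * Real.pi / h : ℂ)) ω := by
      filter_upwards [hd] with ω ⟨m, hm⟩
      rw [← intervalIntegral.integral_of_le hle]
      have h3 := integral_exp_int_mul_period hh m
      have hm' : (S ω : ℂ) - j = h * m := by exact_mod_cast congrArg (Int.cast : ℤ → ℂ) hm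
      have h4 : ∀ t : ℝ, Complex.exp (t * (S ω : ℝ) * Complex.I) *
          Complex.exp (-(t * j * Complex.I)) = Complex.exp ((h * m * Complex.I) * t) := by
        intro t
        rw [← Complex.exp_add, ← hm']
        congr 1
        push_cast
        ring
      simp_rw [h4, h3, Set.indicator_apply, Set.mem_ofPred_eq]
      refine if_congr ?_ rfl rfl
      constructor
      · rintro rfl
        simp only [mul_zero] at hm
        omega
      · intro he
        rw [he, sub_self, eq_comm, mul_eq_zero] at hm
        rcases hm with hm | hm
        · omega
        · exact hm
    have hm : MeasurableSet {ω | S ω = j} := hS (measurableSet_singleton j)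
    rw [integral_congr_ae h2, integral_indicator_const _ hm, mul_comm, Complex.real_smul]
  · refine Integrable.of_bound (C := 1) (Measurable.aestronglyMeasurable (by
      unfold Function.uncurry; fun_prop)) (ae_of_all _ fun ⟨t, ω⟩ => ?_)
    simp only [Function.uncurry]
    rw [norm_mul]
    have e1 : (t : ℂ) * (S ω : ℝ) * Complex.I = ((t * S ω : ℝ) : ℂ) * Complex.I := by push_cast; ring
    have e2 : -((t : ℂ) * j * Complex.I) = ((-(t * j) : ℝ) : ℂ) * Complex.I := by push_cast; ring
    rw [e1, e2, Complex.norm_exp_ofReal_mul_I, Complex.norm_exp_ofReal_mul_I, one_mul]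

/-- The norm equals `2 * |cos (x / 2)|`, and `√(1 - s ^ 2) ≤ 1 - s ^ 2 / 2`. -/
theorem norm_one_add_exp_le (x : ℝ) :
    ‖1 + Complex.exp (x * Complex.I)‖ ≤ 2 - Real.sin (x / 2) ^ 2 := by
  have h0 : 0 ≤ 2 - Real.sin (x / 2) ^ 2 := by nlinarith [Real.sin_sq_le_one (x / 2)]
  refine (sq_le_sq₀ (norm_nonneg _) h0).1 ?_
  have h1 : ‖1 + Complex.exp (x * Complex.I)‖ ^ 2 = 2 + 2 * Real.cos x := by
    rw [Complex.exp_mul_I, ← Complex.ofReal_cos, ← Complex.ofReal_sin, Complex.sq_norm,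
      Complex.normSq_apply]
    simp only [Complex.add_re, Complex.add_im, Complex.one_re, Complex.one_im, Complex.mul_re,
      Complex.mul_im, Complex.ofReal_re, Complex.ofReal_im, Complex.I_re, Complex.I_im]
    nlinarith [Real.sin_sq_add_cos_sq x]
  have h2 : Real.cos x = 1 - 2 * Real.sin (x / 2) ^ 2 := by
    have := Real.cos_two_mul (x / 2)
    rw [mul_div_cancel₀ x two_ne_zero] at this
    nlinarith [Real.sin_sq_add_cos_sq (x / 2)]
  rw [h1, h2]
  nlinarith [sq_nonneg (Real.sin (x / 2) ^ 2)]

theorem charFun_map_natCast (ν : Measure ℕ) (t : ℝ) :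
    charFun (ν.map (Nat.cast : ℕ → ℝ)) t = ∫ k : ℕ, Complex.exp ((t * k : ℝ) * Complex.I) ∂ν := by
  rw [charFun_apply_real, integral_map Measurable.of_discrete.aemeasurable (by fun_prop)]
  simp

theorem integral_sumIndicator_eq {ι : Type*} [Fintype ι] (ν : Measure ℕ) (B : Finset ι) (j : ℕ) :
    ∫ x, sumIndicator B j x ∂iidMeasure ν ι = (iidMeasure ν ι).real {x | ∑ i ∈ B, x i = j} := by
  rw [← integral_indicator_one MeasurableSet.of_discrete]
  refine integral_congr_ae (ae_of_all _ fun x => ?_)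
  simp [sumIndicator, Set.indicator]

variable (ν : Measure ℕ) [IsProbabilityMeasure ν]

theorem integrable_exp_mul_I (t : ℝ) :
    Integrable (fun k : ℕ => Complex.exp ((t * k : ℝ) * Complex.I)) ν :=
  Integrable.of_bound Measurable.of_discrete.aestronglyMeasurable 1
    (ae_of_all _ fun _ => (Complex.norm_exp_ofReal_mul_I _).le)

/-- Equal masses at `0` and at `a` are paired and partly cancel in `1 + exp (i * a * t)`; all
remaining mass is bounded trivially. -/
theorem norm_charFun_le_sub_sin {a : ℕ} (ha : a ≠ 0) (t : ℝ) :
    ‖charFun (ν.map (Nat.cast : ℕ → ℝ)) t‖ ≤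
      1 - min (ν.real {0}) (ν.real {a}) * Real.sin (a * t / 2) ^ 2 := by
  rw [charFun_map_natCast]
  set g : ℕ → ℂ := fun k => Complex.exp ((t * k : ℝ) * Complex.I) with hg
  have hint : Integrable g ν := integrable_exp_mul_I ν t
  set m := min (ν.real {0}) (ν.real {a})
  have hm1 : m ≤ ν.real {0} := min_le_left _ _
  have hm2 : m ≤ ν.real {a} := min_le_right _ _
  have hm0 : 0 ≤ m := le_min measureReal_nonneg measureReal_nonneg
  have hdisj : Disjoint ({0} : Set ℕ) {a} := by simpa using ha.symm
  have hsplit : ∫ k, g k ∂ν = (∫ k in ({0} ∪ {a} : Set ℕ), g k ∂ν) +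
      ∫ k in ({0} ∪ {a} : Set ℕ)ᶜ, g k ∂ν := (integral_add_compl MeasurableSet.of_discrete hint).symm
  have h1 : ∫ k in ({0} ∪ {a} : Set ℕ), g k ∂ν = ν.real {0} + ν.real {a} * g a := by
    rw [setIntegral_union hdisj MeasurableSet.of_discrete hint.integrableOn hint.integrableOn,
      integral_singleton, integral_singleton]
    simp [hg]
  have h2 : ‖∫ k in ({0} ∪ {a} : Set ℕ)ᶜ, g k ∂ν‖ ≤ 1 - ν.real {0} - ν.real {a} := by
    refine (norm_setIntegral_le_of_norm_le_const (C := 1) (measure_lt_top _ _) fun k _ =>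
      (Complex.norm_exp_ofReal_mul_I _).le).trans ?_
    rw [measureReal_compl MeasurableSet.of_discrete,
      measureReal_union hdisj MeasurableSet.of_discrete, probReal_univ]
    linarith
  have h3 : (ν.real {0} : ℂ) + ν.real {a} * g a =
      ((ν.real {0} - m : ℝ) : ℂ) + ((ν.real {a} - m : ℝ) : ℂ) * g a + (m : ℂ) * (1 + g a) := by
    push_cast; ring
  have h4 : ‖(ν.real {0} : ℂ) + ν.real {a} * g a‖ ≤ (ν.real {0} - m) + (ν.real {a} - m) +
      m * (2 - Real.sin (a * t / 2) ^ 2) := by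
    rw [h3]
    refine (norm_add₃_le).trans ?_
    have hga : ‖g a‖ = 1 := Complex.norm_exp_ofReal_mul_I _
    rw [norm_mul, norm_mul, hga, Complex.norm_of_nonneg (sub_nonneg.2 hm1),
      Complex.norm_of_nonneg (sub_nonneg.2 hm2), Complex.norm_of_nonneg hm0, mul_one]
    have h5 := norm_one_add_exp_le (t * a)
    rw [mul_comm t a] at h5
    have h6 : g a = Complex.exp ((a * t : ℝ) * Complex.I) := by
      simp only [hg, mul_comm]
    rw [h6]
    gcongr
  rw [hsplit, h1]
  refine (norm_add_le _ _).trans ((add_le_add h4 h2).trans_eq ?_)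
  ring

variable {ν}

/-- The characteristic function of an offspring law decays like a Gaussian on a period. -/
theorem exists_norm_charFun_le_exp (h0 : ν {0} ≠ 0) (hh : 0 < offspringSpan ν) :
    ∃ c : ℝ, 0 < c ∧ ∀ t : ℝ, |t| ≤ Real.pi / offspringSpan ν →
      ‖charFun (ν.map (Nat.cast : ℕ → ℝ)) t‖ ≤ Real.exp (-c * t ^ 2) := by
  set φ := charFun (ν.map (Nat.cast : ℕ → ℝ)) with hφ
  set h := offspringSpan ν with hhdef
  have hφ1 : ∀ t, ‖φ t‖ ≤ 1 := fun t => by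
    have : IsProbabilityMeasure (ν.map (Nat.cast : ℕ → ℝ)) :=
      Measure.isProbabilityMeasure_map Measurable.of_discrete.aemeasurable
    exact norm_charFun_le_one t
  -- If `‖φ t‖` is near one, then `sin (a * t / 2)` is small for every `a` in the support. The
  -- addition formula for the sine extends this to all sums of such `a`.
  have hcl : ∀ m ∈ AddSubmonoid.closure {i | 1 ≤ i ∧ ν {i} ≠ 0},
      ∃ C : ℝ, 0 ≤ C ∧ ∀ t : ℝ, |Real.sin (m * t / 2)| ≤ C * √(1 - ‖φ t‖) := by
    intro m hm
    induction hm using AddSubmonoid.closure_induction with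
    | mem a ha =>
      have hp : 0 < min (ν.real {0}) (ν.real {a}) := by
        refine lt_min ?_ ?_
        · exact ENNReal.toReal_pos h0 (measure_ne_top _ _)
        · exact ENNReal.toReal_pos ha.2 (measure_ne_top _ _)
      set q := min (ν.real {0}) (ν.real {a})
      refine ⟨√(1 / q), Real.sqrt_nonneg _, fun t => ?_⟩
      rw [← Real.sqrt_mul (by positivity)]
      refine Real.abs_le_sqrt ?_
      have := norm_charFun_le_sub_sin ν (a := a) (by have := ha.1; omega) t
      rw [div_mul_eq_mul_div, one_mul, le_div_iff₀ hp]
      linarith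
    | zero => exact ⟨0, le_rfl, fun t => by simp⟩
    | add a b _ _ iha ihb =>
      obtain ⟨C, hC, hC'⟩ := iha
      obtain ⟨D, hD, hD'⟩ := ihb
      refine ⟨C + D, by positivity, fun t => ?_⟩
      have e : ((a + b : ℕ) : ℝ) * t / 2 = a * t / 2 + b * t / 2 := by push_cast; ring
      rw [e, Real.sin_add, add_mul]
      refine (abs_add_le _ _).trans (add_le_add ?_ ?_)
      · rw [abs_mul]
        exact (mul_le_of_le_one_right (abs_nonneg _) (Real.abs_cos_le_one _)).trans (hC' t)
      · rw [abs_mul]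
        exact (mul_le_of_le_one_left (abs_nonneg _) (Real.abs_cos_le_one _)).trans (hD' t)
  -- The span itself need not be a sum of support points, but it is the difference of the
  -- consecutive multiples `h * N` and `h * (N + 1)`, both in the closure for large `N`. The summand
  -- `1` only makes the constant positive.
  obtain ⟨C, hC0, hC⟩ : ∃ C : ℝ, 0 < C ∧ ∀ t : ℝ, |Real.sin (h * t / 2)| ≤ C * √(1 - ‖φ t‖) := by
    obtain ⟨N, hN⟩ := Nat.exists_mem_closure_of_ge {i | 1 ≤ i ∧ ν {i} ≠ 0}
    obtain ⟨C, hC, hC'⟩ := hcl (h * N) (hN _ (Nat.le_mul_of_pos_left N hh) (dvd_mul_right _ _))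
    obtain ⟨D, hD, hD'⟩ := hcl (h * (N + 1)) (hN _ ((Nat.le_succ N).trans
      (Nat.le_mul_of_pos_left _ hh)) (dvd_mul_right _ _))
    refine ⟨D + C + 1, by positivity, fun t => ?_⟩
    have e : (h : ℝ) * t / 2 = ((h * (N + 1) : ℕ) : ℝ) * t / 2 - ((h * N : ℕ) : ℝ) * t / 2 := by
      push_cast; ring
    rw [e, Real.sin_sub, add_mul, add_mul, one_mul]
    refine (abs_sub _ _).trans (le_add_of_le_of_nonneg (add_le_add ?_ ?_) (Real.sqrt_nonneg _))
    · rw [abs_mul]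
      exact (mul_le_of_le_one_right (abs_nonneg _) (Real.abs_cos_le_one _)).trans (hD' t)
    · rw [abs_mul]
      exact (mul_le_of_le_one_left (abs_nonneg _) (Real.abs_cos_le_one _)).trans (hC' t)
  have hh' : (0 : ℝ) < h := by exact_mod_cast hh
  refine ⟨(h / (C * Real.pi)) ^ 2, by have := Real.pi_pos; positivity, fun t ht => ?_⟩
  have h1 : |(h : ℝ) * t / 2| ≤ Real.pi / 2 := by
    rw [abs_div, abs_mul, abs_of_pos hh', abs_two]
    have := mul_le_mul_of_nonneg_left ht hh'.le
    rw [mul_div_cancel₀ _ hh'.ne'] at this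
    linarith
  -- On a period `|h * t / 2| ≤ π / 2`, so the sine is at least linear there.
  have h2 := (Real.mul_abs_le_abs_sin h1).trans (hC t)
  have h3 : (2 / Real.pi * |(h : ℝ) * t / 2|) ^ 2 ≤ (C * √(1 - ‖φ t‖)) ^ 2 :=
    pow_le_pow_left₀ (by have := Real.pi_pos; positivity) h2 2
  rw [mul_pow, mul_pow, sq_abs, Real.sq_sqrt (sub_nonneg.2 (hφ1 t))] at h3
  have h4 : (h / (C * Real.pi)) ^ 2 * t ^ 2 ≤ 1 - ‖φ t‖ := by
    have e : (h / (C * Real.pi)) ^ 2 * t ^ 2 = (2 / Real.pi) ^ 2 * (h * t / 2) ^ 2 / C ^ 2 := by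
      have := Real.pi_pos
      field_simp
    rw [e, div_le_iff₀ (by positivity)]
    linarith
  have h5 := Real.add_one_le_exp (-(h / (C * Real.pi)) ^ 2 * t ^ 2)
  linarith

variable {ι : Type*} [Fintype ι]

theorem charFun_map_sum (B : Finset ι) :
    charFun ((iidMeasure ν ι).map fun x => ((∑ i ∈ B, x i : ℕ) : ℝ)) =
      charFun (ν.map (Nat.cast : ℕ → ℝ)) ^ B.card := by
  have hi : iIndepFun (fun (i : ι) (x : ι → ℕ) => (x i : ℝ)) (iidMeasure ν ι) :=
    iIndepFun_pi (X := fun _ => (Nat.cast : ℕ → ℝ))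
      fun _ => Measurable.of_discrete.aemeasurable
  have h1 := (hi.restrict B).charFun_map_fun_finsetSum_eq_prod
    (fun i _ => Measurable.of_discrete.aemeasurable)
  have h2 : ∀ i, (iidMeasure ν ι).map (fun x => (x i : ℝ)) = ν.map (Nat.cast : ℕ → ℝ) := by
    intro i
    conv_rhs => rw [← (measurePreserving_eval (fun _ : ι => ν) i).map_eq]
    exact (Measure.map_map (μ := Measure.pi fun _ : ι => ν) (f := Function.eval i)
      (g := (Nat.cast : ℕ → ℝ)) Measurable.of_discrete (measurable_pi_apply i)).symm
  simp only [h2, Finset.prod_const] at h1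
  rw [← h1]
  simp

theorem ae_offspringSpan_dvd_sum (B : Finset ι) :
    ∀ᵐ x ∂iidMeasure ν ι, offspringSpan ν ∣ ∑ i ∈ B, x i := by
  have h1 : ∀ᵐ k ∂ν, offspringSpan ν ∣ k := by
    rw [ae_iff_of_countable]
    intro k hk
    rcases Nat.eq_zero_or_pos k with rfl | h
    · exact dvd_zero _
    · exact Nat.setGcd_dvd_of_mem ⟨h, hk⟩
  have h2 : ∀ᵐ x ∂iidMeasure ν ι, ∀ i, offspringSpan ν ∣ x i :=
    ae_all_iff.2 fun i => (Measure.quasiMeasurePreserving_eval (fun _ : ι => ν) i).ae h1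
  filter_upwards [h2] with x hx
  exact Finset.dvd_sum fun i _ => hx i

theorem sumIndicator_eq_integral_charFun (hh : 0 < offspringSpan ν) (B : Finset ι) {j : ℕ}
    (hj : offspringSpan ν ∣ j) :
    (2 * Real.pi / offspringSpan ν : ℂ) * ((∫ x, sumIndicator B j x ∂iidMeasure ν ι : ℝ) : ℂ) =
      ∫ t in (-(Real.pi / offspringSpan ν))..(Real.pi / offspringSpan ν),
        charFun (ν.map (Nat.cast : ℕ → ℝ)) t ^ B.card * Complex.exp (-(t * j * Complex.I)) := by
  have := measureReal_eq_integral_charFun (iidMeasure ν ι) (S := fun x => ∑ i ∈ B, x i)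
    Measurable.of_discrete hh j (by
      filter_upwards [ae_offspringSpan_dvd_sum (ν := ν) B] with x hx
      exact dvd_sub (by exact_mod_cast hx) (by exact_mod_cast hj))
  rw [integral_sumIndicator_eq, this, charFun_map_sum]
  rfl

/-- An upper bound for point probabilities of sums of independent offspring variables. -/
theorem exists_integral_sumIndicator_le (h0 : ν {0} ≠ 0) (hh : 0 < offspringSpan ν) :
    ∃ C : ℝ, 0 < C ∧ ∀ (ι : Type) [Fintype ι] (B : Finset ι) (j : ℕ), 0 < B.card →
      ∫ x, sumIndicator B j x ∂iidMeasure ν ι ≤ C / √B.card := by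
  obtain ⟨c, hc, hφ⟩ := exists_norm_charFun_le_exp h0 hh
  have hh' : (0 : ℝ) < offspringSpan ν := by exact_mod_cast hh
  have hpi := Real.pi_pos
  -- The Gaussian integral `√(π / (c * B.card))` divided by the normalization `2 * π / h` of the
  -- inversion formula.
  refine ⟨√(Real.pi / c) * (offspringSpan ν / (2 * Real.pi)), by positivity,
    fun ι _ B j hB => ?_⟩
  have hB' : (0 : ℝ) < B.card := by exact_mod_cast hB
  by_cases hj : offspringSpan ν ∣ j
  · have h1 := congrArg norm (sumIndicator_eq_integral_charFun (ν := ν) hh B hj)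
    have hle : -(Real.pi / offspringSpan ν) ≤ Real.pi / offspringSpan ν := by
      have : 0 < Real.pi / offspringSpan ν := by positivity
      linarith
    have hq0 : 0 ≤ ∫ x, sumIndicator B j x ∂iidMeasure ν ι :=
      integral_nonneg fun x => sumIndicator_nonneg _ _ x
    rw [norm_mul, Complex.norm_of_nonneg hq0] at h1
    have h2 : ‖(2 * Real.pi / offspringSpan ν : ℂ)‖ = 2 * Real.pi / offspringSpan ν := by
      rw [show (2 * Real.pi / offspringSpan ν : ℂ) = ((2 * Real.pi / offspringSpan ν : ℝ) : ℂ) by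
        push_cast; rfl]
      exact Complex.norm_of_nonneg (by positivity)
    have hgi : Integrable fun t : ℝ => Real.exp (-(c * B.card) * t ^ 2) :=
      integrable_exp_neg_mul_sq (by positivity)
    have h3 : ‖∫ t in (-(Real.pi / offspringSpan ν))..(Real.pi / offspringSpan ν),
        charFun (ν.map (Nat.cast : ℕ → ℝ)) t ^ B.card * Complex.exp (-(t * j * Complex.I))‖ ≤
        √(Real.pi / (c * B.card)) := by
      rw [← integral_gaussian]
      refine (intervalIntegral.norm_integral_le_of_norm_le hle (ae_of_all _ fun t ht => ?_)
        hgi.intervalIntegrable).trans ?_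
      · have e2 : -((t : ℂ) * j * Complex.I) = ((-(t * j) : ℝ) : ℂ) * Complex.I := by
          push_cast; ring
        rw [norm_mul, e2, Complex.norm_exp_ofReal_mul_I, mul_one, norm_pow]
        refine (pow_le_pow_left₀ (norm_nonneg _) (hφ t (abs_le.2 ⟨ht.1.le, ht.2⟩)) _).trans_eq ?_
        rw [← Real.exp_nat_mul]
        congr 1
        ring
      · rw [intervalIntegral.integral_of_le hle]
        exact setIntegral_le_integral hgi (ae_of_all _ fun t => (Real.exp_pos _).le)
    rw [← h1, h2] at h3
    rw [mul_comm, ← le_div_iff₀ (by positivity)] at h3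
    refine h3.trans_eq ?_
    rw [← div_div, Real.sqrt_div (by positivity)]
    field_simp
  · rw [integral_sumIndicator_eq, measureReal_def]
    have : (iidMeasure ν ι) {x | ∑ i ∈ B, x i = j} = 0 := by
      refine measure_mono_null ?_ (ae_iff.1 (ae_offspringSpan_dvd_sum (ν := ν) B))
      intro x hx hd
      exact hj (hx ▸ hd)
    rw [this]
    simp only [ENNReal.toReal_zero]
    positivity

/-- A lower bound for the point probabilities at the mean minus one of sums of independent offspring
variables; a weak form of the **local limit theorem**. -/
theorem exists_le_integral_sumIndicator (hL2 : MemLp (fun i : ℕ => (i : ℝ)) 2 ν)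
    (hmean : ∫ i : ℕ, (i : ℝ) ∂ν = 1) (hvar : 0 < variance (fun i : ℕ => (i : ℝ)) ν)
    (h0 : ν {0} ≠ 0) (hh : 0 < offspringSpan ν) :
    ∃ C : ℝ, 0 < C ∧ ∃ m₀ : ℕ, ∀ (ι : Type) [Fintype ι] (B : Finset ι), m₀ ≤ B.card →
      B.card ≡ 1 [MOD offspringSpan ν] →
      C / √B.card ≤ ∫ x, sumIndicator B (B.card - 1) x ∂iidMeasure ν ι := by
  obtain ⟨c, hc, hφ⟩ := exists_norm_charFun_le_exp h0 hh
  set φ := charFun (ν.map (Nat.cast : ℕ → ℝ)) with hφdef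
  set h := offspringSpan ν with hhdef
  set v := variance (fun i : ℕ => (i : ℝ)) ν with hv
  set σ := √v with hσ
  have hσ0 : 0 < σ := Real.sqrt_pos.2 hvar
  have hσ2 : σ ^ 2 = v := Real.sq_sqrt hvar.le
  have hh' : (0 : ℝ) < h := by exact_mod_cast hh
  have hpi := Real.pi_pos
  have hint : Integrable (fun i : ℕ => (i : ℝ)) ν := hL2.integrable (by norm_num)
  set X : ℕ → ℝ := fun k => ((k : ℝ) - 1) / σ with hX
  have hX0 : ν[X] = 0 := by
    simp only [hX]
    rw [integral_div, integral_sub hint (integrable_const _), hmean]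
    simp
  have hX1 : ν[X ^ 2] = 1 := by
    have : ∀ k, (X ^ 2) k = ((k : ℝ) - 1) ^ 2 / v := fun k => by
      simp only [hX, Pi.pow_apply, div_pow, hσ2]
    simp only [this]
    rw [integral_div]
    have h2 := variance_eq_integral (μ := ν) (X := fun i : ℕ => (i : ℝ))
      Measurable.of_discrete.aemeasurable
    rw [hmean] at h2
    rw [← h2, ← hv, div_self hvar.ne']
  have hrel : ∀ s : ℝ, charFun (ν.map X) (s * σ) = φ s * Complex.exp (-(s * Complex.I)) := by
    intro s
    rw [hφdef, charFun_map_natCast, charFun_apply_real,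
      integral_map Measurable.of_discrete.aemeasurable (by fun_prop), ← integral_mul_const]
    refine integral_congr_ae (ae_of_all _ fun k => ?_)
    simp only [hX]
    rw [← Complex.exp_add]
    congr 1
    push_cast
    have : (σ : ℂ) ≠ 0 := by exact_mod_cast hσ0.ne'
    field_simp
    ring
  have hlim : ∀ u : ℝ, Tendsto (fun m : ℕ => (φ (u / √m) * Complex.exp (-((u / √m : ℝ) *
      Complex.I))) ^ m) atTop (𝓝 (Complex.exp (-((σ * u : ℝ) : ℂ) ^ 2 / 2))) := by
    intro u
    refine (tendsto_charFun_inv_sqrt_mul_pow (X := X) (P := ν)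
      Measurable.of_discrete.aemeasurable hX0 hX1 (σ * u)).congr fun m => ?_
    rw [← hrel]
    congr 2
    ring
  set A : ℕ → ℂ := fun m => ∫ t in (-(Real.pi / h))..(Real.pi / h),
    φ t ^ m * Complex.exp (-(t * ((m - 1 : ℕ) : ℂ) * Complex.I)) with hA
  -- The inversion integrand after substituting `t = u / √m`, extended by zero so that all integrals
  -- run over the line. The bound on `φ` dominates it by a fixed Gaussian.
  set G : ℕ → ℝ → ℂ := fun m => (Set.Ioc (-(Real.pi / h) * √m) (Real.pi / h * √m)).indicator
    (fun u => φ (u / √m) ^ m * Complex.exp (-((u / √m : ℝ) * ((m - 1 : ℕ) : ℂ) * Complex.I)))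
    with hG
  have hφc : Continuous φ := by
    have : IsProbabilityMeasure (ν.map (Nat.cast : ℕ → ℝ)) :=
      Measure.isProbabilityMeasure_map Measurable.of_discrete.aemeasurable
    exact continuous_charFun
  have hAG : ∀ m : ℕ, 0 < m → (√m : ℂ) * A m = ∫ u, G m u := by
    intro m hm
    have hm' : (0 : ℝ) < √m := Real.sqrt_pos.2 (by exact_mod_cast hm)
    have h1 := intervalIntegral.integral_comp_div (a := -(Real.pi / h) * √m)
      (b := Real.pi / h * √m)
      (fun t : ℝ => φ t ^ m * Complex.exp (-(t * ((m - 1 : ℕ) : ℂ) * Complex.I))) hm'.ne'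
    rw [mul_div_cancel_right₀ _ hm'.ne', mul_div_cancel_right₀ _ hm'.ne',
      intervalIntegral.integral_of_le (by
        have : 0 < Real.pi / h * √m := by positivity
        linarith), Complex.real_smul] at h1
    rw [hA, ← h1, hG, integral_indicator measurableSet_Ioc]
  have hGb : ∀ m : ℕ, ∀ u : ℝ, ‖G m u‖ ≤ Real.exp (-c * u ^ 2) := by
    intro m u
    by_cases hu : u ∈ Set.Ioc (-(Real.pi / h) * √m) (Real.pi / h * √m)
    · simp only [hG]
      rw [Set.indicator_of_mem hu]
      have hm' : 0 < √(m : ℝ) := by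
        by_contra hneg
        have h2 : √(m : ℝ) = 0 := le_antisymm (not_lt.1 hneg) (Real.sqrt_nonneg _)
        rw [h2, mul_zero, mul_zero] at hu
        exact absurd (hu.1.trans_le hu.2) (lt_irrefl _)
      have hm2 : √(m : ℝ) ^ 2 = m := Real.sq_sqrt (Nat.cast_nonneg m)
      have e2 : -(((u / √m : ℝ) : ℂ) * ((m - 1 : ℕ) : ℂ) * Complex.I) =
          ((-(u / √m * (m - 1 : ℕ)) : ℝ) : ℂ) * Complex.I := by
        push_cast; ring
      rw [norm_mul, e2, Complex.norm_exp_ofReal_mul_I, mul_one, norm_pow]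
      have hu' : |u / √m| ≤ Real.pi / h := by
        rw [abs_div, abs_of_pos hm', div_le_iff₀ hm', abs_le]
        exact ⟨by linarith [hu.1], hu.2⟩
      refine (pow_le_pow_left₀ (norm_nonneg _) (hφ _ hu') _).trans_eq ?_
      rw [← Real.exp_nat_mul, div_pow, hm2]
      congr 1
      have : (m : ℝ) ≠ 0 := by rw [← hm2]; positivity
      field_simp
    · simp only [hG]
      rw [Set.indicator_of_notMem hu, norm_zero]
      exact (Real.exp_pos _).le
  have hGlim : ∀ u : ℝ, Tendsto (fun m => G m u) atTop
      (𝓝 (Complex.exp (-((σ * u : ℝ) : ℂ) ^ 2 / 2))) := by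
    intro u
    have hs : Tendsto (fun m : ℕ => √(m : ℝ)) atTop atTop :=
      Real.tendsto_sqrt_atTop.comp tendsto_natCast_atTop_atTop
    -- The target value is `m - 1`, not the mean `m`; the discrepancy is this factor, which
    -- disappears in the limit.
    have h1 : Tendsto (fun m : ℕ => Complex.exp (((u / √m : ℝ) : ℂ) * Complex.I)) atTop (𝓝 1) := by
      have h2 : Tendsto (fun m : ℕ => u / √(m : ℝ)) atTop (𝓝 0) := hs.const_div_atTop u
      have h3 : Continuous fun s : ℝ => Complex.exp ((s : ℂ) * Complex.I) := by fun_prop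
      have h5 := (h3.tendsto 0).comp h2
      simp only [Complex.ofReal_zero, zero_mul, Complex.exp_zero] at h5
      exact h5
    have h4 := (hlim u).mul h1
    rw [mul_one] at h4
    refine h4.congr' ?_
    filter_upwards [hs.eventually_gt_atTop (|u| / (Real.pi / h)), eventually_gt_atTop 0]
      with m hm hm0
    rw [div_lt_iff₀ (by positivity)] at hm
    have hu := abs_lt.1 hm
    have hmem : u ∈ Set.Ioc (-(Real.pi / h) * √m) (Real.pi / h * √m) :=
      ⟨by linarith [hu.1], by linarith [hu.2]⟩
    simp only [hG]
    rw [Set.indicator_of_mem hmem, mul_pow, ← Complex.exp_nat_mul, mul_assoc, ← Complex.exp_add]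
    congr 2
    rw [Nat.cast_sub hm0]
    push_cast
    ring
  have hmeas : ∀ m, AEStronglyMeasurable (G m) volume := by
    intro m
    refine AEStronglyMeasurable.indicator ?_ measurableSet_Ioc
    refine Continuous.aestronglyMeasurable ?_
    have h1 : Continuous fun u : ℝ => u / √(m : ℝ) := continuous_id.div_const _
    have h2 := hφc.comp h1
    exact (h2.pow m).mul (by fun_prop)
  have hlimint := tendsto_integral_of_dominated_convergence (fun u : ℝ => Real.exp (-c * u ^ 2))
    hmeas (integrable_exp_neg_mul_sq hc) (fun m => ae_of_all _ (hGb m)) (ae_of_all _ hGlim)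
  have hL : ∫ u : ℝ, Complex.exp (-((σ * u : ℝ) : ℂ) ^ 2 / 2) = ((√(Real.pi / (v / 2)) : ℝ) : ℂ) := by
    rw [← integral_gaussian, ← integral_complex_ofReal]
    refine integral_congr_ae (ae_of_all _ fun u => ?_)
    simp only
    rw [Complex.ofReal_exp, ← hσ2]
    congr 1
    push_cast
    ring
  set L := √(Real.pi / (v / 2)) with hLdef
  have hL0 : 0 < L := by positivity
  rw [hL] at hlimint
  have hre := (Complex.continuous_re.tendsto _).comp hlimint
  rw [Complex.ofReal_re] at hre
  obtain ⟨m₀, hm₀⟩ := eventually_atTop.1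
    ((hre.eventually_const_lt (half_lt_self hL0)).and (eventually_gt_atTop 0))
  -- `√m` times the inversion integral tends to `L`, hence eventually exceeds `L / 2`.
  refine ⟨L / 2 / (2 * Real.pi / h), by positivity, m₀, fun ι _ B hB hmod => ?_⟩
  obtain ⟨h1, hm⟩ := hm₀ _ hB
  have hm' : 0 < √(B.card : ℝ) := Real.sqrt_pos.2 (by exact_mod_cast hm)
  have hdvd : h ∣ B.card - 1 := (Nat.modEq_iff_dvd' hm).1 hmod.symm
  have h2 := sumIndicator_eq_integral_charFun (ν := ν) hh B hdvd
  have h3 : (√(B.card : ℝ) : ℂ) * A B.card = ((√(B.card : ℝ) * (2 * Real.pi / h *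
      ∫ x, sumIndicator B (B.card - 1) x ∂iidMeasure ν ι) : ℝ) : ℂ) := by
    have h4 : A B.card = _ := h2.symm
    rw [h4]
    push_cast
    rfl
  rw [Function.comp_apply, ← hAG _ hm, h3, Complex.ofReal_re] at h1
  rw [div_le_iff₀ hm', div_le_iff₀ (by positivity)]
  linarith

end LocalLimit

/-! ### Blocks of cyclically consecutive positions. -/

section CyclicBlocks

variable {n : ℕ} [NeZero n]

/-- The `k` cyclically consecutive positions from `i` on. -/
def cyclicBlock (k : ℕ) (i : Fin n) : Finset (Fin n) :=
  (Finset.range k).image fun j => i + Fin.ofNat n j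

theorem fin_add_ofNat_injOn {k : ℕ} (hk : k ≤ n) (i : Fin n) :
    Set.InjOn (fun j => i + Fin.ofNat n j) (Finset.range k : Set ℕ) := by
  intro a ha b hb hab
  simp only [Finset.coe_range, Set.mem_Iio] at ha hb
  have h := congrArg Fin.val (add_left_cancel hab)
  simpa [Fin.ofNat, Nat.mod_eq_of_lt (ha.trans_le hk), Nat.mod_eq_of_lt (hb.trans_le hk)] using h

theorem card_cyclicBlock {k : ℕ} (hk : k ≤ n) (i : Fin n) : (cyclicBlock k i).card = k := by
  rw [cyclicBlock, Finset.card_image_of_injOn (fin_add_ofNat_injOn hk i), Finset.card_range]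

theorem fin_ofNat_add (a b : ℕ) : Fin.ofNat n (a + b) = Fin.ofNat n a + Fin.ofNat n b := by
  ext
  simp [Fin.ofNat, Fin.val_add]

theorem exists_eq_add_of_not_disjoint_cyclicBlock {k : ℕ} {i j : Fin n}
    (h : ¬ Disjoint (cyclicBlock k i) (cyclicBlock k j)) :
    ∃ m < k, j = i + Fin.ofNat n m ∨ i = j + Fin.ofNat n m := by
  obtain ⟨l, hi, hj⟩ := Finset.not_disjoint_iff.1 h
  obtain ⟨a, ha, rfl⟩ := Finset.mem_image.1 hi
  obtain ⟨b, hb, hab⟩ := Finset.mem_image.1 hj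
  rw [Finset.mem_range] at ha hb
  rcases le_total a b with hle | hle
  · obtain ⟨m, rfl⟩ := Nat.exists_eq_add_of_le' hle
    refine ⟨m, by omega, Or.inr ?_⟩
    rw [fin_ofNat_add, ← add_assoc] at hab
    exact (add_right_cancel hab).symm
  · obtain ⟨m, rfl⟩ := Nat.exists_eq_add_of_le' hle
    refine ⟨m, by omega, Or.inl ?_⟩
    rw [fin_ofNat_add, ← add_assoc] at hab
    exact add_right_cancel hab

open Classical in
theorem card_not_disjoint_cyclicBlock_le (k : ℕ) (i : Fin n) :
    (Finset.univ.filter fun j => ¬ Disjoint (cyclicBlock k i) (cyclicBlock k j)).card ≤ 2 * k := by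
  have h : (Finset.univ.filter fun j => ¬ Disjoint (cyclicBlock k i) (cyclicBlock k j)) ⊆
      (Finset.range k).image (fun m => i + Fin.ofNat n m) ∪
        (Finset.range k).image (fun m => i - Fin.ofNat n m) := by
    intro j hj
    obtain ⟨m, hm, h⟩ := exists_eq_add_of_not_disjoint_cyclicBlock (Finset.mem_filter.1 hj).2
    rw [Finset.mem_union, Finset.mem_image, Finset.mem_image]
    rcases h with rfl | rfl
    · exact Or.inl ⟨m, Finset.mem_range.2 hm, rfl⟩
    · exact Or.inr ⟨m, Finset.mem_range.2 hm, by simp⟩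
  refine (Finset.card_le_card h).trans ((Finset.card_union_le _ _).trans ?_)
  have h1 := Finset.card_image_le (s := Finset.range k) (f := fun m => i + Fin.ofNat n m)
  have h2 := Finset.card_image_le (s := Finset.range k) (f := fun m => i - Fin.ofNat n m)
  rw [Finset.card_range] at h1 h2
  omega

theorem dependsOn_occursAt (p : List ℕ) (i : Fin n) :
    DependsOn (fun x => x ∈ {x : Fin n → ℕ | OccursAt p x i})
      (cyclicBlock p.length i : Set (Fin n)) := by
  intro x y h
  refine propext (forall₂_congr fun j hj => ?_)
  rw [h _ (Finset.mem_coe.2 (Finset.mem_image_of_mem _ (Finset.mem_range.2 hj)))]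

theorem sum_cyclicBlock {p : List ℕ} (hp : p.length ≤ n) {x : Fin n → ℕ} {i : Fin n}
    (h : OccursAt p x i) : ∑ l ∈ cyclicBlock p.length i, x l = p.sum := by
  rw [cyclicBlock, Finset.sum_image (fin_add_ofNat_injOn hp i), ← Fin.sum_univ_eq_sum_range
    (fun j => x (i + Fin.ofNat n j)), ← Fin.sum_univ_getElem]
  exact Finset.sum_congr rfl fun j _ => h j j.2

/-- Two overlapping occurrences would make a proper suffix of `p` one of its prefixes. -/
theorem not_occursAt_add {p : List ℕ} (hp : ∀ m, 0 < m → m < p.length → ¬ p.drop m <+: p)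
    {m : ℕ} (h0 : 0 < m) (hm : m < p.length) {x : Fin n → ℕ} {i : Fin n} (h : OccursAt p x i) :
    ¬ OccursAt p x (i + Fin.ofNat n m) := by
  intro h'
  refine hp m h0 hm (List.prefix_iff_getElem.2 ⟨by simp, fun l hl => ?_⟩)
  rw [List.length_drop] at hl
  rw [List.getElem_drop, ← h (m + l) (by omega), ← h' l (by omega), fin_ofNat_add, add_assoc]

theorem disjoint_occursAt {p : List ℕ} (hp : ∀ m, 0 < m → m < p.length → ¬ p.drop m <+: p)
    {i j : Fin n} (hij : i ≠ j)
    (h : ¬ Disjoint (cyclicBlock p.length i) (cyclicBlock p.length j)) :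
    Disjoint {x : Fin n → ℕ | OccursAt p x i} {x | OccursAt p x j} := by
  rw [Set.disjoint_left]
  intro x hi hj
  obtain ⟨m, hm, h⟩ := exists_eq_add_of_not_disjoint_cyclicBlock h
  rcases Nat.eq_zero_or_pos m with rfl | h0
  · have : Fin.ofNat n 0 = 0 := rfl
    simp only [this, add_zero] at h
    exact h.elim (fun h => hij h.symm) hij
  · rcases h with rfl | rfl
    · exact not_occursAt_add hp h0 hm hi hj
    · exact not_occursAt_add hp h0 hm hj hi

theorem iidMeasure_occursAt (ν : Measure ℕ) [IsProbabilityMeasure ν] {p : List ℕ}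
    (hp : p.length ≤ n) (i : Fin n) :
    iidMeasure ν (Fin n) {x | OccursAt p x i} = (p.map fun d => ν {d}).prod := by
  classical
  set t : Fin n → Set ℕ := fun l => if l ∈ cyclicBlock p.length i then
    {p.getD (l - i).val 0} else Set.univ with ht
  have hval : ∀ j < p.length, (i + Fin.ofNat n j - i).val = j := by
    intro j hj
    rw [add_sub_cancel_left]
    exact Nat.mod_eq_of_lt (hj.trans_le hp)
  have e : {x : Fin n → ℕ | OccursAt p x i} = Set.pi Set.univ t := by
    ext x
    simp only [Set.mem_ofPred_eq, Set.mem_pi, Set.mem_univ, true_implies]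
    constructor
    · intro h l
      simp only [ht]
      split_ifs with hl
      · obtain ⟨j, hj, rfl⟩ := Finset.mem_image.1 hl
        rw [Finset.mem_range] at hj
        rw [hval j hj, Set.mem_singleton_iff, h j hj, List.getD_eq_getElem _ _ hj]
      · trivial
    · intro h j hj
      have := h (i + Fin.ofNat n j)
      simp only [ht] at this
      have hmem : i + Fin.ofNat n j ∈ cyclicBlock p.length i :=
        Finset.mem_image_of_mem _ (Finset.mem_range.2 hj)
      rwa [if_pos hmem, hval j hj,
        Set.mem_singleton_iff, List.getD_eq_getElem _ _ hj] at this
  rw [e, Measure.pi_pi]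
  have e2 : ∏ l, ν (t l) = ∏ l ∈ cyclicBlock p.length i, ν {p.getD (l - i).val 0} := by
    rw [← Finset.prod_subset (Finset.subset_univ (cyclicBlock p.length i))]
    · exact Finset.prod_congr rfl fun l hl => by simp only [ht, if_pos hl]
    · intro l _ hl
      simp only [ht, if_neg hl, measure_univ]
  rw [e2, cyclicBlock, Finset.prod_image (fin_add_ofNat_injOn hp i), ← Fin.prod_univ_eq_prod_range
    (fun j => ν {p.getD (i + Fin.ofNat n j - i).val 0}), ← Fin.prod_univ_fun_getElem]
  refine Finset.prod_congr rfl fun j _ => ?_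
  rw [hval j j.2, List.getD_eq_getElem _ _ j.2]

/-- Blocks starting in the first half never reach the final stretch, whose variables stay free. This
serves as one of the two groups in the variance bound. -/
theorem cyclicBlock_subset_of_lt {k : ℕ} (hk : n / 2 + k ≤ n) {i : Fin n} (hi : i.val < n / 2) :
    cyclicBlock k i ⊆ ((Finset.Ico (n / 2 + k) n).attachFin fun _ h => (Finset.mem_Ico.1 h).2)ᶜ := by
  intro l hl
  obtain ⟨j, hj, rfl⟩ := Finset.mem_image.1 hl
  rw [Finset.mem_range] at hj
  rw [Finset.mem_compl, Finset.mem_attachFin, Finset.mem_Ico, not_and_or]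
  left
  have : (i + Fin.ofNat n j).val = i + j := by
    rw [Fin.val_add, Fin.val_ofNat, Nat.add_mod_mod, Nat.mod_eq_of_lt (by omega)]
  omega

/-- Blocks starting in the second half may wrap around, but only into the first `k` positions; the
rest of the first half stays free. -/
theorem cyclicBlock_subset_of_le {k : ℕ} (hk : k ≤ n) {i : Fin n} (hi : n / 2 ≤ i.val) :
    cyclicBlock k i ⊆ ((Finset.Ico k (n / 2)).attachFin
      fun _ h => (Finset.mem_Ico.1 h).2.trans_le (Nat.div_le_self n 2))ᶜ := by
  intro l hl
  obtain ⟨j, hj, rfl⟩ := Finset.mem_image.1 hl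
  rw [Finset.mem_range] at hj
  rw [Finset.mem_compl, Finset.mem_attachFin, Finset.mem_Ico, not_and_or]
  have hi' := i.2
  rw [Fin.val_add, Fin.val_ofNat, Nat.add_mod_mod]
  rcases lt_or_ge (i.val + j) n with h | h
  · rw [Nat.mod_eq_of_lt h]
    right; omega
  · rw [Nat.mod_eq_sub_mod h, Nat.mod_eq_of_lt (by omega)]
    left; omega

/-- The characteristic function of the sum depends only on the number of summands; Fourier inversion
with period `h = 1` recovers the point probabilities. -/
theorem integral_sumIndicator_congr_card {ι : Type*} [Fintype ι] (ν : Measure ℕ)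
    [IsProbabilityMeasure ν] {B B' : Finset ι} (h : B.card = B'.card) (j : ℕ) :
    ∫ x, sumIndicator B j x ∂iidMeasure ν ι = ∫ x, sumIndicator B' j x ∂iidMeasure ν ι := by
  have key : ∀ B : Finset ι, _ := fun B : Finset ι =>
    measureReal_eq_integral_charFun (iidMeasure ν ι) (S := fun x => ∑ i ∈ B, x i)
      Measurable.of_discrete one_pos j (ae_of_all _ fun _ => by simp)
  have h1 := key B
  rw [charFun_map_sum, h, ← charFun_map_sum B', ← key B'] at h1
  rw [integral_sumIndicator_eq, integral_sumIndicator_eq]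
  have h2 : (2 * Real.pi / (1 : ℕ) : ℂ) ≠ 0 := by simp [Real.pi_ne_zero]
  exact_mod_cast mul_left_cancel₀ h2 h1

end CyclicBlocks

/-! ### Elementary consequences of mean one and positive variance. -/

section OffspringLaw

theorem exists_offspring_ne_zero {ν : Measure ℕ} (hmean : ∫ i : ℕ, (i : ℝ) ∂ν = 1) :
    ∃ a, 1 ≤ a ∧ ν {a} ≠ 0 := by
  by_contra! h
  have h1 : ∀ᵐ i : ℕ ∂ν, (i : ℝ) = 0 := by
    rw [ae_iff_of_countable]
    intro i hi
    by_contra hne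
    exact hi (h i (Nat.one_le_iff_ne_zero.2 (by simpa using hne)))
  rw [integral_eq_zero_of_ae h1] at hmean
  exact zero_ne_one hmean

theorem offspringSpan_pos {ν : Measure ℕ} (hmean : ∫ i : ℕ, (i : ℝ) ∂ν = 1) : 0 < offspringSpan ν := by
  obtain ⟨a, ha, hν⟩ := exists_offspring_ne_zero hmean
  refine Nat.pos_of_ne_zero fun h => ?_
  have := Nat.setGcd_eq_zero_iff.1 h (⟨ha, hν⟩ : a ∈ {i | 1 ≤ i ∧ ν {i} ≠ 0})
  rw [Set.mem_singleton_iff] at this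
  omega

variable {ν : Measure ℕ} [IsProbabilityMeasure ν]

/-- A variable that is at least one with mean one is constant, contrary to positive variance. -/
theorem offspring_zero_ne_zero (hL2 : MemLp (fun i : ℕ => (i : ℝ)) 2 ν)
    (hmean : ∫ i : ℕ, (i : ℝ) ∂ν = 1) (hvar : 0 < variance (fun i : ℕ => (i : ℝ)) ν) :
    ν {0} ≠ 0 := by
  intro h0
  have hint : Integrable (fun i : ℕ => (i : ℝ)) ν := hL2.integrable (by norm_num)
  have h1 : ∀ᵐ i ∂ν, i ≠ 0 := by
    rw [ae_iff]
    simpa using h0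
  have h2 : 0 ≤ᵐ[ν] fun i : ℕ => (i : ℝ) - 1 := by
    filter_upwards [h1] with i hi
    have : (1 : ℝ) ≤ i := by exact_mod_cast Nat.one_le_iff_ne_zero.2 hi
    simpa using this
  have h3 : ∫ i : ℕ, ((i : ℝ) - 1) ∂ν = 0 := by
    rw [integral_sub hint (integrable_const _), hmean]
    simp
  have h4 := (integral_eq_zero_iff_of_nonneg_ae h2 (hint.sub (integrable_const _))).1 h3
  rw [variance_eq_integral Measurable.of_discrete.aemeasurable, hmean] at hvar
  refine hvar.ne' (integral_eq_zero_of_ae ?_)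
  filter_upwards [h4] with i hi
  simpa using hi

/-- There are at least two atoms, at `0` and at some `a ≥ 1`, and every atom misses the mass of one
of them. This makes `π(T)` exponentially small in the size of `T`. -/
theorem exists_offspring_real_le (h0 : ν {0} ≠ 0) (hmean : ∫ i : ℕ, (i : ℝ) ∂ν = 1) :
    ∃ ρ : ℝ, 0 ≤ ρ ∧ ρ < 1 ∧ ∀ j, ν.real {j} ≤ ρ := by
  obtain ⟨a, ha, hν⟩ := exists_offspring_ne_zero hmean
  have hp0 : 0 < ν.real {0} := ENNReal.toReal_pos h0 (measure_ne_top _ _)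
  have hpa : 0 < ν.real {a} := ENNReal.toReal_pos hν (measure_ne_top _ _)
  have hpair : ∀ i j, i ≠ j → ν.real {i} + ν.real {j} ≤ 1 := fun i j hij => by
    rw [← measureReal_union (by simpa using hij) (measurableSet_singleton j)]
    exact measureReal_le_one
  refine ⟨1 - min (ν.real {0}) (ν.real {a}), ?_, ?_, fun j => ?_⟩
  · have := (min_le_left (ν.real {0}) (ν.real {a})).trans measureReal_le_one
    linarith
  · have := lt_min hp0 hpa
    linarith
  · rcases eq_or_ne j 0 with rfl | hj
    · have := hpair 0 a (by omega)
      have := min_le_right (ν.real {0}) (ν.real {a})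
      linarith
    · have := hpair j 0 hj
      have := min_le_left (ν.real {0}) (ν.real {a})
      linarith

end OffspringLaw

/-! ### The uniform quantitative bound for fringe subtree counts. -/

section Bound

theorem list_prod_toReal_le {ν : Measure ℕ} {ρ : ℝ} (hρ : 0 ≤ ρ) (h : ∀ j, ν.real {j} ≤ ρ) (p : List ℕ) :
    ((p.map fun d => ν {d}).prod).toReal ≤ ρ ^ p.length := by
  induction p with
  | nil => simp
  | cons d p ih =>
    rw [List.map_cons, List.prod_cons, ENNReal.toReal_mul, List.length_cons, pow_succ']
    exact mul_le_mul (h d) ih ENNReal.toReal_nonneg hρ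

theorem offspringSpan_dvd_sum {ν : Measure ℕ} {p : List ℕ} (h : (p.map fun d => ν {d}).prod ≠ 0) :
    offspringSpan ν ∣ p.sum := by
  refine List.dvd_sum fun d hd => ?_
  rcases Nat.eq_zero_or_pos d with rfl | hd0
  · exact dvd_zero _
  · refine Nat.setGcd_dvd_of_mem ⟨hd0, fun h0 => h (List.prod_eq_zero ?_)⟩
    exact List.mem_map.2 ⟨d, hd, h0⟩

open Classical in
theorem abs_cond_cyclicCount_sub_poisson_le (ν : Measure ℕ) [IsProbabilityMeasure ν]
    {n : ℕ} [NeZero n] {p : List ℕ} {s : ℕ} {C₀ θ : ℝ} {r : ℝ≥0}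
    (hp : ∀ m, 0 < m → m < p.length → ¬ p.drop m <+: p) (hp0 : 0 < p.length)
    (hn : 8 * p.length ≤ n)
    (hq : 0 < ∫ x, sumIndicator Finset.univ s x ∂iidMeasure ν (Fin n))
    (hB : ∀ B : Finset (Fin n), n ≤ 8 * B.card → ∀ j, ∫ x, sumIndicator B j x ∂iidMeasure ν (Fin n) ≤
      C₀ * ∫ x, sumIndicator Finset.univ s x ∂iidMeasure ν (Fin n))
    (hC₀ : 1 ≤ C₀)
    (hθ : ∀ i : Fin n, ∫ x, sumIndicator (cyclicBlock p.length i) p.sum x ∂iidMeasure ν (Fin n) = θ)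
    (has : p.sum ≤ s) (hr : (r : ℝ) = n * ((p.map fun d => ν {d}).prod).toReal) (hr0 : 0 < r)
    (S : Set ℕ) :
    |(ProbabilityTheory.cond (iidMeasure ν (Fin n)) {x | ∑ i, x i = s}).real
        {x | cyclicCount p x ∈ S} - (poissonMeasure r).real S| ≤
      8 * C₀ * (2 * p.length : ℕ) * √(((p.map fun d => ν {d}).prod).toReal / θ) := by
  have h := abs_cond_sub_poisson_le (ι := Fin n) ν
    (ev := fun i => {x | OccursAt p x i}) (blk := cyclicBlock p.length) (a := p.sum) (s := s)
    (D := 2 * p.length) (A := Finset.univ.filter fun i => i.val < n / 2)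
    (C₀ := C₀) (p := ((p.map fun d => ν {d}).prod).toReal) (θ := θ) (r := r)
    (dependsOn_occursAt p) (fun i x hx => sum_cyclicBlock (by omega) hx)
    (fun i => Finset.card_pos.1 (by rw [card_cyclicBlock (by omega)]; exact hp0))
    (fun i j hij hd => disjoint_occursAt hp hij hd)
    (fun i => by convert card_not_disjoint_cyclicBlock_le p.length i)
    (fun i hi => cyclicBlock_subset_of_lt (by omega) (by simpa using hi))
    (fun i hi => cyclicBlock_subset_of_le (by omega) (by simpa using hi))
    hq
    (by
      rw [compl_compl]
      refine hB _ ?_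
      rw [Finset.card_attachFin, Nat.card_Ico]
      omega)
    (by
      rw [compl_compl]
      refine hB _ ?_
      rw [Finset.card_attachFin, Nat.card_Ico]
      omega)
    hC₀
    (fun i => by rw [measureReal_def, iidMeasure_occursAt ν (by omega) i])
    hθ has (by rw [hr, Fintype.card_fin]) hr0 S
  have e : {x : Fin n → ℕ | cyclicCount p x ∈ S} = {x | (Finset.univ.filter fun i =>
      x ∈ {x : Fin n → ℕ | OccursAt p x i}).card ∈ S} := by
    ext x
    simp only [Set.mem_ofPred_eq, cyclicCount]
  rw [e]
  exact h

theorem eq_dirac_zero_of_measure_compl (μ : Measure ℕ) [IsProbabilityMeasure μ]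
    (h : μ {0}ᶜ = 0) : μ = Measure.dirac 0 := by
  have h0 : μ {0} = 1 := by
    have := prob_compl_eq_zero_iff (μ := μ) (measurableSet_singleton 0)
    exact this.1 h
  refine Measure.ext_of_singleton fun j => ?_
  rcases eq_or_ne j 0 with rfl | hj
  · simp [h0]
  · rw [measure_mono_null (by simpa using hj.symm) h]
    simp [hj.symm]

theorem poissonMeasure_zero_eq_dirac : poissonMeasure 0 = Measure.dirac 0 := by
  refine eq_dirac_zero_of_measure_compl _ ?_
  rw [prob_compl_eq_zero_iff (measurableSet_singleton 0), poissonMeasure_singleton]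
  simp

theorem tvDist_le {μ₁ μ₂ : Measure ℕ} {c : ℝ} (hc : ∀ A, |μ₁.real A - μ₂.real A| ≤ c) :
    tvDist μ₁ μ₂ ≤ c :=
  ciSup_le hc

theorem treeCode_sum_add_one (f : PlaneForest) :
    (PlaneForest.treeCode f).sum + 1 = (PlaneForest.treeCode f).length := by
  rw [PlaneForest.treeCode, List.sum_cons, List.length_cons, PlaneForest.length_code]

theorem size_eq_length_treeCode {T : PlaneTree} {f : PlaneForest}
    (h : (T.nodes : Set (List ℕ)) = PlaneForest.nodeSet f) :
    T.size = (PlaneForest.treeCode f).length := by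
  have := PlaneForest.encard_nodeSet f
  rw [← h, Set.encard_coe_eq_coe_finsetCard] at this
  exact_mod_cast this

/-- A quantitative Poisson approximation for the number of fringe subtrees of a given shape. -/
theorem exists_tvDist_fringeCountLaw_le (ν : Measure ℕ) [IsProbabilityMeasure ν]
    (hL2 : MemLp (fun i : ℕ => (i : ℝ)) 2 ν) (hmean : ∫ i : ℕ, (i : ℝ) ∂ν = 1)
    (hvar : 0 < variance (fun i : ℕ => (i : ℝ)) ν) :
    ∃ C η : ℝ, 0 ≤ C ∧ 0 ≤ η ∧ η < 1 ∧ ∃ m₀ : ℕ, ∀ n k : ℕ, m₀ ≤ k → 8 * k ≤ n →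
      n ≡ 1 [MOD offspringSpan ν] → ∀ T : PlaneTree, T.size = k →
      IsProbabilityMeasure (fringeCountLaw ν n T) ∧
      tvDist (fringeCountLaw ν n T) (poissonMeasure (n * treeProb ν T)) ≤ C * (k ^ 2 * η ^ k) := by
  classical
  have h0 := offspring_zero_ne_zero hL2 hmean hvar
  have hh := offspringSpan_pos hmean
  obtain ⟨ρ, hρ0, hρ1, hρ⟩ := exists_offspring_real_le h0 hmean
  obtain ⟨U, hU0, hU⟩ := exists_integral_sumIndicator_le h0 hh
  obtain ⟨c, hc0, m₀, hc⟩ := exists_le_integral_sumIndicator hL2 hmean hvar h0 hh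
  -- At least `n / 8` free variables have point probabilities at most `U / √(n / 8)`, compared with
  -- `c / √n` for the conditioning event; the factor `3` bounds `√8`.
  set K := max 1 (3 * U / c) with hK
  refine ⟨16 * K / √c, √ρ, by positivity, Real.sqrt_nonneg _,
    (Real.sqrt_lt' one_pos).2 (by rwa [one_pow]), max m₀ 1, fun n k hmk hkn hmod T hT => ?_⟩
  have hk1 : 1 ≤ k := (le_max_right _ _).trans hmk
  have hmk' : m₀ ≤ k := (le_max_left _ _).trans hmk
  have : NeZero n := ⟨by omega⟩
  obtain ⟨f, hf⟩ := T.exists_nodes_eq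
  set p := PlaneForest.treeCode f with hp
  have hlen : p.length = k := by rw [← hT, size_eq_length_treeCode hf]
  have hsum : p.sum + 1 = k := by rw [← hlen, treeCode_sum_add_one]
  have hn0 : (0 : ℝ) < n := by exact_mod_cast (by omega : 0 < n)
  have hqlow : c / √n ≤ ∫ x, sumIndicator Finset.univ (n - 1) x ∂iidMeasure ν (Fin n) := by
    have := hc (Fin n) Finset.univ (by rw [Finset.card_univ, Fintype.card_fin]; omega)
      (by rwa [Finset.card_univ, Fintype.card_fin])
    rwa [Finset.card_univ, Fintype.card_fin] at this
  have hq : 0 < ∫ x, sumIndicator Finset.univ (n - 1) x ∂iidMeasure ν (Fin n) :=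
    lt_of_lt_of_le (by positivity) hqlow
  have hset : {x : Fin n → ℕ | n = 1 + ∑ i, x i} = {x | ∑ i, x i = n - 1} := by
    ext x; simp only [Set.mem_ofPred_eq]; omega
  have hlaw := PlaneForest.fringeCountLaw_eq ν T f hf (n := n) (by rw [← hp]; omega)
  rw [hset] at hlaw
  have hne : iidMeasure ν (Fin n) {x | ∑ i, x i = n - 1} ≠ 0 := by
    rw [integral_sumIndicator_eq, measureReal_def] at hq
    exact (ENNReal.toReal_pos_iff.1 hq).1.ne'
  have hcond : IsProbabilityMeasure
      (ProbabilityTheory.cond (iidMeasure ν (Fin n)) {x | ∑ i, x i = n - 1}) :=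
    cond_isProbabilityMeasure hne
  have hprob : IsProbabilityMeasure (fringeCountLaw ν n T) := by
    rw [hlaw]
    exact Measure.isProbabilityMeasure_map Measurable.of_discrete.aemeasurable
  refine ⟨hprob, ?_⟩
  have htp := PlaneForest.treeProb_eq ν T f hf
  rw [← hp] at htp
  set π := ((p.map fun d => ν {d}).prod).toReal with hπ
  have htp' : (treeProb ν T : ℝ) = π := by rw [hπ, ← htp]; rfl
  -- For an impossible shape both laws are the point mass at zero. This case is separate because `k`
  -- need not be congruent to `1` modulo the span, and the lower bound for `θ` may fail.
  rcases eq_or_ne (treeProb ν T) 0 with hz | hz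
  · have hdir : fringeCountLaw ν n T = Measure.dirac 0 := by
      refine eq_dirac_zero_of_measure_compl _ ?_
      rw [hlaw, Measure.map_apply Measurable.of_discrete MeasurableSet.of_discrete]
      refine cond_absolutelyContinuous ?_
      refine measure_mono_null (t := ⋃ i, {x : Fin n → ℕ | OccursAt p x i}) ?_
        (measure_iUnion_null fun i => ?_)
      · intro x hx
        simp only [Set.mem_preimage, Set.mem_compl_iff, Set.mem_singleton_iff, cyclicCount,
          Finset.card_eq_zero] at hx
        obtain ⟨i, hi⟩ := Finset.nonempty_iff_ne_empty.2 hx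
        exact Set.mem_iUnion.2 ⟨i, (Finset.mem_filter.1 hi).2⟩
      · rw [iidMeasure_occursAt ν (by omega) i, ← htp, hz, ENNReal.coe_zero]
    rw [hdir, hz, mul_zero, poissonMeasure_zero_eq_dirac]
    refine tvDist_le fun A => ?_
    rw [sub_self, abs_zero]
    positivity
  have hpos : 0 < treeProb ν T := pos_iff_ne_zero.2 hz
  have hπ0 : 0 < π := by rw [← htp']; exact_mod_cast hpos
  -- In a tree of positive probability all child counts are multiples of the span, and they sum to
  -- `k - 1`.
  have hkmod : k ≡ 1 [MOD offspringSpan ν] := by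
    refine ((Nat.modEq_iff_dvd' hk1).2 ?_).symm
    have : k - 1 = p.sum := by omega
    rw [this]
    refine offspringSpan_dvd_sum ?_
    rw [← htp]
    exact_mod_cast hz
  set θ := ∫ x, sumIndicator (cyclicBlock p.length (0 : Fin n)) p.sum x ∂iidMeasure ν (Fin n) with hθ
  have hcard : ∀ i : Fin n, (cyclicBlock p.length i).card = k := fun i => by
    rw [card_cyclicBlock (by omega), hlen]
  have hθlow : c / √k ≤ θ := by
    have := hc (Fin n) (cyclicBlock p.length (0 : Fin n)) (by rw [hcard]; exact hmk')
      (by rwa [hcard])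
    rw [hcard] at this
    have e : k - 1 = p.sum := by omega
    rwa [e] at this
  have hk0 : (0 : ℝ) < k := by exact_mod_cast hk1
  have hθ0 : 0 < θ := lt_of_lt_of_le (by positivity) hθlow
  have hB : ∀ B : Finset (Fin n), n ≤ 8 * B.card → ∀ j,
      ∫ x, sumIndicator B j x ∂iidMeasure ν (Fin n) ≤
      K * ∫ x, sumIndicator Finset.univ (n - 1) x ∂iidMeasure ν (Fin n) := by
    intro B hBn j
    refine (hU (Fin n) B j (by omega)).trans ?_
    have h1 : √(n : ℝ) ≤ 3 * √(B.card : ℝ) := by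
      rw [Real.sqrt_le_left (by positivity), mul_pow, Real.sq_sqrt (Nat.cast_nonneg _)]
      have : (n : ℝ) ≤ 8 * B.card := by exact_mod_cast hBn
      have : (0 : ℝ) ≤ B.card := Nat.cast_nonneg _
      linarith
    have hb0 : 0 < √(B.card : ℝ) := Real.sqrt_pos.2 (by exact_mod_cast (by omega : 0 < B.card))
    have hs0 : 0 < √(n : ℝ) := Real.sqrt_pos.2 hn0
    calc U / √(B.card : ℝ) ≤ 3 * U / √n := by
          rw [div_le_div_iff₀ hb0 hs0]
          nlinarith
      _ = 3 * U / c * (c / √n) := by field_simp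
      _ ≤ K * ∫ x, sumIndicator Finset.univ (n - 1) x ∂iidMeasure ν (Fin n) :=
          mul_le_mul (le_max_right _ _) hqlow (by positivity) (by positivity)
  -- Here `π ≤ ρ ^ k` meets `θ ≥ c / √k`; the generous `√k ≤ k ^ 2` is chosen to have a simple
  -- square root.
  have hsqrt : √(π / θ) ≤ k * √ρ ^ k / √c := by
    have h1 : π / θ ≤ k ^ 2 * ρ ^ k / c := by
      have h2 : π ≤ ρ ^ k := by rw [← hlen]; exact list_prod_toReal_le hρ0 hρ p
      have h3 : √(k : ℝ) ≤ k ^ 2 := by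
        rw [Real.sqrt_le_left (by positivity), ← pow_mul]
        exact le_self_pow₀ (by exact_mod_cast hk1) (by norm_num)
      calc π / θ ≤ ρ ^ k / (c / √k) := by gcongr
        _ = √k * ρ ^ k / c := by field_simp
        _ ≤ k ^ 2 * ρ ^ k / c := by gcongr
    refine (Real.sqrt_le_sqrt h1).trans_eq ?_
    rw [Real.sqrt_div (by positivity), Real.sqrt_mul (by positivity), Real.sqrt_sq hk0.le]
    congr 2
    rw [← Real.sqrt_sq (pow_nonneg (Real.sqrt_nonneg ρ) k), ← pow_mul, mul_comm k 2, pow_mul,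
      Real.sq_sqrt hρ0]
  refine tvDist_le fun S => ?_
  have hmain := abs_cond_cyclicCount_sub_poisson_le ν (p := p) (s := n - 1) (C₀ := K) (θ := θ)
    (r := n * treeProb ν T) (PlaneForest.treeCode_drop_not_isPrefix f) (by omega) (by omega) hq hB
    (le_max_left _ _) (fun i => integral_sumIndicator_congr_card ν (by rw [hcard, hcard]) _)
    (by omega) (by push_cast; rw [htp']) (mul_pos (by exact_mod_cast (by omega : 0 < n)) hpos) S
  have e : (fringeCountLaw ν n T).real S =
      (ProbabilityTheory.cond (iidMeasure ν (Fin n)) {x | ∑ i, x i = n - 1}).real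
        {x | cyclicCount p x ∈ S} := by
    rw [hlaw, map_measureReal_apply Measurable.of_discrete MeasurableSet.of_discrete]
    rfl
  rw [e]
  refine hmain.trans ?_
  rw [hlen]
  calc 8 * K * (2 * k : ℕ) * √(π / θ) ≤ 8 * K * (2 * k : ℕ) * (k * √ρ ^ k / √c) := by gcongr
    _ = 16 * K / √c * (k ^ 2 * √ρ ^ k) := by push_cast; ring

end Bound

/-! ### Total variation distance and integrals of bounded functions. -/

section TotalVariation

theorem abs_sub_le_tvDist (μ₁ μ₂ : Measure ℕ) [IsProbabilityMeasure μ₁] [IsProbabilityMeasure μ₂]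
    (A : Set ℕ) : |μ₁.real A - μ₂.real A| ≤ tvDist μ₁ μ₂ := by
  refine le_ciSup (f := fun A => |μ₁.real A - μ₂.real A|) ⟨1, ?_⟩ A
  rintro _ ⟨A, rfl⟩
  exact abs_sub_le_of_nonneg_of_le measureReal_nonneg measureReal_le_one measureReal_nonneg
    measureReal_le_one

theorem tvDist_nonneg (μ₁ μ₂ : Measure ℕ) : 0 ≤ tvDist μ₁ μ₂ :=
  Real.iSup_nonneg fun _ => abs_nonneg _

/-- Layer-cake formula for `F + M`, with values in `[0, 2 * M]`: the two integrals differ by at most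
the distance at each level. -/
theorem abs_integral_sub_le_tvDist (μ₁ μ₂ : Measure ℕ) [IsProbabilityMeasure μ₁]
    [IsProbabilityMeasure μ₂] {F : ℕ → ℝ} {M : ℝ} (hF : ∀ i, |F i| ≤ M) :
    |∫ i, F i ∂μ₁ - ∫ i, F i ∂μ₂| ≤ 2 * M * tvDist μ₁ μ₂ := by
  have hM : 0 ≤ M := (abs_nonneg _).trans (hF 0)
  have hint : ∀ (μ : Measure ℕ) [IsProbabilityMeasure μ], Integrable F μ := fun μ _ =>
    Integrable.of_bound Measurable.of_discrete.aestronglyMeasurable M (ae_of_all _ hF)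
  have key : ∀ (μ : Measure ℕ) [IsProbabilityMeasure μ],
      ∫ i, F i ∂μ + M = ∫ t in Set.Ioc 0 (2 * M), μ.real {i | t ≤ F i + M} := by
    intro μ _
    rw [← Integrable.integral_eq_integral_Ioc_meas_le (μ := μ) (f := fun i => F i + M)
      ((hint μ).add (integrable_const _))
      (ae_of_all _ fun i => by have := (abs_le.1 (hF i)).1; simp only [Pi.zero_apply]; linarith)
      (ae_of_all _ fun i => by have := (abs_le.1 (hF i)).2; simp only; linarith),
      integral_add (hint μ) (integrable_const _)]
    simp
  have hanti : ∀ (μ : Measure ℕ) [IsProbabilityMeasure μ],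
      IntegrableOn (fun t : ℝ => μ.real {i | t ≤ F i + M}) (Set.Ioc 0 (2 * M)) := by
    intro μ _
    have h : Antitone fun t : ℝ => μ.real {i | t ≤ F i + M} := fun s t hst =>
      measureReal_mono fun i hi => hst.trans hi
    exact Integrable.of_bound h.measurable.aestronglyMeasurable 1 (ae_of_all _ fun t => by
      rw [Real.norm_of_nonneg measureReal_nonneg]; exact measureReal_le_one)
  have e : ∫ i, F i ∂μ₁ - ∫ i, F i ∂μ₂ =
      ∫ t in Set.Ioc 0 (2 * M), (μ₁.real {i | t ≤ F i + M} - μ₂.real {i | t ≤ F i + M}) := by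
    rw [integral_sub (hanti μ₁) (hanti μ₂), ← key μ₁, ← key μ₂]
    ring
  rw [e, ← Real.norm_eq_abs]
  refine (norm_setIntegral_le_of_norm_le_const (C := tvDist μ₁ μ₂)
    measure_Ioc_lt_top fun t _ =>
    abs_sub_le_tvDist _ _ _).trans_eq ?_
  rw [measureReal_def, Real.volume_Ioc, sub_zero, ENNReal.toReal_ofReal (by positivity), mul_comm]

end TotalVariation

/-! ### Continuity of Poisson laws in the mean and their normal limit. -/

section PoissonLimits

open Nat in
theorem tendsto_integral_poissonMeasure (f : BoundedContinuousFunction ℕ ℝ) (μ : ℝ≥0) :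
    Tendsto (fun r : ℝ≥0 => ∫ i, f i ∂poissonMeasure r) (𝓝 μ) (𝓝 (∫ i, f i ∂poissonMeasure μ)) := by
  simp only [integral_poissonMeasure, smul_eq_mul]
  refine tendsto_tsum_of_dominated_convergence
    (bound := fun i : ℕ => ((μ : ℝ) + 1) ^ i / (i)! * ‖f‖) ?_ ?_ ?_
  · exact (Real.summable_pow_div_factorial _).mul_right _
  · intro i
    have : Continuous fun r : ℝ≥0 => Real.exp (-r) * (r : ℝ) ^ i / (i)! * f i := by fun_prop
    exact this.tendsto μ
  · filter_upwards [gt_mem_nhds (lt_add_one μ)] with r hr i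
    have hr' : (r : ℝ) ≤ μ + 1 := by exact_mod_cast hr.le
    rw [norm_mul, norm_div, norm_mul, norm_pow, Real.norm_of_nonneg (Real.exp_pos _).le,
      Real.norm_of_nonneg r.coe_nonneg, Real.norm_of_nonneg (Nat.cast_nonneg _)]
    have h1 : Real.exp (-r) ≤ 1 := Real.exp_le_one_iff.2 (neg_nonpos.2 r.2)
    have h2 : Real.exp (-r) * (r : ℝ) ^ i ≤ 1 * (μ + 1) ^ i := by gcongr
    rw [one_mul] at h2
    gcongr
    exact f.norm_coe_le_norm i

theorem charFun_poissonMeasure_standardized (r : ℝ≥0) (t : ℝ) :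
    charFun ((poissonMeasure r).map fun m : ℕ => ((m : ℝ) - r) / √r) t =
      Complex.exp (r * (Complex.exp ((t / √r : ℝ) * Complex.I) - 1 - (t / √r : ℝ) * Complex.I)) := by
  have h := charFun_map_cast_poissonMeasure r (t / √r)
  rw [charFun_map_natCast] at h
  rw [charFun_apply_real, integral_map Measurable.of_discrete.aemeasurable (by fun_prop), mul_sub,
    Complex.exp_sub, ← h, ← integral_div]
  refine integral_congr_ae (ae_of_all _ fun k => ?_)
  simp only
  rw [← Complex.exp_sub]
  congr 1
  push_cast
  ring

/-- In the exponent, the Taylor expansion of `exp` to second order produces `-t ^ 2 / 2`, and the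
remainder is at most `r * (|t| / √r) ^ 3 = |t| ^ 3 / √r`. -/
theorem tendsto_charFun_poissonMeasure_standardized (t : ℝ) :
    Tendsto (fun r : ℝ≥0 => charFun ((poissonMeasure r).map fun m : ℕ => ((m : ℝ) - r) / √r) t)
      atTop (𝓝 (charFun (gaussianReal 0 1) t)) := by
  simp only [charFun_poissonMeasure_standardized, charFun_gaussianReal]
  refine (Complex.continuous_exp.tendsto _).comp ?_
  have hs : Tendsto (fun r : ℝ≥0 => √(r : ℝ)) atTop atTop :=
    Real.tendsto_sqrt_atTop.comp (NNReal.tendsto_coe_atTop.2 tendsto_id)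
  have hlim : Tendsto (fun r : ℝ≥0 => |t| ^ 3 / √(r : ℝ)) atTop (𝓝 0) := hs.const_div_atTop _
  rw [tendsto_iff_norm_sub_tendsto_zero]
  refine squeeze_zero' (Eventually.of_forall fun _ => norm_nonneg _) ?_ hlim
  filter_upwards [hs.eventually_ge_atTop (max 1 |t|)] with r hr
  have hr1 : 0 < √(r : ℝ) := lt_of_lt_of_le one_pos ((le_max_left _ _).trans hr)
  have hr2 : √(r : ℝ) ^ 2 = r := Real.sq_sqrt r.2
  have hnorm : ‖((t / √r : ℝ) : ℂ) * Complex.I‖ = |t| / √r := by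
    rw [norm_mul, Complex.norm_I, mul_one, Complex.norm_real, Real.norm_eq_abs, abs_div,
      abs_of_pos hr1]
  have hb := Complex.exp_bound (x := ((t / √r : ℝ) : ℂ) * Complex.I) (by
    rw [hnorm, div_le_one hr1]; exact (le_max_right _ _).trans hr) (n := 3) (by norm_num)
  rw [hnorm] at hb
  have hr3 : (√(r : ℝ) : ℂ) ^ 2 = r := by exact_mod_cast congrArg Complex.ofReal hr2
  have hr4 : (√(r : ℝ) : ℂ) ≠ 0 := by exact_mod_cast hr1.ne'
  have e : (r : ℂ) * (Complex.exp ((t / √r : ℝ) * Complex.I) - 1 - (t / √r : ℝ) * Complex.I) -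
      (t * (0 : ℝ) * Complex.I - (1 : ℝ≥0) * t ^ 2 / 2) =
      r * (Complex.exp ((t / √r : ℝ) * Complex.I) - ∑ m ∈ Finset.range 3,
        ((t / √r : ℝ) * Complex.I) ^ m / (m.factorial : ℂ)) := by
    simp only [Finset.sum_range_succ, Finset.sum_range_zero, Nat.factorial, mul_pow, Complex.I_sq]
    rw [← hr3]
    push_cast
    field_simp
    ring
  rw [e, norm_mul]
  have h5 : ‖((r : ℝ) : ℂ)‖ = √(r : ℝ) ^ 2 := by
    rw [Complex.norm_real, Real.norm_of_nonneg r.coe_nonneg, hr2]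
  rw [show ((r : ℂ)) = ((r : ℝ) : ℂ) from rfl, h5]
  refine (mul_le_mul_of_nonneg_left hb (by positivity)).trans ?_
  have h6 : (((3 : ℕ).succ : ℝ) * ((Nat.factorial 3 : ℕ) * (3 : ℕ) : ℝ)⁻¹) ≤ 1 := by
    norm_num [Nat.factorial]
  calc √(r : ℝ) ^ 2 * ((|t| / √r) ^ 3 * _) ≤ √(r : ℝ) ^ 2 * ((|t| / √r) ^ 3 * 1) := by gcongr
    _ = |t| ^ 3 / √r := by field_simp

theorem tendsto_integral_poissonMeasure_standardized (f : BoundedContinuousFunction ℝ ℝ) :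
    Tendsto (fun r : ℝ≥0 => ∫ m : ℕ, f (((m : ℝ) - r) / √r) ∂poissonMeasure r) atTop
      (𝓝 (∫ x, f x ∂gaussianReal 0 1)) := by
  refine tendsto_of_seq_tendsto fun u hu => ?_
  have hp : ∀ n, IsProbabilityMeasure
      ((poissonMeasure (u n)).map fun m : ℕ => ((m : ℝ) - u n) / √(u n)) := fun n =>
    Measure.isProbabilityMeasure_map Measurable.of_discrete.aemeasurable
  have h := (ProbabilityMeasure.tendsto_iff_forall_integral_tendsto.1
    (ProbabilityMeasure.tendsto_of_tendsto_charFun (μ := fun n => ⟨_, hp n⟩)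
      (μ₀ := ⟨gaussianReal 0 1, inferInstance⟩)
      fun t => (tendsto_charFun_poissonMeasure_standardized t).comp hu)) f
  refine h.congr fun n => ?_
  exact integral_map Measurable.of_discrete.aemeasurable f.continuous.aestronglyMeasurable

end PoissonLimits

/-! ### Transfer of limits from the Poisson laws and the final statement. -/

theorem convergesInLaw_of_tendsto_integral {E : Type*} [TopologicalSpace E] [MeasurableSpace E]
    [OpensMeasurableSpace E] {μ : ℕ → Measure E} [∀ n, IsFiniteMeasure (μ n)] {l : Filter ℕ}
    {μ₀ : Measure E} [IsFiniteMeasure μ₀]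
    (h : ∀ f : BoundedContinuousFunction E ℝ,
      Tendsto (fun n => ∫ x, f x ∂μ n) l (𝓝 (∫ x, f x ∂μ₀))) :
    ConvergesInLaw μ l μ₀ :=
  FiniteMeasure.tendsto_iff_forall_integral_tendsto.2 h

/-- The test functions may vary with `n` under a common bound; the normal limit needs this, as its
standardization depends on `n`. -/
theorem tendsto_integral_of_tvDist {P Q : ℕ → Measure ℕ} {l : Filter ℕ}
    (hP : ∀ᶠ n in l, IsProbabilityMeasure (P n)) [∀ n, IsProbabilityMeasure (Q n)]
    (htv : Tendsto (fun n => tvDist (P n) (Q n)) l (𝓝 0)) {F : ℕ → ℕ → ℝ} {M L : ℝ}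
    (hF : ∀ n i, |F n i| ≤ M) (hQ : Tendsto (fun n => ∫ i, F n i ∂Q n) l (𝓝 L)) :
    Tendsto (fun n => ∫ i, F n i ∂P n) l (𝓝 L) := by
  have h : Tendsto (fun n => ∫ i, F n i ∂P n - ∫ i, F n i ∂Q n) l (𝓝 0) := by
    refine squeeze_zero_norm' ?_ (by simpa using htv.const_mul (2 * M))
    filter_upwards [hP] with n hn
    exact abs_integral_sub_le_tvDist _ _ (hF n)
  simpa using h.add hQ

theorem mainTheorem1 (ν : Measure ℕ) [IsProbabilityMeasure ν]
    (hL2 : MemLp (fun i : ℕ => (i : ℝ)) 2 ν)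
    (hmean : ∫ i : ℕ, (i : ℝ) ∂ν = 1)
    (hvar : 0 < variance (fun i : ℕ => (i : ℝ)) ν)
    (k : ℕ → ℕ)
    (hk : Tendsto k (alongSpan ν) atTop)
    (hkn : (fun n : ℕ => (k n : ℝ)) =o[alongSpan ν] (fun n : ℕ => (n : ℝ))) :
    Tendsto (fun n : ℕ => ⨆ T : {T : PlaneTree // T.size = k n},
        tvDist (fringeCountLaw ν n T) (poissonMeasure (n * treeProb ν T)))
      (alongSpan ν) (𝓝 0) ∧
    ∀ T : ℕ → PlaneTree, (∀ᶠ n in alongSpan ν, (T n).size = k n) →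
      (Tendsto (fun n : ℕ => n * treeProb ν (T n)) (alongSpan ν) (𝓝 0) →
        Tendsto (fun n : ℕ => (fringeCountLaw ν n (T n)).real {0}) (alongSpan ν) (𝓝 1)) ∧
      (∀ μ : ℝ≥0, 0 < μ →
        Tendsto (fun n : ℕ => n * treeProb ν (T n)) (alongSpan ν) (𝓝 μ) →
        ConvergesInLaw (fun n : ℕ => fringeCountLaw ν n (T n)) (alongSpan ν) (poissonMeasure μ)) ∧
      (Tendsto (fun n : ℕ => n * treeProb ν (T n)) (alongSpan ν) atTop →
        ConvergesInLaw
          (fun n : ℕ => (fringeCountLaw ν n (T n)).map (fun m : ℕ =>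
            ((m : ℝ) - n * treeProb ν (T n)) / Real.sqrt (n * treeProb ν (T n))))
          (alongSpan ν) (gaussianReal 0 1)) := by
  obtain ⟨C, η, hC, hη0, hη1, m₀, hbound⟩ := exists_tvDist_fringeCountLaw_le ν hL2 hmean hvar
  have hlim : Tendsto (fun n => C * ((k n : ℝ) ^ 2 * η ^ k n)) (alongSpan ν) (𝓝 0) := by
    have h := (tendsto_pow_const_mul_const_pow_of_abs_lt_one 2
      (by rwa [abs_of_nonneg hη0] : |η| < 1)).const_mul C
    rw [mul_zero] at h
    exact h.comp hk
  have hev : ∀ᶠ n in alongSpan ν, ∀ T : PlaneTree, T.size = k n →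
      IsProbabilityMeasure (fringeCountLaw ν n T) ∧
      tvDist (fringeCountLaw ν n T) (poissonMeasure (n * treeProb ν T)) ≤
        C * ((k n : ℝ) ^ 2 * η ^ k n) := by
    have hmod : ∀ᶠ n in alongSpan ν, n ≡ 1 [MOD offspringSpan ν] :=
      mem_inf_of_right (mem_principal_self _)
    -- All that is used of `k = o(n)` is `8 * k ≤ n`, which leaves enough free variables beside the
    -- blocks.
    filter_upwards [hk.eventually_ge_atTop m₀, hkn.def (by norm_num : (0 : ℝ) < 1 / 8), hmod]
      with n h1 h2 h3
    rw [Real.norm_of_nonneg (Nat.cast_nonneg _), Real.norm_of_nonneg (Nat.cast_nonneg _)] at h2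
    have h4 : 8 * k n ≤ n := by
      have : (8 : ℝ) * k n ≤ n := by linarith
      exact_mod_cast this
    exact hbound n (k n) h1 h4 h3
  refine ⟨?_, fun T hT => ?_⟩
  · refine tendsto_of_tendsto_of_tendsto_of_le_of_le' tendsto_const_nhds hlim
      (Eventually.of_forall fun n => Real.iSup_nonneg fun _ => tvDist_nonneg _ _) ?_
    filter_upwards [hev] with n hn
    exact Real.iSup_le (fun T => (hn T T.2).2) (by positivity)
  have hP : ∀ᶠ n in alongSpan ν, IsProbabilityMeasure (fringeCountLaw ν n (T n)) := by
    filter_upwards [hev, hT] with n h1 h2 using (h1 _ h2).1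
  have htv : Tendsto (fun n : ℕ => tvDist (fringeCountLaw ν n (T n))
      (poissonMeasure (n * treeProb ν (T n)))) (alongSpan ν) (𝓝 0) := by
    refine tendsto_of_tendsto_of_tendsto_of_le_of_le' tendsto_const_nhds hlim
      (Eventually.of_forall fun n => tvDist_nonneg _ _) ?_
    filter_upwards [hev, hT] with n h1 h2 using (h1 _ h2).2
  refine ⟨fun h => ?_, fun μ _ h => ?_, fun h => ?_⟩
  · have h1 : Tendsto (fun n : ℕ => (poissonMeasure (n * treeProb ν (T n))).real {0})
        (alongSpan ν) (𝓝 1) := by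
      have h2 : Continuous fun r : ℝ≥0 => Real.exp (-(r : ℝ)) := by fun_prop
      have h3 := (h2.tendsto 0).comp h
      simp only [NNReal.coe_zero, neg_zero, Real.exp_zero] at h3
      refine h3.congr fun n => ?_
      rw [poissonMeasure_real_singleton]
      simp
    have h2 : ∀ P : Measure ℕ, P.real {0} = ∫ i, ({0} : Set ℕ).indicator 1 i ∂P := fun P =>
      (integral_indicator_one (measurableSet_singleton 0)).symm
    simp only [h2] at h1 ⊢
    refine tendsto_integral_of_tvDist hP htv (F := fun _ => ({0} : Set ℕ).indicator 1) (M := 1)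
      (fun _ i => ?_) h1
    by_cases hi : i = 0 <;> simp [hi]
  · refine convergesInLaw_of_tendsto_integral fun f => ?_
    exact tendsto_integral_of_tvDist hP htv (F := fun _ => f) (M := ‖f‖)
      (fun _ i => f.norm_coe_le_norm i) ((tendsto_integral_poissonMeasure f μ).comp h)
  · refine convergesInLaw_of_tendsto_integral fun f => ?_
    have h1 := tendsto_integral_of_tvDist hP htv (F := fun n m => f (((m : ℝ) - n * treeProb ν (T n)) /
      Real.sqrt (n * treeProb ν (T n)))) (M := ‖f‖) (fun _ i => f.norm_coe_le_norm _)
      (((tendsto_integral_poissonMeasure_standardized f).comp h).congr fun n => by simp)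
    refine h1.congr fun n => ?_
    exact (integral_map Measurable.of_discrete.aemeasurable
      f.continuous.aestronglyMeasurable).symm
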